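/- Let $\mathscr D\colon \mathcal{C}at^{\mathrm{op}}\to\mathcal{CAT}$ be a stable derivator, that is, a 2-functor satisfying the axioms (Der1)–(Der4), such that the category $\mathscr D(\mathbb 1)$ has a zero object and a coherent square $X\in\mathscr D(\square)$, $\square=\mathbb 2\times\mathbb 2$, is cartesian if and only if it is cocartesian. (It is not assumed that $\mathscr D$ is strong.) Write $u^*$ for restriction along $u$, and $u_!\dashv u^*\dashv u_*$ for the Kan extensions. Let $\ulcorner=\square\setminus\{(1,1)\}$ and let $\Sigma=(1,1)^*(i_\ulcorner)_!(0,0)_*$ be the suspension functor of $\mathscr D(\mathbb 1)$; every cocartesian square $Q$ with $Q_{0,1}$ and $Q_{1,0}$ zero objects induces a canonical isomorphism $Q_{1,1}\cong\Sigma Q_{0,0}$. A cofiber sequence is an object $X\in\mathscr D(\mathbb 2\times\mathbb 3)$ whose two squares are cocartesian and for which $X_{0,2}$ and $X_{1,0}$ are zero objects; a distinguished triangle in $\mathscr D(\mathbb 1)$ is a triangle isomorphic to the triangle $$X_{0,0}\to X_{0,1}\to X_{1,1}\to X_{1,2}\cong\Sigma X_{0,0}$$ of a cofiber sequence $X$,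 where the last isomorphism is induced by the outer rectangle of $X$. Let $\mathscr D^{\mathrm{op}}(A)=\mathscr D(A^{\mathrm{op}})^{\mathrm{op}}$ be the opposite derivator; its cofiber sequences are the fiber sequences of $\mathscr D$, and its suspension functor is the loop functor $\Omega$ of $\mathscr D$. A triangle of $\mathscr D^{\mathrm{op}}(\mathbb 1)$ is a diagram $\Omega w\to y\to z\to w$ in $\mathscr D(\mathbb 1)$. It corresponds to the triangle $x\to y\to z\to\Sigma x$ of $\mathscr D(\mathbb 1)$ when, up to isomorphism of triangles, the latter is obtained from it by means of the isomorphisms $x\cong\Omega w$ and $w\cong\Sigma x$ induced by one bicartesian square $Q$ with $Q_{0,0}=x$, $Q_{1,1}=w$ and $Q_{0,1},Q_{1,0}$ zero objects. Here $Q$ is regarded as a square in $\mathscr D^{\mathrm{op}}$ through the isomorphism $\square\cong\square^{\mathrm{op}}$ which fixes $(0,1)$ and $(1,0)$ and exchanges $(0,0)$ and $(1,1)$. Then $\mathscr D(\mathbb 1)$ is preadditive, and the distinguished triangles of $\mathscr D^{\mathrm{op}}(\mathbb 1)$ are the negatives of those of $\mathscr D(\mathbb 1)$. Precisely, for every preadditive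 structure on $\mathscr D(\mathbb 1)$ and all signs $\varepsilon_1,\varepsilon_2,\varepsilon_3\in\{1,-1\}$ with $\varepsilon_1\varepsilon_2\varepsilon_3=-1$: 1. for every triangle $T=(f,g,h)$ of $\mathscr D(\mathbb 1)$, the triangle $(\varepsilon_1f,\varepsilon_2g,\varepsilon_3h)$ is distinguished in $\mathscr D(\mathbb 1)$ if and only if $T$ corresponds to some distinguished triangle of $\mathscr D^{\mathrm{op}}(\mathbb 1)$; 2. a triangle $T'$ of $\mathscr D^{\mathrm{op}}(\mathbb 1)$ is distinguished if and only if it corresponds to some triangle $T=(f,g,h)$ of $\mathscr D(\mathbb 1)$ such that $(\varepsilon_1f,\varepsilon_2g,\varepsilon_3h)$ is distinguished in $\mathscr D(\mathbb 1)$. -/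

import Mathlib

open CategoryTheory CategoryTheory.Limits Opposite

universe w v u

namespace Derivators

/-! ### Shapes -/

/-- The terminal category `𝟙`. -/
abbrev OneCat : Type w := Discrete PUnit.{w + 1}

/-- The square `□ = 𝟚 × 𝟚` (a poset, regarded as a category). -/
abbrev Sq : Type w := ULift.{w} (Fin 2 × Fin 2)

/-- The category `𝟚 × 𝟛` (a poset, regarded as a category). -/
abbrev Rect : Type w := ULift.{w} (Fin 2 × Fin 3)

/-- The object `(i, j)` of `□`. -/
abbrev sq (i j : Fin 2) : Sq.{w} := ULift.up (i, j)

/-- The object `(i, j)` of `𝟚 × 𝟛`. -/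
abbrev rect (i : Fin 2) (j : Fin 3) : Rect.{w} := ULift.up (i, j)

/-- The full subcategory `⌜ = □ \ {(1,1)}`. -/
abbrev UL : Type w := {p : Sq.{w} // p ≠ sq 1 1}

/-- The full subcategory `⌟ = □ \ {(0,0)}`. -/
abbrev LR : Type w := {p : Sq.{w} // p ≠ sq 0 0}

/-- The inclusion `⌜ ⥤ □`. -/
def inclUL : UL.{w} ⥤ Sq.{w} := (Subtype.mono_coe _).functor

/-- The inclusion `⌟ ⥤ □`. -/
def inclLR : LR.{w} ⥤ Sq.{w} := (Subtype.mono_coe _).functor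

/-- The functor `𝟙 ⥤ A` picking the object `a`. -/
abbrev pt {A : Type w} [SmallCategory A] (a : A) : OneCat.{w} ⥤ A := Functor.fromPUnit a

/-- The functor `(0,0) : 𝟙 ⥤ ⌜`. -/
def cornerUL : OneCat.{w} ⥤ UL.{w} := pt ⟨sq 0 0, by simp [sq]⟩

/-- The functor `ι_{jk} : □ ⥤ 𝟚 × 𝟛`, the identity on the first factor and `0 ↦ j`, `1 ↦ k` on the
second one. -/
def iota (j k : Fin 3) (h : j ≤ k) : Sq.{w} ⥤ Rect.{w} :=
  Monotone.functor (f := fun p => rect p.down.1 (if p.down.2 = 0 then j else k)) (by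
    rintro ⟨a, b⟩ ⟨a', b'⟩ ⟨h1, h2⟩
    refine ⟨h1, ?_⟩
    dsimp at h2 ⊢
    split_ifs with h3 h4 h4
    · exact le_rfl
    · exact h
    · exfalso
      subst h4
      exact h3 (Fin.le_zero_iff.mp h2)
    · exact le_rfl)

/-- The isomorphism `□ᵒᵖ ⥤ □` which fixes `(0,1)` and `(1,0)` and exchanges `(0,0)` and `(1,1)`
(`Fin.rev` exchanges `0` and `1`). -/
def flipSq : Sq.{w}ᵒᵖ ⥤ Sq.{w} where
  obj p := sq p.unop.down.2.rev p.unop.down.1.rev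
  map m := homOfLE
    ⟨Fin.rev_le_rev.mpr (leOfHom m.unop).2, Fin.rev_le_rev.mpr (leOfHom m.unop).1⟩

/-! ### Derivators -/

/-- A prederivator: a (strict, covariant on 2-cells) 2-functor `Catᵒᵖ ⥤ CAT`. -/
abbrev Prederivator := StrictPseudofunctor (Cat.{w, w})ᵒᵖ Cat.{v, u}

namespace Prederivator

variable (D : Prederivator.{w, v, u})

/-- The category `D(A)` of coherent diagrams of shape `A`. -/
abbrev Diag (A : Type w) [SmallCategory A] : Type u := D.obj (op (Cat.of A))

section

variable {A B C : Type w} [SmallCategory A] [SmallCategory B] [SmallCategory C]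

/-- The restriction functor `u^* : D(B) ⥤ D(A)`. -/
def restr (f : A ⥤ B) : D.Diag B ⥤ D.Diag A := (D.map f.toCatHom.op).toFunctor

/-- The natural transformation `α^* : f^* ⟶ g^*` induced by `α : f ⟶ g`. -/
def restrMap {f g : A ⥤ B} (α : f ⟶ g) : D.restr f ⟶ D.restr g :=
  (D.map₂ (Bicategory.Opposite.op2 α.toCatHom₂)).toNatTrans

lemma restr_comp (f : A ⥤ B) (g : B ⥤ C) : D.restr (f ⋙ g) = D.restr g ⋙ D.restr f :=
  congrArg Cat.Hom.toFunctor (D.map_comp g.toCatHom.op f.toCatHom.op)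

lemma restr_id : D.restr (𝟭 A) = 𝟭 (D.Diag A) :=
  congrArg Cat.Hom.toFunctor (D.map_id (op (Cat.of A)))

/-- If `p ⋙ f = q ⋙ g`, then `p^* f^* X = q^* g^* X`. -/
lemma restr_obj_eq {B' : Type w} [SmallCategory B'] {p : A ⥤ B} {f : B ⥤ C} {q : A ⥤ B'}
    {g : B' ⥤ C} (h : p ⋙ f = q ⋙ g) (X : D.Diag C) :
    (D.restr p).obj ((D.restr f).obj X) = (D.restr q).obj ((D.restr g).obj X) := by
  have := congrArg D.restr h
  rw [restr_comp, restr_comp] at this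
  exact Functor.congr_obj this X

/-- If `p ⋙ f = q`, then `p^* f^* X = q^* X`. -/
lemma restr_obj_eq' {p : A ⥤ B} {f : B ⥤ C} {q : A ⥤ C} (h : p ⋙ f = q) (X : D.Diag C) :
    (D.restr p).obj ((D.restr f).obj X) = (D.restr q).obj X := by
  rw [← h, restr_comp]; rfl

/-- The value `X_a = a^* X`. -/
abbrev ev (a : A) : D.Diag A ⥤ D.Diag OneCat.{w} := D.restr (pt a)

/-- The morphism `X_a ⟶ X_b` of the underlying diagram of `X` induced by `m : a ⟶ b`. -/
def evMap (X : D.Diag A) {a b : A} (m : a ⟶ b) : (D.ev a).obj X ⟶ (D.ev b).obj X :=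
  (D.restrMap (Discrete.natTrans (fun _ => m) : pt a ⟶ pt b)).app X

/-- The restricted 2-square `f^* ⋙ p^* ⟶ g^* ⋙ q^*` associated with a 2-square
`p ⋙ f ⟶ q ⋙ g` of small categories. -/
def square {E : Type w} [SmallCategory E] {p : E ⥤ A} {q : E ⥤ B} {f : A ⥤ C} {g : B ⥤ C}
    (α : p ⋙ f ⟶ q ⋙ g) : TwoSquare (D.restr f) (D.restr g) (D.restr p) (D.restr q) :=
  eqToHom (D.restr_comp p f).symm ≫ D.restrMap α ≫ eqToHom (D.restr_comp q g)

end

/-- Axiom (Der3): every restriction functor has a left and a right adjoint. -/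
class HasKan : Prop where
  isRightAdjoint : ∀ {A B : Type w} [SmallCategory A] [SmallCategory B] (f : A ⥤ B),
    (D.restr f).IsRightAdjoint
  isLeftAdjoint : ∀ {A B : Type w} [SmallCategory A] [SmallCategory B] (f : A ⥤ B),
    (D.restr f).IsLeftAdjoint

section Kan

variable [D.HasKan] {A B : Type w} [SmallCategory A] [SmallCategory B] (f : A ⥤ B)

instance : (D.restr f).IsRightAdjoint := HasKan.isRightAdjoint f

instance : (D.restr f).IsLeftAdjoint := HasKan.isLeftAdjoint f

/-- The left Kan extension functor `f_!`. -/
noncomputable def lan : D.Diag A ⥤ D.Diag B := (D.restr f).leftAdjoint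

/-- The right Kan extension functor `f_*`. -/
noncomputable def ran : D.Diag A ⥤ D.Diag B := (D.restr f).rightAdjoint

/-- The adjunction `f_! ⊣ f^*`. -/
noncomputable def lanAdj : D.lan f ⊣ D.restr f := Adjunction.ofIsRightAdjoint _

/-- The adjunction `f^* ⊣ f_*`. -/
noncomputable def ranAdj : D.restr f ⊣ D.ran f := Adjunction.ofIsLeftAdjoint _

end Kan

/-- A prederivator is a derivator if it satisfies the axioms (Der1)--(Der4). -/
class IsDerivator : Prop extends D.HasKan where
  /-- (Der1): `D` takes coproducts to products. -/
  der1 : ∀ {I : Type w} (A : I → Type w) [∀ i, SmallCategory (A i)],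
    (Functor.pi' (fun i => D.restr (Sigma.incl (C := A) i))).IsEquivalence
  /-- (Der2): isomorphisms are detected pointwise. -/
  der2 : ∀ {A : Type w} [SmallCategory A] {X Y : D.Diag A} (φ : X ⟶ Y),
    (∀ a : A, IsIso ((D.ev a).map φ)) → IsIso φ
  /-- (Der4), for left Kan extensions: with `p`, `q` the projections of the comma category `(f/c)`,
  the canonical mate `q_! p^* ⟶ c^* f_!` is an isomorphism. -/
  der4_lan : ∀ {A C : Type w} [SmallCategory A] [SmallCategory C] (f : A ⥤ C) (c : C),
    IsIso ((mateEquiv (D.lanAdj f) (D.lanAdj (Comma.snd f (pt c)))).symm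
      (D.square (Comma.natTrans f (pt c)))).natTrans
  /-- (Der4), for right Kan extensions: with `p`, `q` the projections of the comma category `(c/g)`,
  the canonical mate `c^* g_* ⟶ p_* q^*` is an isomorphism. -/
  der4_ran : ∀ {B C : Type w} [SmallCategory B] [SmallCategory C] (g : B ⥤ C) (c : C),
    IsIso (mateEquiv (D.ranAdj g) (D.ranAdj (Comma.fst (pt c) g))
      (D.square (Comma.natTrans (pt c) g))).natTrans

/-- A coherent square is cocartesian if it is in the essential image of `(i_⌜)_!`. -/
def IsCocartesian [D.HasKan] (X : D.Diag Sq.{w}) : Prop := (D.lan inclUL).essImage X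

/-- A coherent square is cartesian if it is in the essential image of `(i_⌟)_*`. -/
def IsCartesian [D.HasKan] (X : D.Diag Sq.{w}) : Prop := (D.ran inclLR).essImage X

/-- Stable derivators: pointed derivators in which the cartesian and the cocartesian squares
coincide. -/
class IsStable : Prop extends D.IsDerivator where
  hasZeroObject : HasZeroObject (D.Diag OneCat.{w})
  isCartesian_iff : ∀ X : D.Diag Sq.{w}, D.IsCartesian X ↔ D.IsCocartesian X

/-! ### The opposite prederivator -/

section

variable {A B C : Type w} [SmallCategory A] [SmallCategory B] [SmallCategory C]

lemma restrMap_id (f : A ⥤ B) : D.restrMap (𝟙 f) = 𝟙 (D.restr f) :=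
  congrArg Cat.Hom₂.toNatTrans (D.map₂_id f.toCatHom.op)

lemma restrMap_comp {f g h : A ⥤ B} (α : f ⟶ g) (β : g ⟶ h) :
    D.restrMap (α ≫ β) = D.restrMap α ≫ D.restrMap β :=
  congrArg Cat.Hom₂.toNatTrans (D.map₂_comp (Bicategory.Opposite.op2 α.toCatHom₂)
    (Bicategory.Opposite.op2 β.toCatHom₂))

lemma restrMap_whiskerLeft_app (f : A ⥤ B) {g h : B ⥤ C} (α : g ⟶ h) (X : D.Diag C) :
    (D.restrMap (Functor.whiskerLeft f α)).app X =
      eqToHom (by rw [restr_comp]; rfl) ≫ (D.restr f).map ((D.restrMap α).app X) ≫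
        eqToHom (by rw [restr_comp]; rfl) := by
  have h := congrArg Cat.Hom₂.toNatTrans
    (D.map₂_whisker_right (Bicategory.Opposite.op2 α.toCatHom₂) f.toCatHom.op)
  have h' := congrArg (fun t => t.app X) h
  simp only [D.mapComp_eq_eqToIso] at h'
  refine Eq.trans ?_ (h'.trans ?_)
  · rfl
  · simp
    rfl

lemma restrMap_whiskerRight_app {f g : A ⥤ B} (α : f ⟶ g) (h : B ⥤ C) (X : D.Diag C) :
    (D.restrMap (Functor.whiskerRight α h)).app X =
      eqToHom (by rw [restr_comp]; rfl) ≫ (D.restrMap α).app ((D.restr h).obj X) ≫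
        eqToHom (by rw [restr_comp]; rfl) := by
  have h := congrArg Cat.Hom₂.toNatTrans
    (D.map₂_whisker_left h.toCatHom.op (Bicategory.Opposite.op2 α.toCatHom₂))
  have h' := congrArg (fun t => t.app X) h
  simp only [D.mapComp_eq_eqToIso] at h'
  refine Eq.trans ?_ (h'.trans ?_)
  · rfl
  · simp
    rfl

lemma restrMap_eqToHom {f g : A ⥤ B} (h : f = g) :
    D.restrMap (eqToHom h) = eqToHom (congrArg D.restr h) := by
  subst h; exact D.restrMap_id f

end

lemma eqToHom_eq_app_associator {A B C E : Cat.{v, u}} {F H : A ⟶ E} {r : A ⟶ B} {s : B ⟶ C}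
    {t : C ⟶ E} (h₁ : F = (r ≫ s) ≫ t) (h₂ : r ≫ s ≫ t = H) (X : A) :
    eqToHom (by subst h₁ h₂; rfl) =
      (eqToHom h₁ ≫ (Bicategory.associator r s t).hom ≫ eqToHom h₂).toNatTrans.app X := by
  subst h₁ h₂
  simp

/-- The opposite `Dᵒᵖ(A) = D(Aᵒᵖ)ᵒᵖ`. -/
def opposite : Prederivator.{w, v, u} := StrictPseudofunctor.mk'
  { obj := fun A => Cat.of (D.Diag (A.unop : Type w)ᵒᵖ)ᵒᵖ
    map := fun f => (D.restr f.unop.toFunctor.op).op.toCatHom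
    map₂ := fun α => (NatTrans.op (D.restrMap (NatTrans.op α.unop2.toNatTrans))).toCatHom₂
    map₂_id := fun f => by
      ext X
      exact congrArg Quiver.Hom.op
        (congrArg (fun t => t.app X.unop) (D.restrMap_id f.unop.toFunctor.op))
    map₂_comp := fun α β => by
      ext X
      exact congrArg Quiver.Hom.op (congrArg (fun t => t.app X.unop)
        (D.restrMap_comp (NatTrans.op β.unop2.toNatTrans) (NatTrans.op α.unop2.toNatTrans)))
    map_id := fun A => by
      ext1
      exact congrArg Functor.op (D.restr_id (A := (A.unop : Type w)ᵒᵖ))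
    map_comp := fun f g => by
      ext1
      exact congrArg Functor.op (D.restr_comp g.unop.toFunctor.op f.unop.toFunctor.op)
    map₂_whisker_left := fun f g h α => by
      ext X
      have := congrArg Quiver.Hom.op
        (D.restrMap_whiskerRight_app (NatTrans.op α.unop2.toNatTrans) f.unop.toFunctor.op X.unop)
      refine this.trans ?_
      erw [NatTrans.comp_app, NatTrans.comp_app, Cat.eqToHom_app, Cat.eqToHom_app]
      simp only [op_comp, eqToHom_op, Category.assoc]
      rfl
    map₂_whisker_right := fun α h => by
      ext X
      have := congrArg Quiver.Hom.op
        (D.restrMap_whiskerLeft_app h.unop.toFunctor.op (NatTrans.op α.unop2.toNatTrans) X.unop)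
      refine this.trans ?_
      erw [NatTrans.comp_app, NatTrans.comp_app, Cat.eqToHom_app, Cat.eqToHom_app]
      simp only [op_comp, eqToHom_op, Category.assoc]
      rfl
    map₂_left_unitor := fun f => by
      ext X
      have := congrArg Quiver.Hom.op (congrArg (fun t => t.app X.unop)
        (D.restrMap_eqToHom (Functor.comp_id f.unop.toFunctor.op).symm))
      refine Eq.trans ?_ (this.trans ?_)
      · rfl
      · erw [NatTrans.comp_app, CategoryTheory.eqToHom_app]
        simp only [eqToHom_op]
        exact (Category.comp_id _).symm
    map₂_right_unitor := fun f => by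
      ext X
      have := congrArg Quiver.Hom.op (congrArg (fun t => t.app X.unop)
        (D.restrMap_eqToHom (Functor.id_comp f.unop.toFunctor.op).symm))
      refine Eq.trans ?_ (this.trans ?_)
      · rfl
      · erw [NatTrans.comp_app, CategoryTheory.eqToHom_app]
        simp only [eqToHom_op]
        exact (Category.comp_id _).symm
    map₂_associator := fun f g h => by
      ext X
      have := congrArg Quiver.Hom.op (congrArg (fun t => t.app X.unop)
        (D.restrMap_eqToHom (Functor.assoc h.unop.toFunctor.op g.unop.toFunctor.op
          f.unop.toFunctor.op)))
      refine Eq.trans ?_ (this.trans ?_)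
      · rfl
      · rw [CategoryTheory.eqToHom_app, eqToHom_op]
        exact eqToHom_eq_app_associator
          (F := (D.restr (h.unop.toFunctor.op ⋙ g.unop.toFunctor.op ⋙
            f.unop.toFunctor.op)).op.toCatHom)
          (H := (D.restr ((h.unop.toFunctor.op ⋙ g.unop.toFunctor.op) ⋙
            f.unop.toFunctor.op)).op.toCatHom) _ _ X }

instance [D.HasKan] : D.opposite.HasKan where
  isRightAdjoint f := inferInstanceAs (D.restr f.op).op.IsRightAdjoint
  isLeftAdjoint f := inferInstanceAs (D.restr f.op).op.IsLeftAdjoint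

/-! ### Suspension and distinguished triangles -/

/-- The outer rectangle `ι_{02}^* X`. -/
abbrev outer (X : D.Diag Rect.{w}) : D.Diag Sq.{w} := (D.restr (iota 0 2 (by decide))).obj X

lemma outer_ev₀₀ (X : D.Diag Rect.{w}) :
    (D.ev (sq 0 0)).obj (D.outer X) = (D.ev (rect 0 0)).obj X :=
  D.restr_obj_eq' rfl X

lemma outer_ev₁₁ (X : D.Diag Rect.{w}) :
    (D.ev (sq 1 1)).obj (D.outer X) = (D.ev (rect 1 2)).obj X :=
  D.restr_obj_eq' rfl X

section Susp

variable [D.HasKan]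

/-- The suspension functor `Σ = (1,1)^* (i_⌜)_! (0,0)_*`. -/
noncomputable def susp : D.Diag OneCat.{w} ⥤ D.Diag OneCat.{w} :=
  D.ran cornerUL ⋙ D.lan inclUL ⋙ D.ev (sq 1 1)

/-- The comparison morphism `(i_⌜)_! i_⌜^* X ⟶ (i_⌜)_! (0,0)_* X_{00}`, evaluated at `(1,1)`, so
that its target is `Σ X_{00}`. -/
noncomputable def toSusp (X : D.Diag Sq.{w}) :
    (D.ev (sq 1 1)).obj ((D.lan inclUL).obj ((D.restr inclUL).obj X)) ⟶
      D.susp.obj ((D.ev (sq 0 0)).obj X) :=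
  (D.ev (sq 1 1)).map ((D.lan inclUL).map
    ((D.ranAdj cornerUL).unit.app ((D.restr inclUL).obj X) ≫
      (D.ran cornerUL).map (eqToHom (D.restr_obj_eq' rfl X))))

/-- `φ : X_{11} ⟶ Σ X_{00}` is the canonical morphism induced by the square `X`: it is compatible
with the counit `(i_⌜)_! i_⌜^* X ⟶ X` and with `(i_⌜)_! i_⌜^* X ⟶ (i_⌜)_! (0,0)_* X_{00}`.
If `X` is cocartesian with `X_{01}` and `X_{10}` zero objects, then both of these are isomorphisms
(in a pointed derivator), and `φ` is the canonical isomorphism `X_{11} ≅ Σ X_{00}`. -/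
def IsSuspComparison (X : D.Diag Sq.{w})
    (φ : (D.ev (sq 1 1)).obj X ⟶ D.susp.obj ((D.ev (sq 0 0)).obj X)) : Prop :=
  (D.ev (sq 1 1)).map ((D.lanAdj inclUL).counit.app X) ≫ φ = D.toSusp X

/-- Diagrams `x ⟶ y ⟶ z ⟶ Σ x` in the underlying category `D(𝟙)`. -/
structure Triangle where
  {x y z : D.Diag OneCat.{w}}
  f : x ⟶ y
  g : y ⟶ z
  h : z ⟶ D.susp.obj x

/-- Isomorphic triangles. -/
def Triangle.Iso {D : Prederivator.{w, v, u}} [D.HasKan] (S T : D.Triangle) : Prop :=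
  ∃ (a : S.x ≅ T.x) (b : S.y ≅ T.y) (c : S.z ≅ T.z),
    S.f ≫ b.hom = a.hom ≫ T.f ∧ S.g ≫ c.hom = b.hom ≫ T.g ∧
      S.h ≫ D.susp.map a.hom = c.hom ≫ T.h

/-- Cofiber sequences: coherent diagrams of shape `𝟚 × 𝟛` in which both squares are cocartesian and
whose `(0,2)`- and `(1,0)`-entries are zero objects. -/
structure IsCofiberSequence (X : D.Diag Rect.{w}) : Prop where
  left : D.IsCocartesian ((D.restr (iota 0 1 (by decide))).obj X)
  right : D.IsCocartesian ((D.restr (iota 1 2 (by decide))).obj X)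
  isZero₀₂ : IsZero ((D.ev (rect 0 2)).obj X)
  isZero₁₀ : IsZero ((D.ev (rect 1 0)).obj X)

/-- The triangle `x ⟶ y ⟶ z ⟶ w ⟶ Σ x` given by a diagram `X` of shape `𝟚 × 𝟛` and a morphism
`φ : w ⟶ Σ x` defined on the outer rectangle of `X`. -/
noncomputable def triangleOf (X : D.Diag Rect.{w})
    (φ : (D.ev (sq 1 1)).obj (D.outer X) ⟶ D.susp.obj ((D.ev (sq 0 0)).obj (D.outer X))) :
    D.Triangle where
  f := D.evMap X (homOfLE (by simp [rect] : rect 0 0 ≤ rect 0 1))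
  g := D.evMap X (homOfLE (by simp [rect] : rect 0 1 ≤ rect 1 1))
  h := D.evMap X (homOfLE (by simp [rect] : rect 1 1 ≤ rect 1 2)) ≫
    eqToHom (D.outer_ev₁₁ X).symm ≫ φ ≫ D.susp.map (eqToHom (D.outer_ev₀₀ X))

/-- Distinguished triangles of `D(𝟙)`: the triangles isomorphic to one induced by a cofiber
sequence, where the isomorphism `w ≅ Σ x` is the one given by the outer rectangle. -/
def Triangle.IsDistinguished {D : Prederivator.{w, v, u}} [D.HasKan] (T : D.Triangle) : Prop :=
  ∃ (X : D.Diag Rect.{w})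
    (φ : (D.ev (sq 1 1)).obj (D.outer X) ⟶ D.susp.obj ((D.ev (sq 0 0)).obj (D.outer X))),
    D.IsCofiberSequence X ∧ D.IsSuspComparison (D.outer X) φ ∧ T.Iso (D.triangleOf X φ)

/-- The triangle `(ε₁ f, ε₂ g, ε₃ h)`, for signs `ε₁, ε₂, ε₃`. -/
noncomputable def Triangle.signs {D : Prederivator.{w, v, u}} [D.HasKan] [Preadditive (D.Diag OneCat.{w})]
    (ε₁ ε₂ ε₃ : ℤˣ) (T : D.Triangle) : D.Triangle where
  f := (ε₁ : ℤ) • T.f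
  g := (ε₂ : ℤ) • T.g
  h := (ε₃ : ℤ) • T.h

end Susp

/-! ### Triangles in the opposite derivator -/

/-- The identification of `D(𝟙)ᵒᵖ` with `Dᵒᵖ(𝟙) = D(𝟙ᵒᵖ)ᵒᵖ`, by restriction along `𝟙ᵒᵖ ≌ 𝟙`. -/
def toOpposite : (D.Diag OneCat.{w})ᵒᵖ ⥤ D.opposite.Diag OneCat.{w} :=
  (D.restr ((Functor.const (OneCat.{w})ᵒᵖ).obj (⟨PUnit.unit⟩ : OneCat.{w}))).op

/-- A coherent square in `D`, viewed as a coherent square in `Dᵒᵖ` through `flipSq`. -/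
def flip (Q : D.Diag Sq.{w}) : D.opposite.Diag Sq.{w} := op ((D.restr flipSq).obj Q)

lemma flip_ev (Q : D.Diag Sq.{w}) (i j : Fin 2) :
    (D.opposite.ev (sq i j)).obj (D.flip Q) =
      D.toOpposite.obj (op ((D.ev (sq j.rev i.rev)).obj Q)) :=
  congrArg op (D.restr_obj_eq (p := (pt (sq i j)).op) (f := flipSq)
    (q := (Functor.const (OneCat.{w})ᵒᵖ).obj (⟨PUnit.unit⟩ : OneCat.{w}))
    (g := pt (sq j.rev i.rev)) rfl Q)

/-- `T.CorrespondsTo T'` expresses that the triangle `T'` of `Dᵒᵖ(𝟙)` is, up to isomorphism of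
triangles, the triangle `T` of `D(𝟙)`
with its arrows reversed: `T ≅ (x ⟶ y ⟶ z ⟶ w ≅ Σ x)` and, writing `Ω` for the suspension of
`Dᵒᵖ`, `T' ≅ (Ω w ≅ x ⟶ y ⟶ z ⟶ w)` read in the opposite category, where `w ≅ Σ x` and
`Ω w ≅ x` are induced by one and the same cocartesian and cartesian square `Q`, with
`Q_{00} = x`, `Q_{11} = w` and with `Q_{01}`, `Q_{10}` zero objects (that is, by the equivalence
`Σ ⊣ Ω`). -/
def Triangle.CorrespondsTo {D : Prederivator.{w, v, u}} [D.HasKan] (T : D.Triangle)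
    (T' : D.opposite.Triangle) : Prop :=
  ∃ (Q : D.Diag Sq.{w})
    (φ : (D.ev (sq 1 1)).obj Q ⟶ D.susp.obj ((D.ev (sq 0 0)).obj Q))
    (ψ : (D.opposite.ev (sq 1 1)).obj (D.flip Q) ⟶
      D.opposite.susp.obj ((D.opposite.ev (sq 0 0)).obj (D.flip Q)))
    (y z : D.Diag OneCat.{w})
    (f : (D.ev (sq 0 0)).obj Q ⟶ y) (g : y ⟶ z) (h : z ⟶ (D.ev (sq 1 1)).obj Q),
    IsZero ((D.ev (sq 0 1)).obj Q) ∧ IsZero ((D.ev (sq 1 0)).obj Q) ∧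
    D.IsCocartesian Q ∧ D.IsCartesian Q ∧
    D.IsSuspComparison Q φ ∧ D.opposite.IsSuspComparison (D.flip Q) ψ ∧
    T.Iso { f := f, g := g, h := h ≫ φ } ∧
    T'.Iso
      { f := D.toOpposite.map h.op
        g := D.toOpposite.map g.op
        h := D.toOpposite.map f.op ≫ eqToHom (D.flip_ev Q 1 1).symm ≫ ψ ≫
          D.opposite.susp.map (eqToHom (D.flip_ev Q 0 0)) }

end Prederivator
end Derivators

namespace Derivators

namespace Prederivator

/-! The sign comes from a transposition. Reversing `𝟚 × 𝟛` turns a cofiber sequence `Y` of `D` into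
one of `Dᵒᵖ`, because cartesian and cocartesian squares agree. On the outer rectangle this reversal
is `(i,j) ↦ (1-i,1-j)`, whereas the prescribed `□ᵒᵖ ≅ □` fixes `(0,1)` and `(1,0)`; the two differ
by the transposition of `□` (`restr_iota_rev`). So the triangle of the reversed `Y` in `Dᵒᵖ`
corresponds to the triangle of `Y` in which `w ≅ Σ x` is induced by the transposed outer rectangle.
Two facts remain: transposing a bicartesian square with zero off-diagonal corners negates `Q₁₁ ≅ Σ
Q₀₀` (`IsLoopSquare.comparison_transpose`), and up to isomorphism only the product of the three
signs matters (`Triangle.signs_iso`).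

For the first fact, let `Q` be such a square and `x = Q₀₀`. Since `Q` is cocartesian, maps `Q₁₁ ⟶ Y`
are maps from the span `0 ← x → 0` to the constant diagram `Y` (`spanOf`); think of them as paths
between two null homotopies of a map out of `x`. A fan with three zero objects under `x` has faces
`12`, `23` and `13`. A Segal condition (`bijective_faces'`) says that the first two faces are
arbitrary and determine the fan, so the third defines a sum. Degenerate fans show that null maps are
units and that a path plus its reverse is null, and the reverse is the action of the transposition.
Every object is some `Q₁₁`, and copowers exist, so an Eckmann--Hilton argument gives a preadditive
structure (`nonempty_preadditive`); it also shows that this sum is the addition of any preadditive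
structure (`eq_add_of_unital`). Hence the transposition acts on `Q₁₁` by `-1` (`pull_swap_eq_neg`).

Strongness is not needed, because every morphism of diagrams that has to be lifted goes between
squares of this kind, and such a morphism is freely determined by its value at `(0,0)`, or equally
by its value at `(1,1)` (`IsSuspSquare.bij_ev`, `IsLoopSquare.bij_ev₁₁`). For the same reason,
passing from `x ⟶ y ⟶ z ⟶ w` with a square `Q` to a triangle of `D(𝟙)` or of `Dᵒᵖ(𝟙)` detects the
same isomorphisms (`LoopTriangle.toTriangle_iso_iff_toOppositeTriangle_iso`), so the correspondence
of triangles is one of isomorphism classes.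

Kan extensions are handled throughout by the relation `Bij`: restriction is bijective on a given set
of morphisms. It has a two-out-of-three property, and it dualizes by exchanging its two arguments,
so the chosen Kan extensions of `Dᵒᵖ` rarely have to be compared with those of `D`. -/

lemma eqToHom_sandwich {E : Type*} [Category* E] {a b b' c x y z : E} (M : a ⟶ b) (N : b' ⟶ c)
    (p : x = a) (q : b = b') (r : c = x) {p' : y = a} {r' : c = z}
    (h : eqToHom p ≫ M ≫ eqToHom q ≫ N ≫ eqToHom r = 𝟙 x) :
    eqToHom p' ≫ M ≫ eqToHom q ≫ N ≫ eqToHom r' = eqToHom (p'.trans (p.symm.trans (r.symm.trans r'))) := by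
  subst p q p' r'; subst r
  simpa using h

/-! ### The calculus of restrictions -/

section Calculus

variable (D : Prederivator.{w, v, u})
variable {A B C J J' : Type w} [SmallCategory A] [SmallCategory B] [SmallCategory C]
  [SmallCategory J] [SmallCategory J']

lemma restr_comp_obj (f : A ⥤ B) (g : B ⥤ C) (X : D.Diag C) :
    (D.restr (f ⋙ g)).obj X = (D.restr f).obj ((D.restr g).obj X) :=
  Functor.congr_obj (D.restr_comp f g) X

lemma restr_id_obj (X : D.Diag A) : (D.restr (𝟭 A)).obj X = X :=
  Functor.congr_obj D.restr_id X

lemma restr_congr_obj {f g : A ⥤ B} (h : f = g) (X : D.Diag B) :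
    (D.restr f).obj X = (D.restr g).obj X := by rw [h]

lemma restr_comp_map (f : A ⥤ B) (g : B ⥤ C) {X Y : D.Diag C} (φ : X ⟶ Y) :
    (D.restr (f ⋙ g)).map φ = eqToHom (D.restr_comp_obj f g X) ≫
      (D.restr f).map ((D.restr g).map φ) ≫ eqToHom (D.restr_comp_obj f g Y).symm :=
  Functor.congr_hom (D.restr_comp f g) φ

lemma restr_map_map (f : A ⥤ B) (g : B ⥤ C) {X Y : D.Diag C} (φ : X ⟶ Y) :
    (D.restr f).map ((D.restr g).map φ) = eqToHom (D.restr_comp_obj f g X).symm ≫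
      (D.restr (f ⋙ g)).map φ ≫ eqToHom (D.restr_comp_obj f g Y) := by
  simp [restr_comp_map]

lemma restr_id_map {X Y : D.Diag A} (φ : X ⟶ Y) :
    (D.restr (𝟭 A)).map φ = eqToHom (D.restr_id_obj X) ≫ φ ≫ eqToHom (D.restr_id_obj Y).symm :=
  Functor.congr_hom D.restr_id φ

lemma restr_congr_map {f g : A ⥤ B} (h : f = g) {X Y : D.Diag B} (φ : X ⟶ Y) :
    (D.restr f).map φ = eqToHom (D.restr_congr_obj h X) ≫
      (D.restr g).map φ ≫ eqToHom (D.restr_congr_obj h Y).symm := by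
  subst h; simp

lemma restr_map_restrMap (f : A ⥤ B) {g h : B ⥤ C} (α : g ⟶ h) (X : D.Diag C) :
    (D.restr f).map ((D.restrMap α).app X) = eqToHom (D.restr_comp_obj f g X).symm ≫
      (D.restrMap (Functor.whiskerLeft f α)).app X ≫ eqToHom (D.restr_comp_obj f h X) := by
  simp [restrMap_whiskerLeft_app]

lemma restrMap_app_restr {f g : A ⥤ B} (α : f ⟶ g) (h : B ⥤ C) (X : D.Diag C) :
    (D.restrMap α).app ((D.restr h).obj X) = eqToHom (D.restr_comp_obj f h X).symm ≫
      (D.restrMap (Functor.whiskerRight α h)).app X ≫ eqToHom (D.restr_comp_obj g h X) := by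
  simp [restrMap_whiskerRight_app]

lemma restrMap_comp_app {f g h : A ⥤ B} (α : f ⟶ g) (β : g ⟶ h) (X : D.Diag B) :
    (D.restrMap (α ≫ β)).app X = (D.restrMap α).app X ≫ (D.restrMap β).app X := by
  rw [restrMap_comp]; rfl

lemma restrMap_id_app (f : A ⥤ B) (X : D.Diag B) :
    (D.restrMap (𝟙 f)).app X = 𝟙 _ := by
  rw [restrMap_id]; rfl

instance isIso_restrMap {f g : A ⥤ B} (α : f ⟶ g) [IsIso α] : IsIso (D.restrMap α) :=
  ⟨D.restrMap (inv α), by rw [← restrMap_comp, IsIso.hom_inv_id, restrMap_id],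
    by rw [← restrMap_comp, IsIso.inv_hom_id, restrMap_id]⟩

/-- An adjunction `l ⊣ k` of functors induces an adjunction `k^* ⊣ l^*`. -/
def restrAdj {l : A ⥤ B} {k : B ⥤ A} (adj : l ⊣ k) : D.restr k ⊣ D.restr l :=
  Adjunction.mkOfUnitCounit
    { unit := eqToHom D.restr_id.symm ≫ D.restrMap adj.unit ≫ eqToHom (D.restr_comp l k)
      counit := eqToHom (D.restr_comp k l).symm ≫ D.restrMap adj.counit ≫ eqToHom D.restr_id
      left_triangle := by
        ext X
        -- Restriction reverses functors but not transformations, so the left triangle identity for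
        -- `k^* ⊣ l^*` is the right one of `adj`, and conversely below.
        have h : Functor.whiskerLeft k adj.unit ≫ Functor.whiskerRight adj.counit k = 𝟙 k := by
          ext; simp
        have h2 : (D.restrMap (Functor.whiskerLeft k adj.unit ≫
          Functor.whiskerRight adj.counit k)).app X = 𝟙 _ := by rw [h]; exact D.restrMap_id_app k X
        erw [restrMap_comp_app, restrMap_whiskerLeft_app, restrMap_whiskerRight_app] at h2
        simp only [Functor.comp_obj, Functor.id_obj, NatTrans.comp_app, Functor.whiskerRight_app,
          Functor.whiskerLeft_app, Functor.associator_hom_app, eqToHom_app, Functor.map_comp,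
          eqToHom_map, Category.assoc, Category.id_comp, eqToHom_trans_assoc] at h2 ⊢
        exact eqToHom_sandwich _ _ _ _ _ h2
      right_triangle := by
        ext X
        have h : Functor.whiskerRight adj.unit l ≫ Functor.whiskerLeft l adj.counit = 𝟙 l := by
          ext; simp
        have h2 : (D.restrMap (Functor.whiskerRight adj.unit l ≫
          Functor.whiskerLeft l adj.counit)).app X = 𝟙 _ := by rw [h]; exact D.restrMap_id_app l X
        erw [restrMap_comp_app, restrMap_whiskerLeft_app, restrMap_whiskerRight_app] at h2
        simp only [Functor.comp_obj, Functor.id_obj, NatTrans.comp_app, Functor.whiskerRight_app,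
          Functor.whiskerLeft_app, Functor.associator_inv_app, eqToHom_app, Functor.map_comp,
          eqToHom_map, Category.assoc, Category.id_comp, eqToHom_trans_assoc] at h2 ⊢
        exact eqToHom_sandwich _ _ _ _ _ h2 }

end Calculus

/-! ### Restriction functors inducing bijections on morphisms -/

section Bij

variable (D : Prederivator.{w, v, u})
variable {A B C : Type w} [SmallCategory A] [SmallCategory B] [SmallCategory C]

/-- Restriction along `f` induces a bijection on the morphisms `X ⟶ Z`. -/
def Bij (f : A ⥤ B) (X Z : D.Diag B) : Prop :=
  Function.Bijective (fun φ : X ⟶ Z => (D.restr f).map φ)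

lemma bijective_eqToHom_conj {E : Type*} [Category* E] {a a' b b' : E} (p : a' = a) (q : b = b') :
    Function.Bijective (fun φ : a ⟶ b => eqToHom p ≫ φ ≫ eqToHom q) := by
  subst p q; simpa using! Function.bijective_id

variable {D}

lemma Bij.congr {f g : A ⥤ B} {X Z : D.Diag B} (h : D.Bij f X Z) (e : f = g) : D.Bij g X Z := by
  subst e; exact h

lemma bij_comp_iff (f : A ⥤ B) (g : B ⥤ C) (X Z : D.Diag C) :
    D.Bij (f ⋙ g) X Z ↔
      Function.Bijective (fun φ : X ⟶ Z => (D.restr f).map ((D.restr g).map φ)) := by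
  have : (fun φ : X ⟶ Z => (D.restr (f ⋙ g)).map φ) =
      (fun φ => eqToHom (D.restr_comp_obj f g X) ≫ φ ≫ eqToHom (D.restr_comp_obj f g Z).symm) ∘
        fun φ : X ⟶ Z => (D.restr f).map ((D.restr g).map φ) := by
    funext φ; exact D.restr_comp_map f g φ
  rw [Bij, this]
  exact (bijective_eqToHom_conj _ _).of_comp_iff' _

/-- This and the next two lemmas form a two-out-of-three property, which takes the place of the
calculus of composite Kan extensions. -/
lemma Bij.comp {f : A ⥤ B} {g : B ⥤ C} {X Z : D.Diag C}
    (hf : D.Bij f ((D.restr g).obj X) ((D.restr g).obj Z)) (hg : D.Bij g X Z) :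
    D.Bij (f ⋙ g) X Z :=
  (bij_comp_iff f g X Z).2 (Function.Bijective.comp hf hg)

lemma Bij.of_comp_left {f : A ⥤ B} {g : B ⥤ C} {X Z : D.Diag C}
    (h : D.Bij (f ⋙ g) X Z) (hf : D.Bij f ((D.restr g).obj X) ((D.restr g).obj Z)) :
    D.Bij g X Z :=
  (Function.Bijective.of_comp_iff' hf _).1 ((bij_comp_iff f g X Z).1 h)

lemma Bij.of_comp_right {f : A ⥤ B} {g : B ⥤ C} {X Z : D.Diag C}
    (h : D.Bij (f ⋙ g) X Z) (hg : D.Bij g X Z) :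
    D.Bij f ((D.restr g).obj X) ((D.restr g).obj Z) :=
  (Function.Bijective.of_comp_iff _ hg).1 ((bij_comp_iff f g X Z).1 h)

lemma Bij.of_iso {f : A ⥤ B} {X X' Z Z' : D.Diag B} (h : D.Bij f X Z) (e : X ≅ X') (e' : Z ≅ Z') :
    D.Bij f X' Z' := by
  have : (fun φ : X' ⟶ Z' => (D.restr f).map φ) =
      ((D.restr f).mapIso e).homCongr ((D.restr f).mapIso e') ∘ (fun φ => (D.restr f).map φ) ∘
        (e.homCongr e').symm := by
    funext φ; simp [← Functor.map_comp]
  rw [Bij, this]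
  exact (Equiv.bijective _).comp (Function.Bijective.comp h (Equiv.bijective _))

lemma bij_of_full_faithful (f : A ⥤ B) [(D.restr f).Full] [(D.restr f).Faithful] (X Z : D.Diag B) :
    D.Bij f X Z :=
  ⟨(D.restr f).map_injective, (D.restr f).map_surjective⟩

variable (D) in
lemma isEquivalence_restr_of_inverse {f : A ⥤ B} {g : B ⥤ A} (hfg : f ⋙ g = 𝟭 A)
    (hgf : g ⋙ f = 𝟭 B) : (D.restr f).IsEquivalence := by
  have h1 : D.restr f ⋙ D.restr g = 𝟭 _ := by rw [← restr_comp, hgf, restr_id]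
  have h2 : D.restr g ⋙ D.restr f = 𝟭 _ := by rw [← restr_comp, hfg, restr_id]
  exact (CategoryTheory.Equivalence.mk (D.restr f) (D.restr g) (eqToIso h1.symm)
    (eqToIso h2)).isEquivalence_functor

/-- Transport along a commutative square with invertible horizontal functors. -/
lemma Bij.transport {A' B' : Type w} [SmallCategory A'] [SmallCategory B'] {f : A ⥤ B}
    {f' : A' ⥤ B'} {e : A' ⥤ A} {e' : B' ⥤ B} [(D.restr e).IsEquivalence]
    [(D.restr e').IsEquivalence] (w : f' ⋙ e' = e ⋙ f) {X Z : D.Diag B} :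
    D.Bij f X Z ↔ D.Bij f' ((D.restr e').obj X) ((D.restr e').obj Z) :=
  ⟨fun h => (((bij_of_full_faithful e _ _).comp h).congr w.symm).of_comp_right
      (bij_of_full_faithful e' _ _),
    fun h => ((h.comp (bij_of_full_faithful e' _ _)).congr w).of_comp_left
      (bij_of_full_faithful e _ _)⟩

/-- A fully faithful right adjoint `k` is final. -/
lemma bij_of_adjunction {l : A ⥤ B} {k : B ⥤ A} (adj : l ⊣ k) [IsIso adj.counit] (X : D.Diag A)
    (Y : D.Diag B) : D.Bij k X ((D.restr l).obj Y) := by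
  have : IsIso ((D.restrAdj adj).counit) :=
    inferInstanceAs (IsIso (eqToHom (D.restr_comp k l).symm ≫ D.restrMap adj.counit ≫
      eqToHom D.restr_id))
  have h : (fun φ : X ⟶ (D.restr l).obj Y => (D.restr k).map φ) =
      (fun φ => φ ≫ inv ((D.restrAdj adj).counit.app Y)) ∘ ((D.restrAdj adj).homEquiv X Y).symm := by
    funext φ
    simp [Adjunction.homEquiv_counit]
  rw [Bij, h]
  exact (((asIso ((D.restrAdj adj).counit.app Y)).symm.homToEquiv).bijective).comp
    (Equiv.bijective _)

/-- A fully faithful left adjoint `l` is initial. -/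
lemma bij_of_adjunction' {l : A ⥤ B} {k : B ⥤ A} (adj : l ⊣ k) [IsIso adj.unit] (X : D.Diag A)
    (Y : D.Diag B) : D.Bij l ((D.restr k).obj X) Y := by
  have : IsIso ((D.restrAdj adj).unit) :=
    inferInstanceAs (IsIso (eqToHom D.restr_id.symm ≫ D.restrMap adj.unit ≫
      eqToHom (D.restr_comp l k)))
  have h : (fun φ : (D.restr k).obj X ⟶ Y => (D.restr l).map φ) =
      (fun φ => inv ((D.restrAdj adj).unit.app X) ≫ φ) ∘ ((D.restrAdj adj).homEquiv X Y) := by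
    funext φ
    simp [Adjunction.homEquiv_unit]
  rw [Bij, h]
  exact (((asIso ((D.restrAdj adj).unit.app X)).homFromEquiv).bijective).comp
    (Equiv.bijective _)

end Bij

/-! ### Colimiting and limiting cones -/

section Cones

variable {D : Prederivator.{w, v, u}}
variable {J : Type w} [SmallCategory J]

/-- `θ` exhibits `L` as the colimit of the coherent diagram `V`. -/
def IsColimCone (q : J ⥤ OneCat.{w}) {V : D.Diag J} {L : D.Diag OneCat.{w}}
    (θ : V ⟶ (D.restr q).obj L) : Prop :=
  ∀ Y, Function.Bijective (fun φ : L ⟶ Y => θ ≫ (D.restr q).map φ)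

/-- `θ` exhibits `L` as the limit of the coherent diagram `V`. -/
def IsLimCone (q : J ⥤ OneCat.{w}) {V : D.Diag J} {L : D.Diag OneCat.{w}}
    (θ : (D.restr q).obj L ⟶ V) : Prop :=
  ∀ Y, Function.Bijective (fun φ : Y ⟶ L => (D.restr q).map φ ≫ θ)

lemma isIso_of_bijective_comp {E : Type*} [Category* E] {a b : E} (f : a ⟶ b)
    (h : ∀ c, Function.Bijective (fun g : b ⟶ c => f ≫ g)) : IsIso f :=
  (isIso_iff_coyoneda_map_bijective f).2 h

lemma isIso_of_bijective_comp' {E : Type*} [Category* E] {a b : E} (f : a ⟶ b)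
    (h : ∀ c, Function.Bijective (fun g : c ⟶ a => g ≫ f)) : IsIso f :=
  (isIso_iff_yoneda_map_bijective f).2 h

lemma bijective_comp_of_isIso {E : Type*} [Category* E] {a b : E} (f : a ⟶ b) [IsIso f] (c : E) :
    Function.Bijective (fun g : b ⟶ c => f ≫ g) :=
  (isIso_iff_coyoneda_map_bijective f).1 inferInstance c

lemma bijective_comp_of_isIso' {E : Type*} [Category* E] {a b : E} (f : a ⟶ b) [IsIso f] (c : E) :
    Function.Bijective (fun g : c ⟶ a => g ≫ f) :=
  (isIso_iff_yoneda_map_bijective f).1 inferInstance c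

/-- The adjunction `q ⊣ t` for a terminal object `t`. -/
def terminalAdj (q : J ⥤ OneCat.{w}) {t : J} (ht : IsTerminal t) : q ⊣ pt t :=
  Adjunction.mkOfUnitCounit
    { unit := { app := fun j => ht.from j, naturality := fun _ _ _ => ht.hom_ext _ _ }
      counit := { app := fun _ => eqToHom (Subsingleton.elim _ _) }
      left_triangle := by ext; exact Subsingleton.elim _ _
      right_triangle := by ext; exact ht.hom_ext _ _ }

/-- The adjunction `t ⊣ q` for an initial object `t`. -/
def initialAdj (q : J ⥤ OneCat.{w}) {t : J} (ht : IsInitial t) : pt t ⊣ q :=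
  Adjunction.mkOfUnitCounit
    { unit := { app := fun _ => eqToHom (Subsingleton.elim _ _) }
      counit := { app := fun j => ht.to j, naturality := fun _ _ _ => ht.hom_ext _ _ }
      left_triangle := by ext; exact ht.hom_ext _ _
      right_triangle := by ext; exact Subsingleton.elim _ _ }

instance (q : J ⥤ OneCat.{w}) {t : J} (ht : IsTerminal t) : IsIso (terminalAdj q ht).counit := by
  have : ∀ x, IsIso ((terminalAdj q ht).counit.app x) := fun x =>
    inferInstanceAs (IsIso (eqToHom (Subsingleton.elim ((pt t ⋙ q).obj x) x)))
  exact NatIso.isIso_of_isIso_app _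

instance (q : J ⥤ OneCat.{w}) {t : J} (ht : IsInitial t) : IsIso (initialAdj q ht).unit := by
  have : ∀ x, IsIso ((initialAdj q ht).unit.app x) := fun x =>
    inferInstanceAs (IsIso (eqToHom (Subsingleton.elim x ((pt t ⋙ q).obj x))))
  exact NatIso.isIso_of_isIso_app _

lemma functor_oneCat_eq (f g : J ⥤ OneCat.{w}) : f = g :=
  CategoryTheory.Functor.ext (fun _ => Subsingleton.elim _ _) (fun _ _ _ => Subsingleton.elim _ _)

lemma bij_pt_comp (q : J ⥤ OneCat.{w}) (t : J) (X Z : D.Diag OneCat.{w}) :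
    Function.Bijective (fun φ : X ⟶ Z => (D.ev t).map ((D.restr q).map φ)) := by
  rw [← bij_comp_iff, functor_oneCat_eq (pt t ⋙ q) (𝟭 _)]
  have : (D.restr (𝟭 OneCat.{w})).IsEquivalence := D.isEquivalence_restr_of_inverse (g := 𝟭 _) rfl rfl
  exact bij_of_full_faithful _ _ _

lemma ev_restr_obj (q : J ⥤ OneCat.{w}) (t : J) (X : D.Diag OneCat.{w}) :
    (D.ev t).obj ((D.restr q).obj X) = X := by
  rw [← restr_comp_obj, functor_oneCat_eq (pt t ⋙ q) (𝟭 _), restr_id_obj]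

/-- A terminal object is final, so cones may be tested after evaluation at `t`. -/
lemma isColimCone_iff_of_isTerminal (q : J ⥤ OneCat.{w}) {t : J} (ht : IsTerminal t) {V : D.Diag J}
    {L : D.Diag OneCat.{w}} (θ : V ⟶ (D.restr q).obj L) :
    IsColimCone q θ ↔ IsIso ((D.ev t).map θ) := by
  have key : ∀ Y, Function.Bijective (fun φ : L ⟶ Y => θ ≫ (D.restr q).map φ) ↔
      Function.Bijective (fun ψ : (D.ev t).obj ((D.restr q).obj L) ⟶
        (D.ev t).obj ((D.restr q).obj Y) => (D.ev t).map θ ≫ ψ) := fun Y => by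
    rw [← Function.Bijective.of_comp_iff' (bij_of_adjunction (terminalAdj q ht) V Y),
      ← Function.Bijective.of_comp_iff _ (bij_pt_comp q t L Y)]
    refine iff_of_eq (congrArg _ ?_)
    funext φ
    simp
  refine ⟨fun h => isIso_of_bijective_comp _ fun Y => ?_, fun h Y => (key Y).2
    (bijective_comp_of_isIso _ _)⟩
  exact (congrArg (fun c => Function.Bijective (fun ψ : _ ⟶ c => (D.ev t).map θ ≫ ψ))
    (ev_restr_obj q t Y)).mp ((key Y).1 (h Y))

lemma isLimCone_iff_of_isInitial (q : J ⥤ OneCat.{w}) {t : J} (ht : IsInitial t) {V : D.Diag J}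
    {L : D.Diag OneCat.{w}} (θ : (D.restr q).obj L ⟶ V) :
    IsLimCone q θ ↔ IsIso ((D.ev t).map θ) := by
  have key : ∀ Y, Function.Bijective (fun φ : Y ⟶ L => (D.restr q).map φ ≫ θ) ↔
      Function.Bijective (fun ψ : (D.ev t).obj ((D.restr q).obj Y) ⟶
        (D.ev t).obj ((D.restr q).obj L) => ψ ≫ (D.ev t).map θ) := fun Y => by
    rw [← Function.Bijective.of_comp_iff' (bij_of_adjunction' (initialAdj q ht) Y V),
      ← Function.Bijective.of_comp_iff _ (bij_pt_comp q t Y L)]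
    refine iff_of_eq (congrArg _ ?_)
    funext φ
    simp
  refine ⟨fun h => isIso_of_bijective_comp' _ fun Y => ?_, fun h Y => (key Y).2
    (bijective_comp_of_isIso' _ _)⟩
  exact (congrArg (fun c => Function.Bijective (fun ψ : c ⟶ _ => ψ ≫ (D.ev t).map θ))
    (ev_restr_obj q t Y)).mp ((key Y).1 (h Y))

end Cones

/-! ### Pointwise Kan extensions -/

section Pointwise

variable {D : Prederivator.{w, v, u}}
variable {A C : Type w} [SmallCategory A] [SmallCategory C]

/-- The cone on `X|_{f/c}` with vertex `X_c`. -/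
def colimCone (f : A ⥤ C) (c : C) (X : D.Diag C) :
    (D.restr (Comma.fst f (pt c))).obj ((D.restr f).obj X) ⟶
      (D.restr (Comma.snd f (pt c))).obj ((D.ev c).obj X) :=
  (D.square (Comma.natTrans f (pt c))).natTrans.app X

/-- The cone on `X|_{c/f}` with vertex `X_c`. -/
def limCone (f : A ⥤ C) (c : C) (X : D.Diag C) :
    (D.restr (Comma.fst (pt c) f)).obj ((D.ev c).obj X) ⟶
      (D.restr (Comma.snd (pt c) f)).obj ((D.restr f).obj X) :=
  (D.square (Comma.natTrans (pt c) f)).natTrans.app X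

lemma colimCone_naturality (f : A ⥤ C) (c : C) {X Y : D.Diag C} (φ : X ⟶ Y) :
    (D.restr (Comma.fst f (pt c))).map ((D.restr f).map φ) ≫ colimCone f c Y =
      colimCone f c X ≫ (D.restr (Comma.snd f (pt c))).map ((D.ev c).map φ) :=
  (D.square (Comma.natTrans f (pt c))).natTrans.naturality φ

lemma limCone_naturality (f : A ⥤ C) (c : C) {X Y : D.Diag C} (φ : X ⟶ Y) :
    (D.restr (Comma.fst (pt c) f)).map ((D.ev c).map φ) ≫ limCone f c Y =
      limCone f c X ≫ (D.restr (Comma.snd (pt c) f)).map ((D.restr f).map φ) :=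
  (D.square (Comma.natTrans (pt c) f)).natTrans.naturality φ

variable [D.IsDerivator]

/-- This is (Der4): the cone is the adjunct of the mate `q_! p^* ⟶ c^* f_!`, and it is colimiting
because the mate is invertible. -/
lemma isColimCone_lan (f : A ⥤ C) (c : C) (X : D.Diag A) :
    IsColimCone (Comma.snd f (pt c)) ((D.restr (Comma.fst f (pt c))).map ((D.lanAdj f).unit.app X) ≫
      colimCone f c ((D.lan f).obj X)) := fun Y => by
  have := IsDerivator.der4_lan (D := D) f c
  have h := unit_mateEquiv_symm (D.lanAdj f) (D.lanAdj (Comma.snd f (pt c)))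
    (D.square (Comma.natTrans f (pt c))) X
  have e : (fun φ : (D.ev c).obj ((D.lan f).obj X) ⟶ Y =>
      ((D.restr (Comma.fst f (pt c))).map ((D.lanAdj f).unit.app X) ≫
        colimCone f c ((D.lan f).obj X)) ≫ (D.restr (Comma.snd f (pt c))).map φ) =
      ((D.lanAdj (Comma.snd f (pt c))).homEquiv _ Y) ∘ (fun φ =>
        ((mateEquiv (D.lanAdj f) (D.lanAdj (Comma.snd f (pt c)))).symm
          (D.square (Comma.natTrans f (pt c)))).natTrans.app X ≫ φ) := by
    funext φ
    refine (congrArg (fun t => t ≫ (D.restr (Comma.snd f (pt c))).map φ) h).trans ?_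
    simp [Adjunction.homEquiv_unit]
  rw [e]
  exact (Equiv.bijective _).comp (bijective_comp_of_isIso _ _)

lemma isLimCone_ran (f : A ⥤ C) (c : C) (X : D.Diag A) :
    IsLimCone (Comma.fst (pt c) f) (limCone f c ((D.ran f).obj X) ≫
      (D.restr (Comma.snd (pt c) f)).map ((D.ranAdj f).counit.app X)) := fun Y => by
  have := IsDerivator.der4_ran (D := D) f c
  have h := mateEquiv_counit (D.ranAdj f) (D.ranAdj (Comma.fst (pt c) f))
    (D.square (Comma.natTrans (pt c) f)) X
  have e : (fun φ : Y ⟶ (D.ev c).obj ((D.ran f).obj X) =>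
      (D.restr (Comma.fst (pt c) f)).map φ ≫ limCone f c ((D.ran f).obj X) ≫
      (D.restr (Comma.snd (pt c) f)).map ((D.ranAdj f).counit.app X)) =
      ((D.ranAdj (Comma.fst (pt c) f)).homEquiv Y _).symm ∘ (fun φ =>
        φ ≫ (mateEquiv (D.ranAdj f) (D.ranAdj (Comma.fst (pt c) f))
          (D.square (Comma.natTrans (pt c) f))).natTrans.app X) := by
    funext φ
    refine (congrArg (fun t => (D.restr (Comma.fst (pt c) f)).map φ ≫ t) h.symm).trans ?_
    simp [Adjunction.homEquiv_counit]
  rw [e]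
  exact (Equiv.bijective _).comp (bijective_comp_of_isIso' _ _)

/-- `X` is the left Kan extension of its restriction along `f` if it is so pointwise. -/
lemma bij_of_isColimCone (f : A ⥤ C) (X : D.Diag C)
    (h : ∀ c, IsColimCone (Comma.snd f (pt c)) (colimCone f c X)) (Z : D.Diag C) : D.Bij f X Z := by
  let ε : (D.lan f).obj ((D.restr f).obj X) ⟶ X := (D.lanAdj f).counit.app X
  -- By (Der2) it suffices to look at each `c`. There `ε_c` carries the colimiting cone of the Kan
  -- extension to the cone of `X`, which is colimiting by hypothesis.
  have hε : IsIso ε := by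
    refine IsDerivator.der2 _ fun c => isIso_of_bijective_comp _ fun Y => ?_
    rw [← Function.Bijective.of_comp_iff' (isColimCone_lan f c ((D.restr f).obj X) Y)]
    refine (congrArg Function.Bijective (funext fun φ => Eq.symm ?_)).mp (h c Y)
    have := colimCone_naturality f c ε
    have tri := (D.lanAdj f).right_triangle_components X
    have e2 := congrArg (D.restr (Comma.fst f (pt c))).map tri
    rw [Functor.map_comp] at e2
    simp only [Function.comp, Functor.map_comp, Category.assoc, ε] at this ⊢
    rw [← reassoc_of% this, reassoc_of% e2]
    simp
  have e : (fun φ : X ⟶ Z => (D.restr f).map φ) =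
      (D.lanAdj f).homEquiv _ _ ∘ (fun φ => ε ≫ φ) := by
    funext φ
    simp [ε, Adjunction.homEquiv_unit]
  rw [Bij, e]
  exact (Equiv.bijective _).comp (bijective_comp_of_isIso _ _)

/-- `X` is the right Kan extension of its restriction along `f` if it is so pointwise. -/
lemma bij_of_isLimCone (f : A ⥤ C) (X : D.Diag C)
    (h : ∀ c, IsLimCone (Comma.fst (pt c) f) (limCone f c X)) (Z : D.Diag C) : D.Bij f Z X := by
  let η : X ⟶ (D.ran f).obj ((D.restr f).obj X) := (D.ranAdj f).unit.app X
  have hη : IsIso η := by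
    refine IsDerivator.der2 _ fun c => isIso_of_bijective_comp' _ fun Y => ?_
    rw [← Function.Bijective.of_comp_iff' (isLimCone_ran f c ((D.restr f).obj X) Y)]
    refine (congrArg Function.Bijective (funext fun φ => Eq.symm ?_)).mp (h c Y)
    have := limCone_naturality f c η
    have tri := (D.ranAdj f).left_triangle_components X
    have e2 := congrArg (D.restr (Comma.snd (pt c) f)).map tri
    rw [Functor.map_comp] at e2
    simp only [Function.comp, Functor.map_comp, Category.assoc, η] at this ⊢
    rw [reassoc_of% this, e2]
    simp
  have e : (fun φ : Z ⟶ X => (D.restr f).map φ) =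
      ((D.ranAdj f).homEquiv _ _).symm ∘ (fun φ => φ ≫ η) := by
    funext φ
    simp [η, Adjunction.homEquiv_counit]
  rw [Bij, e]
  exact (Equiv.bijective _).comp (bijective_comp_of_isIso' _ _)

end Pointwise

/-! ### Kan extensions along fully faithful functors -/

section FullyFaithful

variable {D : Prederivator.{w, v, u}}
variable {A C : Type w} [SmallCategory A] [SmallCategory C]

lemma isIso_ev_map_square {E B : Type w} [SmallCategory E] [SmallCategory B] {p : E ⥤ A}
    {q : E ⥤ B} {f : A ⥤ C} {g : B ⥤ C} (α : p ⋙ f ⟶ q ⋙ g) (t : E) [IsIso (α.app t)]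
    (X : D.Diag C) : IsIso ((D.ev t).map ((D.square α).natTrans.app X)) := by
  have : IsIso (Functor.whiskerLeft (pt t) α) := by
    have : ∀ x, IsIso ((Functor.whiskerLeft (pt t) α).app x) := fun x =>
      inferInstanceAs (IsIso (α.app t))
    exact NatIso.isIso_of_isIso_app _
  have h2 : IsIso ((D.ev t).map ((D.restrMap α).app X)) := by
    rw [restr_map_restrMap]; infer_instance
  have e : (D.square α).natTrans.app X = eqToHom (D.restr_comp_obj p f X).symm ≫
      (D.restrMap α).app X ≫ eqToHom (D.restr_comp_obj q g X) := by
    rw [square]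
    simp only [NatTrans.comp_app, eqToHom_app]
  rw [e, Functor.map_comp, Functor.map_comp, eqToHom_map, eqToHom_map]
  infer_instance

/-- The terminal object of `f/f(a)`. -/
abbrev overId (f : A ⥤ C) (a : A) : Comma f (pt.{w} (f.obj a)) := ⟨a, ⟨⟨⟩⟩, 𝟙 _⟩

/-- The initial object of `f(a)/f`. -/
abbrev underId (f : A ⥤ C) (a : A) : Comma (pt.{w} (f.obj a)) f := ⟨⟨⟨⟩⟩, a, 𝟙 _⟩

/-- `overId f a` is terminal if `f` is fully faithful. -/
noncomputable def isTerminalOverId (f : A ⥤ C) [f.Full] [f.Faithful] (a : A) :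
    IsTerminal (overId f a) :=
  IsTerminal.ofUniqueHom
    (fun x => { left := f.preimage x.hom, right := eqToHom (Subsingleton.elim _ _) })
    (fun x m => by
      ext
      · apply f.map_injective
        have := m.w
        simp at this
        simpa using this
      · exact Subsingleton.elim _ _)

/-- `underId f a` is initial if `f` is fully faithful. -/
noncomputable def isInitialUnderId (f : A ⥤ C) [f.Full] [f.Faithful] (a : A) :
    IsInitial (underId f a) :=
  IsInitial.ofUniqueHom
    (fun x => { left := eqToHom (Subsingleton.elim _ _), right := f.preimage x.hom })
    (fun x m => by
      ext
      · exact Subsingleton.elim _ _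
      · apply f.map_injective
        have := m.w
        simp at this
        simpa using this.symm)

/-- The slice `f/f(a)` has the terminal object `(a, 𝟙)`, at which the cone is an identity up to
transport. Hence the pointwise condition for a left Kan extension is void on the image of `f`. -/
lemma isColimCone_colimCone_obj (f : A ⥤ C) [f.Full] [f.Faithful] (a : A) (X : D.Diag C) :
    IsColimCone (Comma.snd f (pt (f.obj a))) (colimCone f (f.obj a) X) := by
  rw [isColimCone_iff_of_isTerminal _ (isTerminalOverId f a)]
  have : IsIso ((Comma.natTrans f (pt (f.obj a))).app (overId f a)) :=
    inferInstanceAs (IsIso (𝟙 (f.obj a)))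
  exact isIso_ev_map_square _ _ _

lemma isLimCone_limCone_obj (f : A ⥤ C) [f.Full] [f.Faithful] (a : A) (X : D.Diag C) :
    IsLimCone (Comma.fst (pt (f.obj a)) f) (limCone f (f.obj a) X) := by
  rw [isLimCone_iff_of_isInitial _ (isInitialUnderId f a)]
  have : IsIso ((Comma.natTrans (pt (f.obj a)) f).app (underId f a)) :=
    inferInstanceAs (IsIso (𝟙 (f.obj a)))
  exact isIso_ev_map_square _ _ _

lemma pt_comp {J : Type w} [SmallCategory J] (j : J) (p : J ⥤ A) : pt j ⋙ p = pt (p.obj j) :=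
  CategoryTheory.Functor.ext (fun _ => rfl) (fun x y m => by simp)

lemma ev_restr_map (p : A ⥤ C) (a : A) {X Y : D.Diag C} (φ : X ⟶ Y) :
    (D.ev a).map ((D.restr p).map φ) =
      eqToHom (by rw [← restr_comp_obj, pt_comp]) ≫ (D.ev (p.obj a)).map φ ≫
        eqToHom (by rw [← restr_comp_obj, pt_comp]) := by
  rw [restr_map_map, restr_congr_map D (pt_comp a p)]
  simp

lemma isIso_ev_restr_map_iff (p : A ⥤ C) (a : A) {X Y : D.Diag C} (φ : X ⟶ Y) :
    IsIso ((D.ev a).map ((D.restr p).map φ)) ↔ IsIso ((D.ev (p.obj a)).map φ) := by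
  rw [ev_restr_map]
  constructor
  · intro h
    rw [isIso_comp_left_iff, isIso_comp_right_iff] at h
    exact h
  · intro h; infer_instance

lemma isZero_ev_restr_iff (p : A ⥤ C) (a : A) (X : D.Diag C) :
    IsZero ((D.ev a).obj ((D.restr p).obj X)) ↔ IsZero ((D.ev (p.obj a)).obj X) := by
  rw [← restr_comp_obj, pt_comp]

variable [D.IsDerivator]

/-- Over `f/f(a)` two cones to the Kan extension at `f(a)` are colimiting: the one of (Der4) and the
tautological one. They differ by the unit, and both are tested at the terminal object of the slice.
-/
instance isIso_lanAdj_unit_app (f : A ⥤ C) [f.Full] [f.Faithful] (X : D.Diag A) :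
    IsIso ((D.lanAdj f).unit.app X) := by
  refine IsDerivator.der2 _ fun a => ?_
  have h := isColimCone_lan f (f.obj a) X
  rw [isColimCone_iff_of_isTerminal _ (isTerminalOverId f a), Functor.map_comp] at h
  have h2 := isColimCone_colimCone_obj f a ((D.lan f).obj X)
  rw [isColimCone_iff_of_isTerminal _ (isTerminalOverId f a)] at h2
  rw [isIso_comp_right_iff] at h
  exact (isIso_ev_restr_map_iff (Comma.fst f (pt (f.obj a))) (overId f a) _).1 h

instance isIso_ranAdj_counit_app (f : A ⥤ C) [f.Full] [f.Faithful] (X : D.Diag A) :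
    IsIso ((D.ranAdj f).counit.app X) := by
  refine IsDerivator.der2 _ fun a => ?_
  have h := isLimCone_ran f (f.obj a) X
  rw [isLimCone_iff_of_isInitial _ (isInitialUnderId f a), Functor.map_comp] at h
  have h2 := isLimCone_limCone_obj f a ((D.ran f).obj X)
  rw [isLimCone_iff_of_isInitial _ (isInitialUnderId f a)] at h2
  rw [isIso_comp_left_iff] at h
  exact (isIso_ev_restr_map_iff (Comma.snd (pt (f.obj a)) f) (underId f a) _).1 h

end FullyFaithful

/-! ### Empty and disjoint shapes, zero objects -/

section Zero

variable {D : Prederivator.{w, v, u}} [D.IsDerivator]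
variable {J : Type w} [SmallCategory J]

lemma bijective_sigma {I : Type w} (A : I → Type w) [∀ i, SmallCategory (A i)]
    (X Z : D.Diag (Σ i, A i)) :
    Function.Bijective (fun (φ : X ⟶ Z) (i : I) => (D.restr (Sigma.incl (C := A) i)).map φ) := by
  have := IsDerivator.der1 (D := D) A
  let F := Functor.pi' (fun i => D.restr (Sigma.incl (C := A) i))
  exact ⟨fun a b h => F.map_injective h, fun g => F.map_surjective g⟩

/-- (Der1) for the empty family, transported along the isomorphism from the empty coproduct to `J`.
-/
lemma unique_hom_of_isEmpty [IsEmpty J] (X Z : D.Diag J) : Nonempty (Unique (X ⟶ Z)) := by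
  let A : PEmpty.{w + 1} → Type w := fun i => i.elim
  let _ : ∀ i, SmallCategory (A i) := fun i => i.elim
  have hA : IsEmpty (Σ i, A i) := ⟨fun x => x.1.elim⟩
  let F : (Σ i, A i) ⥤ J := { obj := fun x => x.1.elim, map := fun {x} => x.1.elim, map_id := fun x => x.1.elim, map_comp := fun {x} => x.1.elim }
  let G : J ⥤ (Σ i, A i) := { obj := fun x => isEmptyElim x, map := fun {x} => isEmptyElim x, map_id := fun x => isEmptyElim x, map_comp := fun {x} => isEmptyElim x }
  have : (D.restr F).IsEquivalence := D.isEquivalence_restr_of_inverse (g := G)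
    (CategoryTheory.Functor.ext (fun x => isEmptyElim x) (fun x => isEmptyElim x))
    (CategoryTheory.Functor.ext (fun x => isEmptyElim x) (fun x => isEmptyElim x))
  have hb := Function.Bijective.comp (bijective_sigma A ((D.restr F).obj X) ((D.restr F).obj Z))
    (bij_of_full_faithful F X Z)
  exact ⟨{ default := (hb.2 (fun i => i.elim)).choose
           uniq := fun φ => hb.1 (funext fun i => i.elim) }⟩

lemma isColimCone_of_isEmpty [IsEmpty J] (q : J ⥤ OneCat.{w}) {V : D.Diag J}
    {L : D.Diag OneCat.{w}} (hL : IsZero L) (θ : V ⟶ (D.restr q).obj L) : IsColimCone q θ :=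
  fun Y => by
    obtain ⟨_⟩ := unique_hom_of_isEmpty V ((D.restr q).obj Y)
    exact ⟨fun a b _ => hL.eq_of_src a b, fun g => ⟨hL.to_ Y, Subsingleton.elim _ _⟩⟩

lemma isLimCone_of_isEmpty [IsEmpty J] (q : J ⥤ OneCat.{w}) {V : D.Diag J}
    {L : D.Diag OneCat.{w}} (hL : IsZero L) (θ : (D.restr q).obj L ⟶ V) : IsLimCone q θ :=
  fun Y => by
    obtain ⟨_⟩ := unique_hom_of_isEmpty ((D.restr q).obj Y) V
    exact ⟨fun a b _ => hL.eq_of_tgt a b, fun g => ⟨hL.from_ Y, Subsingleton.elim _ _⟩⟩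

lemma isZero_of_isColimCone_of_isEmpty [HasZeroObject (D.Diag OneCat.{w})] [IsEmpty J]
    (q : J ⥤ OneCat.{w}) {V : D.Diag J} {L : D.Diag OneCat.{w}} {θ : V ⟶ (D.restr q).obj L}
    (h : IsColimCone q θ) : IsZero L := by
  have hb : ∀ Y, Nonempty (Unique (L ⟶ Y)) := fun Y => by
    obtain ⟨_⟩ := unique_hom_of_isEmpty V ((D.restr q).obj Y)
    exact ⟨{ default := ((h Y).2 default).choose
             uniq := fun φ => (h Y).1 (Subsingleton.elim _ _) }⟩
  have hI : IsInitial L := IsInitial.ofUniqueHom (fun Y => (hb Y).some.default)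
    (fun Y m => (hb Y).some.uniq m)
  obtain ⟨Z, hZ⟩ := HasZeroObject.zero (C := D.Diag OneCat.{w})
  exact hZ.of_iso (hI.uniqueUpToIso hZ.isInitial)

/-- Restriction has adjoints on both sides, so it preserves both initial and terminal objects. -/
lemma isZero_restr (q : J ⥤ OneCat.{w}) {L : D.Diag OneCat.{w}} (hL : IsZero L) :
    IsZero ((D.restr q).obj L) where
  unique_to Y := by
    have e := (D.ranAdj q).homEquiv L Y
    exact ⟨{ default := e.symm (hL.to_ _), uniq := fun a => e.injective (hL.eq_of_src _ _) }⟩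
  unique_from Y := by
    have e := (D.lanAdj q).homEquiv Y L
    exact ⟨{ default := e (hL.from_ _), uniq := fun a => e.symm.injective (hL.eq_of_tgt _ _) }⟩

end Zero

/-! ### Posets -/

section Thin

variable {D : Prederivator.{w, v, u}}
variable {A C J : Type w} [SmallCategory A] [SmallCategory C] [SmallCategory J]

lemma functor_ext_of_isThin [Quiver.IsThin C] {f g : J ⥤ C} (h : ∀ j, f.obj j = g.obj j) : f = g :=
  CategoryTheory.Functor.ext h (fun _ _ _ => Subsingleton.elim _ _)

lemma restrMap_app_congr_of_isThin [Quiver.IsThin C] {m m' n n' : J ⥤ C} (α : m ⟶ n)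
    (α' : m' ⟶ n') (hm : m = m') (hn : n = n') (X : D.Diag C) :
    (D.restrMap α).app X = eqToHom (D.restr_congr_obj hm X) ≫ (D.restrMap α').app X ≫
      eqToHom (D.restr_congr_obj hn.symm X) := by
  subst hm hn
  have : α = α' := by ext; exact Subsingleton.elim _ _
  simp [this]

lemma colimCone_eq (f : A ⥤ C) (c : C) (X : D.Diag C) : colimCone f c X =
    eqToHom (D.restr_comp_obj _ f X).symm ≫ (D.restrMap (Comma.natTrans f (pt c))).app X ≫
      eqToHom (D.restr_comp_obj _ (pt c) X) := by
  rw [colimCone, square]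
  simp only [NatTrans.comp_app, eqToHom_app]

/-- The functor to the point. -/
abbrev toPt (J : Type w) [SmallCategory J] : J ⥤ OneCat.{w} := (Functor.const J).obj ⟨⟨⟩⟩

/-- A pointwise criterion for left Kan extensions of posets at an object which is the last vertex
of a cocartesian square. -/
lemma isColimCone_of_square [Quiver.IsThin C] (f : A ⥤ C) (s : Sq.{w} ⥤ C) (g : UL.{w} ⥤ A)
    (hw : ∀ x, s.obj (inclUL.obj x) = f.obj (g.obj x)) [g.Full] [g.Faithful]
    (hg : ∀ a, (f.obj a ⟶ s.obj (sq 1 1)) → ∃ x, g.obj x = a)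
    (X : D.Diag C)
    (h : ∀ Y : D.Diag OneCat.{w}, D.Bij inclUL ((D.restr s).obj X) ((D.restr (toPt _)).obj Y)) :
    IsColimCone (Comma.snd f (pt (s.obj (sq 1 1)))) (colimCone f (s.obj (sq 1 1)) X) := fun Y => by
  have hle : ∀ x : Sq.{w}, x ≤ sq 1 1 := fun x =>
    ⟨Fin.le_last x.down.1, Fin.le_last x.down.2⟩
  let c := s.obj (sq 1 1)
  -- By `hg` everything over the last vertex comes from `⌜`, so `v` is an equivalence onto the slice
  -- `f/c` and the cone can be tested on `⌜`.
  let v : UL.{w} ⥤ Comma f (pt c) :=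
    { obj := fun x => ⟨g.obj x, ⟨⟨⟩⟩, eqToHom (hw x).symm ≫ s.map (homOfLE (hle x.1))⟩
      map := fun m => { left := g.map m, right := 𝟙 _, w := Subsingleton.elim _ _ } }
  have hvf : v.Faithful := ⟨fun {x y a b} h => g.map_injective (congrArg CommaMorphism.left h)⟩
  have hvF : v.Full := ⟨fun {x y} m => ⟨g.preimage m.left, by
    ext
    · exact g.map_preimage m.left
    · exact Subsingleton.elim _ _⟩⟩
  have hvE : v.EssSurj := ⟨fun y => by
    obtain ⟨a, r, hy⟩ := y
    obtain ⟨x, rfl⟩ := hg a hy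
    exact ⟨x, ⟨Comma.isoMk (Iso.refl _) (eqToIso (Subsingleton.elim _ _))
      (Subsingleton.elim _ _)⟩⟩⟩
  have hve : v.IsEquivalence := {}
  let adj := v.asEquivalence.toAdjunction
  have hb : ∀ (W : D.Diag (Comma f (pt c))),
      D.Bij v W ((D.restr (Comma.snd f (pt c))).obj Y) := fun W => by
    have := bij_of_adjunction v.asEquivalence.symm.toAdjunction W ((D.restr (toPt _)).obj Y)
    rw [← restr_comp_obj] at this
    exact functor_oneCat_eq (v.inv ⋙ toPt _) (Comma.snd f (pt c)) ▸ this
  have ht : IsTerminal (sq.{w} 1 1) := IsTerminal.ofUniqueHom (fun x => homOfLE (hle x))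
    (fun _ _ => Subsingleton.elim _ _)
  let α : s ⟶ toPt _ ⋙ pt c := { app := fun x => s.map (homOfLE (hle x)) }
  -- `θ` is the tautological cone on the whole square. It is colimiting since `(1,1)` is terminal,
  -- and `h` says that nothing changes on restricting it to `⌜`, where it becomes the cone in
  -- question.
  let θ : (D.restr s).obj X ⟶ (D.restr (toPt _)).obj ((D.ev c).obj X) :=
    (D.restrMap α).app X ≫ eqToHom (D.restr_comp_obj _ _ X)
  have hα : IsIso (Functor.whiskerLeft (pt (sq 1 1)) α) := by
    have : ∀ x, IsIso ((Functor.whiskerLeft (pt (sq 1 1)) α).app x) := fun x => by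
      change IsIso (s.map (homOfLE (hle (sq 1 1))))
      rw [Subsingleton.elim (homOfLE (hle (sq 1 1))) (𝟙 _)]
      infer_instance
    exact NatIso.isIso_of_isIso_app _
  have hθ : IsIso ((D.ev (sq 1 1)).map θ) := by
    rw [Functor.map_comp, restr_map_restrMap]
    infer_instance
  have h1 := (isColimCone_iff_of_isTerminal (toPt _) ht θ).2 hθ Y
  have h2 := Function.Bijective.comp (h Y) h1
  rw [← Function.Bijective.of_comp_iff' (hb _)]
  have e1 : (D.restr (v ⋙ Comma.fst f (pt c))).obj ((D.restr f).obj X) =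
    (D.restr inclUL).obj ((D.restr s).obj X) := by
      rw [← restr_comp_obj, ← restr_comp_obj]
      exact D.restr_congr_obj (functor_ext_of_isThin fun x => (hw x).symm) X
  have e2 : (D.restr inclUL).obj ((D.restr (toPt _)).obj Y) =
      (D.restr v).obj ((D.restr (Comma.snd f (pt c))).obj Y) := by
    rw [← restr_comp_obj, ← restr_comp_obj]
    exact D.restr_congr_obj (functor_oneCat_eq _ _) Y
  rw [← Function.Bijective.of_comp_iff' (bijective_eqToHom_conj
    ((D.restr_comp_obj _ _ _).symm.trans e1) e2)] at h2
  refine (congrArg Function.Bijective (funext fun φ => ?_)).mp h2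
  have e3 : inclUL ⋙ s = v ⋙ Comma.fst f (pt c) ⋙ f := functor_ext_of_isThin hw
  have e4 : inclUL ⋙ toPt _ ⋙ pt c = v ⋙ Comma.snd f (pt c) ⋙ pt c :=
    functor_ext_of_isThin fun _ => rfl
  simp only [Function.comp, Functor.map_comp, colimCone_eq, θ, eqToHom_map]
  erw [restr_map_restrMap, restr_map_restrMap]
  rw [restrMap_app_congr_of_isThin (Functor.whiskerLeft inclUL α)
    (Functor.whiskerLeft v (Comma.natTrans f (pt c))) e3 e4]
  simp only [restr_map_map]
  rw [D.restr_congr_map (functor_oneCat_eq (inclUL ⋙ toPt _) (v ⋙ Comma.snd f (pt c)))]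
  simp
  rfl

end Thin

/-! ### Cartesian and cocartesian squares -/

section Kan

variable {D : Prederivator.{w, v, u}} [D.HasKan]
variable {A C : Type w} [SmallCategory A] [SmallCategory C]

lemma isIso_counit_of_bij {f : A ⥤ C} {X : D.Diag C} (h : ∀ Z, D.Bij f X Z) :
    IsIso ((D.lanAdj f).counit.app X) := by
  refine isIso_of_bijective_comp _ fun Z => ?_
  rw [← Function.Bijective.of_comp_iff' ((D.lanAdj f).homEquiv _ _).bijective]
  refine (congrArg Function.Bijective (funext fun φ => ?_)).mp (h Z)
  simp [Adjunction.homEquiv_unit]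

lemma isIso_unit_of_bij {f : A ⥤ C} {X : D.Diag C} (h : ∀ Z, D.Bij f Z X) :
    IsIso ((D.ranAdj f).unit.app X) := by
  refine isIso_of_bijective_comp' _ fun Z => ?_
  rw [← Function.Bijective.of_comp_iff' ((D.ranAdj f).homEquiv _ _).symm.bijective]
  refine (congrArg Function.Bijective (funext fun φ => ?_)).mp (h Z)
  simp [Adjunction.homEquiv_counit]

lemma isCocartesian_of_bij {X : D.Diag Sq.{w}} (h : ∀ Z, D.Bij inclUL X Z) :
    D.IsCocartesian X := by
  have := isIso_counit_of_bij h
  exact ⟨_, ⟨asIso ((D.lanAdj inclUL).counit.app X)⟩⟩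

lemma isCartesian_of_bij {X : D.Diag Sq.{w}} (h : ∀ Z, D.Bij inclLR Z X) :
    D.IsCartesian X := by
  have := isIso_unit_of_bij h
  exact ⟨_, ⟨(asIso ((D.ranAdj inclLR).unit.app X)).symm⟩⟩

end Kan

instance : inclUL.{w}.Faithful := ⟨fun _ => Subsingleton.elim _ _⟩
instance : inclLR.{w}.Faithful := ⟨fun _ => Subsingleton.elim _ _⟩
instance : inclUL.{w}.Full := ⟨fun m => ⟨homOfLE (leOfHom m), Subsingleton.elim _ _⟩⟩
instance : inclLR.{w}.Full := ⟨fun m => ⟨homOfLE (leOfHom m), Subsingleton.elim _ _⟩⟩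

instance full_pt {J : Type w} [SmallCategory J] [Quiver.IsThin J] (j : J) : (pt j).Full :=
  ⟨fun _ => ⟨eqToHom (Subsingleton.elim _ _), Subsingleton.elim _ _⟩⟩
instance faithful_pt {J : Type w} [SmallCategory J] (j : J) : (pt j).Faithful :=
  ⟨fun _ => Subsingleton.elim _ _⟩

instance : cornerUL.{w}.Full := full_pt _
instance : cornerUL.{w}.Faithful := faithful_pt _

/-- The functor `(1,1) : 𝟙 ⥤ ⌟`. -/
def cornerLR : OneCat.{w} ⥤ LR.{w} := pt ⟨sq 1 1, by simp [sq]⟩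

instance : cornerLR.{w}.Full := full_pt _
instance : cornerLR.{w}.Faithful := faithful_pt _

lemma sq_cases {P : Sq.{w} → Prop} (h00 : P (sq 0 0)) (h01 : P (sq 0 1)) (h10 : P (sq 1 0))
    (h11 : P (sq 1 1)) (x : Sq.{w}) : P x := by
  obtain ⟨i, j⟩ := x
  fin_cases i <;> fin_cases j <;> assumption

section Derivator

variable {D : Prederivator.{w, v, u}} [D.IsDerivator]
variable {A C : Type w} [SmallCategory A] [SmallCategory C]

lemma bij_of_mem_essImage_lan {f : A ⥤ C} [f.Full] [f.Faithful] {X : D.Diag C}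
    (h : (D.lan f).essImage X) (Z : D.Diag C) : D.Bij f X Z := by
  obtain ⟨W, ⟨e⟩⟩ := h
  refine Bij.of_iso ?_ e (Iso.refl Z)
  have e : (fun φ : (D.lan f).obj W ⟶ Z => (D.restr f).map φ) =
      (fun ψ => inv ((D.lanAdj f).unit.app W) ≫ ψ) ∘ ((D.lanAdj f).homEquiv _ _) := by
    funext φ
    simp [Adjunction.homEquiv_unit]
  rw [Bij, e]
  exact (bijective_comp_of_isIso _ _).comp (Equiv.bijective _)

lemma bij_of_mem_essImage_ran {f : A ⥤ C} [f.Full] [f.Faithful] {X : D.Diag C}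
    (h : (D.ran f).essImage X) (Z : D.Diag C) : D.Bij f Z X := by
  obtain ⟨W, ⟨e⟩⟩ := h
  refine Bij.of_iso ?_ (Iso.refl Z) e
  have e : (fun φ : Z ⟶ (D.ran f).obj W => (D.restr f).map φ) =
      (fun ψ => ψ ≫ inv ((D.ranAdj f).counit.app W)) ∘ ((D.ranAdj f).homEquiv _ _).symm := by
    funext φ
    simp [Adjunction.homEquiv_counit]
  rw [Bij, e]
  exact (bijective_comp_of_isIso' _ _).comp (Equiv.bijective _)

lemma isCocartesian_iff (X : D.Diag Sq.{w}) : D.IsCocartesian X ↔ ∀ Z, D.Bij inclUL X Z :=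
  ⟨bij_of_mem_essImage_lan, isCocartesian_of_bij⟩

lemma isCartesian_iff (X : D.Diag Sq.{w}) : D.IsCartesian X ↔ ∀ Z, D.Bij inclLR Z X :=
  ⟨bij_of_mem_essImage_ran, isCartesian_of_bij⟩

/-- The Kan condition has content only at `(1,1)`. There it is a statement about a colimit, so
constant targets suffice. -/
lemma isCocartesian_iff_const (X : D.Diag Sq.{w}) :
    D.IsCocartesian X ↔ ∀ Y : D.Diag OneCat.{w}, D.Bij inclUL X ((D.restr (toPt _)).obj Y) := by
  rw [isCocartesian_iff]
  refine ⟨fun h Y => h _, fun h => bij_of_isColimCone _ _ ?_⟩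
  have hc : ∀ (c : Sq.{w}) (hc : c ≠ sq 1 1),
      IsColimCone (Comma.snd inclUL (pt c)) (colimCone inclUL c X) := fun c hc =>
    isColimCone_colimCone_obj inclUL (⟨c, hc⟩ : UL.{w}) X
  refine sq_cases (hc _ (by simp [sq])) (hc _ (by simp [sq])) (hc _ (by simp [sq])) ?_
  refine isColimCone_of_square inclUL (𝟭 _) (𝟭 _) (fun _ => rfl) (fun a _ => ⟨a, rfl⟩) X ?_
  rwa [restr_id_obj]

/-- The slices of the corner under `(0,1)` and `(1,0)` are empty, so right Kan extension from
`(0,0)` is extension by zero. -/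
lemma bij_cornerUL (W : D.Diag UL.{w})
    (h01 : IsZero ((D.ev ⟨sq 0 1, by simp [sq]⟩).obj W))
    (h10 : IsZero ((D.ev ⟨sq 1 0, by simp [sq]⟩).obj W)) (V : D.Diag UL.{w}) :
    D.Bij cornerUL V W := by
  refine bij_of_isLimCone _ _ ?_ V
  rintro ⟨c, hc⟩
  revert hc
  induction c using sq_cases
  · intro hc
    exact isLimCone_limCone_obj cornerUL (⟨⟨⟩⟩ : OneCat.{w}) W
  · intro hc
    have : IsEmpty (Comma (pt (⟨sq 0 1, hc⟩ : UL.{w})) cornerUL) :=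
      ⟨fun x => absurd (show (1 : Fin 2) ≤ 0 from (leOfHom x.hom).2) (by decide)⟩
    exact isLimCone_of_isEmpty _ h01 _
  · intro hc
    have : IsEmpty (Comma (pt (⟨sq 1 0, hc⟩ : UL.{w})) cornerUL) :=
      ⟨fun x => absurd (show (1 : Fin 2) ≤ 0 from (leOfHom x.hom).1) (by decide)⟩
    exact isLimCone_of_isEmpty _ h10 _
  · intro hc
    exact absurd rfl hc

/-- Dually, left Kan extension from `(1,1)` to `⌟` is extension by zero, since the relevant slices
over `(0,1)` and `(1,0)` are empty. -/
lemma bij_cornerLR (W : D.Diag LR.{w})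
    (h01 : IsZero ((D.ev ⟨sq 0 1, by simp [sq]⟩).obj W))
    (h10 : IsZero ((D.ev ⟨sq 1 0, by simp [sq]⟩).obj W)) (V : D.Diag LR.{w}) :
    D.Bij cornerLR W V := by
  refine bij_of_isColimCone _ _ ?_ V
  rintro ⟨c, hc⟩
  revert hc
  induction c using sq_cases
  · intro hc
    exact absurd rfl hc
  · intro hc
    have : IsEmpty (Comma cornerLR (pt (⟨sq 0 1, hc⟩ : LR.{w}))) :=
      ⟨fun x => absurd (show (1 : Fin 2) ≤ 0 from (leOfHom x.hom).1) (by decide)⟩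
    exact isColimCone_of_isEmpty _ h01 _
  · intro hc
    have : IsEmpty (Comma cornerLR (pt (⟨sq 1 0, hc⟩ : LR.{w}))) :=
      ⟨fun x => absurd (show (1 : Fin 2) ≤ 0 from (leOfHom x.hom).2) (by decide)⟩
    exact isColimCone_of_isEmpty _ h10 _
  · intro hc
    exact isColimCone_colimCone_obj cornerLR (⟨⟨⟩⟩ : OneCat.{w}) W

end Derivator

/-! ### Squares with two zero corners -/

section SuspSquare

variable (D : Prederivator.{w, v, u})

/-- Bicartesian squares with two zero corners. -/
structure IsLoopSquare [D.HasKan] (Q : D.Diag Sq.{w}) : Prop where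
  isZero₀₁ : IsZero ((D.ev (sq 0 1)).obj Q)
  isZero₁₀ : IsZero ((D.ev (sq 1 0)).obj Q)
  isCocartesian : D.IsCocartesian Q
  isCartesian : D.IsCartesian Q

/-- The mapping properties of a cocartesian square with two zero corners. -/
structure IsSuspSquare (Q : D.Diag Sq.{w}) : Prop where
  bij_incl : ∀ Z, D.Bij inclUL Q Z
  bij_corner : ∀ V, D.Bij cornerUL V ((D.restr inclUL).obj Q)

variable {D}

lemma IsLoopSquare.isSuspSquare [D.IsDerivator] {Q : D.Diag Sq.{w}} (h : D.IsLoopSquare Q) :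
    D.IsSuspSquare Q where
  bij_incl := (isCocartesian_iff Q).1 h.isCocartesian
  bij_corner := bij_cornerUL _ ((isZero_ev_restr_iff inclUL _ Q).2 h.isZero₀₁)
    ((isZero_ev_restr_iff inclUL _ Q).2 h.isZero₁₀)

lemma IsLoopSquare.bij_inclLR [D.IsDerivator] {Q : D.Diag Sq.{w}} (h : D.IsLoopSquare Q)
    (Z : D.Diag Sq.{w}) : D.Bij inclLR Z Q :=
  (isCartesian_iff Q).1 h.isCartesian Z

lemma IsLoopSquare.bij_cornerLR [D.IsDerivator] {Q : D.Diag Sq.{w}} (h : D.IsLoopSquare Q)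
    (V : D.Diag LR.{w}) : D.Bij cornerLR ((D.restr inclLR).obj Q) V :=
  Prederivator.bij_cornerLR _ ((isZero_ev_restr_iff inclLR _ Q).2 h.isZero₀₁)
    ((isZero_ev_restr_iff inclLR _ Q).2 h.isZero₁₀) V

/-- `Q` is left Kan extended from `⌜`, and on `⌜` the square `Q'` is right Kan extended from
`(0,0)`. This is the lifting property that is used in place of strongness; the next lemma is its
dual at `(1,1)`. -/
lemma IsSuspSquare.bij_ev {Q Q' : D.Diag Sq.{w}} (h : D.IsSuspSquare Q) (h' : D.IsSuspSquare Q') :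
    D.Bij (pt (sq 0 0)) Q Q' :=
  (h'.bij_corner _).comp (h.bij_incl Q')

lemma IsLoopSquare.bij_ev₁₁ [D.IsDerivator] {Q Q' : D.Diag Sq.{w}} (h : D.IsLoopSquare Q)
    (h' : D.IsLoopSquare Q') : D.Bij (pt (sq 1 1)) Q Q' :=
  (h.bij_cornerLR _).comp (h'.bij_inclLR Q)

lemma corner_ev (Q : D.Diag Sq.{w}) :
    (D.restr cornerUL).obj ((D.restr inclUL).obj Q) = (D.ev (sq 0 0)).obj Q :=
  D.restr_obj_eq' rfl Q

variable [D.HasKan]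

lemma IsSuspSquare.isIso_counit {Q : D.Diag Sq.{w}} (h : D.IsSuspSquare Q) :
    IsIso ((D.lanAdj inclUL).counit.app Q) := isIso_counit_of_bij h.bij_incl

/-- The morphism `i_⌜^* Q ⟶ (0,0)_* Q_{00}`. -/
noncomputable def toRanCorner (Q : D.Diag Sq.{w}) :
    (D.restr inclUL).obj Q ⟶ (D.ran cornerUL).obj ((D.ev (sq 0 0)).obj Q) :=
  (D.ranAdj cornerUL).unit.app ((D.restr inclUL).obj Q) ≫ (D.ran cornerUL).map (eqToHom (corner_ev Q))

lemma toSusp_eq (Q : D.Diag Sq.{w}) :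
    D.toSusp Q = (D.ev (sq 1 1)).map ((D.lan inclUL).map (toRanCorner Q)) := rfl

lemma IsSuspSquare.isIso_toSusp {Q : D.Diag Sq.{w}} (h : D.IsSuspSquare Q) :
    IsIso (D.toSusp Q) := by
  have := isIso_unit_of_bij h.bij_corner
  have : IsIso (toRanCorner Q) := by
    rw [toRanCorner]; infer_instance
  rw [toSusp_eq]
  exact inferInstanceAs (IsIso ((D.ev (sq 1 1)).map ((D.lan inclUL).map (toRanCorner Q))))

/-- This and the related facts rest on the mapping properties in `IsSuspSquare` and on the existence
of Kan extensions only. They are therefore available in `D.opposite` without verifying (Der1),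
(Der2) and (Der4) there. -/
lemma IsSuspSquare.exists_comparison {Q : D.Diag Sq.{w}} (h : D.IsSuspSquare Q) :
    ∃ φ : (D.ev (sq 1 1)).obj Q ⟶ D.susp.obj ((D.ev (sq 0 0)).obj Q), D.IsSuspComparison Q φ := by
  have := h.isIso_counit
  exact ⟨inv ((D.ev (sq 1 1)).map ((D.lanAdj inclUL).counit.app Q)) ≫ D.toSusp Q,
    by simp [IsSuspComparison]⟩

lemma IsSuspSquare.isIso_comparison {Q : D.Diag Sq.{w}} (h : D.IsSuspSquare Q)
    {φ : (D.ev (sq 1 1)).obj Q ⟶ D.susp.obj ((D.ev (sq 0 0)).obj Q)}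
    (hφ : D.IsSuspComparison Q φ) : IsIso φ := by
  have := h.isIso_counit
  have := h.isIso_toSusp
  rw [← hφ] at this
  exact (isIso_comp_left_iff _ _).1 this

lemma toSusp_naturality {Q Q' : D.Diag Sq.{w}} (a : Q ⟶ Q') :
    (D.ev (sq 1 1)).map ((D.lan inclUL).map ((D.restr inclUL).map a)) ≫ D.toSusp Q' =
      D.toSusp Q ≫ D.susp.map ((D.ev (sq 0 0)).map a) := by
  have key : (D.restr inclUL).map a ≫ toRanCorner Q' =
      toRanCorner Q ≫ (D.ran cornerUL).map ((D.ev (sq 0 0)).map a) := by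
    have h1 := (D.ranAdj cornerUL).unit.naturality ((D.restr inclUL).map a)
    dsimp only [Functor.id_map, Functor.comp_map, Functor.id_obj, Functor.comp_obj] at h1
    have h2 : (D.restr cornerUL).map ((D.restr inclUL).map a) ≫ eqToHom (corner_ev Q') =
        eqToHom (corner_ev Q) ≫ (D.ev (sq 0 0)).map a := by
      rw [restr_map_map]
      simp only [Category.assoc, eqToHom_trans]
      exact congrArg (fun t => eqToHom (corner_ev Q) ≫ t) (Category.comp_id _)
    rw [toRanCorner, toRanCorner, reassoc_of% h1, Category.assoc, ← Functor.map_comp,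
      ← Functor.map_comp, h2]
  have := congrArg (fun t => (D.ev (sq 1 1)).map ((D.lan inclUL).map t)) key
  simp only [Functor.map_comp] at this
  exact this

lemma IsSuspSquare.comparison_naturality {Q Q' : D.Diag Sq.{w}} (h : D.IsSuspSquare Q) (a : Q ⟶ Q')
    {φ : (D.ev (sq 1 1)).obj Q ⟶ D.susp.obj ((D.ev (sq 0 0)).obj Q)}
    (hφ : D.IsSuspComparison Q φ)
    {φ' : (D.ev (sq 1 1)).obj Q' ⟶ D.susp.obj ((D.ev (sq 0 0)).obj Q')}
    (hφ' : D.IsSuspComparison Q' φ') :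
    (D.ev (sq 1 1)).map a ≫ φ' = φ ≫ D.susp.map ((D.ev (sq 0 0)).map a) := by
  have := h.isIso_counit
  rw [← cancel_epi ((D.ev (sq 1 1)).map ((D.lanAdj inclUL).counit.app Q)), reassoc_of% hφ,
    ← toSusp_naturality, ← hφ']
  rw [← Functor.map_comp_assoc, ← Functor.map_comp_assoc]
  congr 2
  exact ((D.lanAdj inclUL).counit.naturality a).symm

lemma IsSuspSquare.comparison_unique {Q : D.Diag Sq.{w}} (h : D.IsSuspSquare Q)
    {φ φ' : (D.ev (sq 1 1)).obj Q ⟶ D.susp.obj ((D.ev (sq 0 0)).obj Q)}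
    (hφ : D.IsSuspComparison Q φ) (hφ' : D.IsSuspComparison Q φ') : φ = φ' := by
  have := h.isIso_counit
  rw [← cancel_epi ((D.ev (sq 1 1)).map ((D.lanAdj inclUL).counit.app Q))]
  exact hφ.trans hφ'.symm

end SuspSquare

/-! ### Pasting -/

section Shapes

variable {D : Prederivator.{w, v, u}}

lemma ul_cases {P : UL.{w} → Prop} (h00 : P ⟨sq 0 0, by simp [sq]⟩) (h01 : P ⟨sq 0 1, by simp [sq]⟩)
    (h10 : P ⟨sq 1 0, by simp [sq]⟩) (x : UL.{w}) : P x := by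
  obtain ⟨x, hx⟩ := x
  induction x using sq_cases
  · exact h00
  · exact h01
  · exact h10
  · exact absurd rfl hx

/-- The functor `⌜ ⥤ P` given by a span in a preorder. -/
def spanUL {P : Type w} [Preorder P] (a b c : P) (hb : a ≤ b) (hc : a ≤ c) : UL.{w} ⥤ P :=
  Monotone.functor
    (f := fun x => if x.1.down.1 = 1 then c else if x.1.down.2 = 1 then b else a) (by
      intro x y
      induction x using ul_cases <;> induction y using ul_cases <;> intro h
      · exact le_rfl
      · exact hb
      · exact hc
      · exact absurd (show (1 : Fin 2) ≤ 0 from h.2) (by decide)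
      · exact le_rfl
      · exact absurd (show (1 : Fin 2) ≤ 0 from h.2) (by decide)
      · exact absurd (show (1 : Fin 2) ≤ 0 from h.1) (by decide)
      · exact absurd (show (1 : Fin 2) ≤ 0 from h.1) (by decide)
      · exact le_rfl)

/-- The functor `□ ⥤ P` given by a commutative square in a preorder. -/
def squareSq {P : Type w} [Preorder P] (a b c d : P) (hb : a ≤ b) (hc : a ≤ c) (hbd : b ≤ d)
    (hcd : c ≤ d) : Sq.{w} ⥤ P :=
  Monotone.functor
    (f := fun x => if x.down.1 = 1 then (if x.down.2 = 1 then d else c)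
      else if x.down.2 = 1 then b else a) (by
      intro x y
      induction x using sq_cases <;> induction y using sq_cases <;> intro h
      · exact le_rfl
      · exact hb
      · exact hc
      · exact hb.trans hbd
      · exact absurd (show (1 : Fin 2) ≤ 0 from h.2) (by decide)
      · exact le_rfl
      · exact absurd (show (1 : Fin 2) ≤ 0 from h.2) (by decide)
      · exact hbd
      · exact absurd (show (1 : Fin 2) ≤ 0 from h.1) (by decide)
      · exact absurd (show (1 : Fin 2) ≤ 0 from h.1) (by decide)
      · exact le_rfl
      · exact hcd
      · exact absurd (show (1 : Fin 2) ≤ 0 from h.1) (by decide)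
      · exact absurd (show (1 : Fin 2) ≤ 0 from h.1) (by decide)
      · exact absurd (show (1 : Fin 2) ≤ 0 from h.2) (by decide)
      · exact le_rfl)

lemma restr_toPt {A C : Type w} [SmallCategory A] [SmallCategory C] (f : A ⥤ C)
    (Y : D.Diag OneCat.{w}) :
    (D.restr f).obj ((D.restr (toPt _)).obj Y) = (D.restr (toPt _)).obj Y :=
  (D.restr_comp_obj f (toPt _) Y).symm

/-- A fully faithful right adjoint between preorders is final. -/
lemma bij_of_galoisConnection {P Q : Type w} [Preorder P] [Preorder Q] (l : P → Q) (k : Q ⥤ P)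
    (gc : GaloisConnection l k.obj) (hk : ∀ b, l (k.obj b) = b) (X : D.Diag P)
    (Y : D.Diag OneCat.{w}) : D.Bij k X ((D.restr (toPt _)).obj Y) := by
  let adj : gc.monotone_l.functor ⊣ k := Adjunction.mkOfUnitCounit
    { unit := { app := fun a => homOfLE (gc.le_u_l a) }
      counit := { app := fun b => homOfLE (gc.l_u_le b) } }
  have : IsIso adj.counit := by
    have : ∀ b, IsIso (adj.counit.app b) := fun b =>
      ⟨eqToHom (hk b).symm, Subsingleton.elim _ _, Subsingleton.elim _ _⟩
    exact NatIso.isIso_of_isIso_app _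
  have := bij_of_adjunction adj X ((D.restr (toPt _)).obj Y)
  rwa [restr_toPt] at this

end Shapes

section Pasting

variable {D : Prederivator.{w, v, u}}

/-- `𝟚 × 𝟛` without its last object. -/
abbrev RectPre : Type w := {p : Rect.{w} // p ≠ rect 1 2}

/-- `𝟚 × 𝟛` without `(1,1)` and `(1,2)`. -/
abbrev RectTop : Type w := {p : RectPre.{w} // p.1 ≠ rect 1 1}

abbrev inclRectPre : RectPre.{w} ⥤ Rect.{w} := (Subtype.mono_coe _).functor
abbrev inclRectTop : RectTop.{w} ⥤ RectPre.{w} := (Subtype.mono_coe _).functor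

instance : inclRectTop.{w}.Faithful := ⟨fun _ => Subsingleton.elim _ _⟩
instance : inclRectTop.{w}.Full := ⟨fun m => ⟨homOfLE (leOfHom m), Subsingleton.elim _ _⟩⟩

abbrev rectPre (i : Fin 2) (j : Fin 3) (h : rect.{w} i j ≠ rect 1 2 := by simp [rect]) : RectPre.{w} :=
  ⟨rect i j, h⟩

abbrev rectTop (i : Fin 2) (j : Fin 3) (h : rect.{w} i j ≠ rect 1 2 := by simp [rect])
    (h' : rect.{w} i j ≠ rect 1 1 := by simp [rect]) : RectTop.{w} :=
  ⟨⟨rect i j, h⟩, h'⟩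

abbrev spanRight : UL.{w} ⥤ RectPre.{w} :=
  spanUL (rectPre 0 1) (rectPre 0 2) (rectPre 1 1) (by simp [rect]) (by simp [rect])

abbrev spanLeft : UL.{w} ⥤ RectTop.{w} :=
  spanUL (rectTop 0 0) (rectTop 0 1) (rectTop 1 0) (by simp [rect]) (by simp [rect])

abbrev spanOuter : UL.{w} ⥤ RectTop.{w} :=
  spanUL (rectTop 0 0) (rectTop 0 2) (rectTop 1 0) (by simp [rect]) (by simp [rect])

abbrev squareLeft : Sq.{w} ⥤ RectPre.{w} :=
  squareSq (rectPre 0 0) (rectPre 0 1) (rectPre 1 0) (rectPre 1 1) (by simp [rect])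
    (by simp [rect]) (by simp [rect]) (by simp [rect])

lemma rect_cases {P : Rect.{w} → Prop} (h00 : P (rect 0 0)) (h01 : P (rect 0 1)) (h02 : P (rect 0 2))
    (h10 : P (rect 1 0)) (h11 : P (rect 1 1)) (h12 : P (rect 1 2)) (x : Rect.{w}) : P x := by
  obtain ⟨i, j⟩ := x
  fin_cases i <;> fin_cases j <;> assumption

lemma rectPre_cases {P : RectPre.{w} → Prop} (h00 : P (rectPre 0 0)) (h01 : P (rectPre 0 1))
    (h02 : P (rectPre 0 2)) (h10 : P (rectPre 1 0)) (h11 : P (rectPre 1 1)) (x : RectPre.{w}) :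
    P x := by
  obtain ⟨x, hx⟩ := x
  induction x using rect_cases
  · exact h00
  · exact h01
  · exact h02
  · exact h10
  · exact h11
  · exact absurd rfl hx

lemma rectTop_cases {P : RectTop.{w} → Prop} (h00 : P (rectTop 0 0)) (h01 : P (rectTop 0 1))
    (h02 : P (rectTop 0 2)) (h10 : P (rectTop 1 0)) (x : RectTop.{w}) : P x := by
  obtain ⟨x, hx⟩ := x
  induction x using rectPre_cases
  · exact h00
  · exact h01
  · exact h02
  · exact h10
  · exact absurd rfl hx

/-- The left adjoint rounds a column up to the nearer of `j` and `2`. -/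
lemma gc_iota {j : Fin 3} (h : j ≤ 2) (hj : j ≠ 2) : GaloisConnection
    (fun p : Rect.{w} => sq p.down.1 (if p.down.2 ≤ j then 0 else 1)) (iota.{w} j 2 h).obj := by
  have key : ∀ j : Fin 3, j ≠ 2 → ∀ (a : Fin 2 × Fin 3) (b : Fin 2 × Fin 2),
    (a.1, if a.2 ≤ j then (0 : Fin 2) else 1) ≤ b ↔ a ≤ (b.1, if b.2 = 0 then j else 2) := by decide
  exact fun a b => key j hj a.down b.down

lemma bij_iota {j : Fin 3} (h : j ≤ 2) (hj : j ≠ 2) (X : D.Diag Rect.{w}) (Y : D.Diag OneCat.{w}) :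
    D.Bij (iota j 2 h) X ((D.restr (toPt _)).obj Y) := by
  refine bij_of_galoisConnection _ _ (gc_iota h hj) (fun b => ?_) X Y
  revert h hj
  induction b using sq_cases <;> fin_cases j <;> intro h hj <;> first | rfl | exact absurd rfl hj

/-- The reflection onto the span `(0,2) ← (0,1) → (1,1)` moves column `0` to column `1`. -/
lemma bij_spanRight (X : D.Diag RectPre.{w}) (Y : D.Diag OneCat.{w}) :
    D.Bij spanRight X ((D.restr (toPt _)).obj Y) := by
  refine bij_of_galoisConnection (fun p => if p.1.down = (0, 2) then ⟨sq 0 1, by simp [sq]⟩ else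
    if p.1.down.1 = 1 then ⟨sq 1 0, by simp [sq]⟩ else ⟨sq 0 0, by simp [sq]⟩) _ ?_ ?_ X Y
  · intro a b
    induction a using rectPre_cases <;> induction b using ul_cases <;>
      (change (_ : Fin 2 × Fin 2) ≤ _ ↔ (_ : Fin 2 × Fin 3) ≤ _; decide)
  · intro b
    induction b using ul_cases <;> rfl

/-- The reflection onto `(0,2) ← (0,0) → (1,0)` moves only `(0,1)`, to `(0,2)`. -/
lemma bij_spanOuter (X : D.Diag RectTop.{w}) (Y : D.Diag OneCat.{w}) :
    D.Bij spanOuter X ((D.restr (toPt _)).obj Y) := by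
  refine bij_of_galoisConnection (fun p => if p.1.1.down.1 = 1 then ⟨sq 1 0, by simp [sq]⟩ else
    if p.1.1.down.2 = 0 then ⟨sq 0 0, by simp [sq]⟩ else ⟨sq 0 1, by simp [sq]⟩) _ ?_ ?_ X Y
  · intro a b
    induction a using rectTop_cases <;> induction b using ul_cases <;>
      (change (_ : Fin 2 × Fin 2) ≤ _ ↔ (_ : Fin 2 × Fin 3) ≤ _; decide)
  · intro b
    induction b using ul_cases <;> rfl

instance : spanLeft.{w}.Faithful := ⟨fun _ => Subsingleton.elim _ _⟩
instance : spanLeft.{w}.Full := ⟨fun {x y} m => ⟨homOfLE (by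
  have h0 : spanLeft.obj x ≤ spanLeft.obj y := leOfHom m
  have h : (spanLeft.obj x).1.1.down ≤ (spanLeft.obj y).1.1.down := h0
  clear h0
  change x.1.down ≤ y.1.down
  clear m
  induction x using ul_cases <;> induction y using ul_cases <;> revert h <;> decide),
  Subsingleton.elim _ _⟩⟩

variable [D.IsDerivator]

/-- The outer rectangle of two cocartesian squares is cocartesian. -/
lemma isCocartesian_outer {X : D.Diag Rect.{w}}
    (hl : D.IsCocartesian ((D.restr (iota 0 1 (by decide))).obj X))
    (hr : D.IsCocartesian ((D.restr (iota 1 2 (by decide))).obj X)) :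
    D.IsCocartesian (D.outer X) := by
  rw [isCocartesian_iff_const] at hl hr ⊢
  intro Y
  -- The right square presents `X₁₂` as a colimit over its own span; by finality of that span, `h2`
  -- makes it the colimit over everything before `(1,2)`.
  have h1 : D.Bij (spanRight ⋙ inclRectPre) X ((D.restr (toPt _)).obj Y) := by
    refine Bij.congr (f := inclUL ⋙ iota 1 2 (by decide)) (Bij.comp ?_
      (bij_iota _ (by decide) X Y)) (functor_ext_of_isThin fun x => by
        induction x using ul_cases <;> rfl)
    rw [restr_toPt]
    exact hr Y
  have h2 : D.Bij inclRectPre X ((D.restr (toPt _)).obj Y) := by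
    refine h1.of_comp_left ?_
    rw [restr_toPt]
    exact bij_spanRight _ _
  -- The left square makes `(1,1)` redundant: below `(1,2)` the diagram is left Kan extended from
  -- its part without `(1,1)`.
  have h3 : ∀ Z, D.Bij inclRectTop ((D.restr inclRectPre).obj X) Z := by
    refine bij_of_isColimCone _ _ ?_
    rintro ⟨c, hc⟩
    by_cases hc' : c = rect 1 1
    · subst hc'
      refine isColimCone_of_square inclRectTop squareLeft spanLeft (fun x => by
        induction x using ul_cases <;> rfl) (fun a m => ?_) _ ?_
      · have h0 : inclRectTop.obj a ≤ squareLeft.obj (sq 1 1) := leOfHom m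
        have hm : a.1.1.down ≤ (1, 1) := h0
        clear m h0
        induction a using rectTop_cases
        · exact ⟨⟨sq 0 0, by simp [sq]⟩, rfl⟩
        · exact ⟨⟨sq 0 1, by simp [sq]⟩, rfl⟩
        · exact absurd hm (by decide)
        · exact ⟨⟨sq 1 0, by simp [sq]⟩, rfl⟩
      · intro Y
        rw [← restr_comp_obj, D.restr_congr_obj (functor_ext_of_isThin fun x => by
          induction x using sq_cases <;> rfl : squareLeft ⋙ inclRectPre = iota 0 1 (by decide))]
        exact hl Y
    · exact isColimCone_colimCone_obj inclRectTop ⟨⟨c, hc⟩, hc'⟩ _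
  -- In that remaining part the outer span is final, so `X₁₂` is the colimit of the outer span.
  have h4 : D.Bij (spanOuter ⋙ inclRectTop ⋙ inclRectPre) X ((D.restr (toPt _)).obj Y) := by
    refine Bij.comp ?_ ((h3 _).comp h2)
    rw [restr_toPt]
    exact bij_spanOuter _ _
  have h5 := (h4.congr (g := inclUL ⋙ iota 0 2 (by decide)) (functor_ext_of_isThin fun x => by
    induction x using ul_cases <;> rfl)).of_comp_right (bij_iota _ (by decide) X Y)
  rwa [restr_toPt] at h5

end Pasting

/-! ### Transposed squares -/

section Transpose

/-- The transposition of the square. -/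
abbrev swapSq : Sq.{w} ⥤ Sq.{w} :=
  squareSq (sq 0 0) (sq 1 0) (sq 0 1) (sq 1 1) (by simp [sq]) (by simp [sq]) (by simp [sq])
    (by simp [sq])

/-- The transposition of the span. -/
abbrev swapUL : UL.{w} ⥤ UL.{w} :=
  spanUL ⟨sq 0 0, by simp [sq]⟩ ⟨sq 1 0, by simp [sq]⟩ ⟨sq 0 1, by simp [sq]⟩ (by simp [sq])
    (by simp [sq])

lemma swapSq_comp_swapSq : swapSq.{w} ⋙ swapSq = 𝟭 _ :=
  functor_ext_of_isThin fun x => by induction x using sq_cases <;> rfl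

lemma swapUL_comp_swapUL : swapUL.{w} ⋙ swapUL = 𝟭 _ :=
  functor_ext_of_isThin fun x => by induction x using ul_cases <;> rfl

lemma inclUL_comp_swapSq : inclUL.{w} ⋙ swapSq = swapUL ⋙ inclUL :=
  functor_ext_of_isThin fun x => by induction x using ul_cases <;> rfl

variable {D : Prederivator.{w, v, u}}

variable (D) in
/-- The transpose of a coherent square. -/
abbrev transpose (Q : D.Diag Sq.{w}) : D.Diag Sq.{w} := (D.restr swapSq).obj Q

instance : (D.restr swapSq).IsEquivalence :=
  D.isEquivalence_restr_of_inverse swapSq_comp_swapSq swapSq_comp_swapSq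

instance : (D.restr swapUL).IsEquivalence :=
  D.isEquivalence_restr_of_inverse swapUL_comp_swapUL swapUL_comp_swapUL

lemma transpose_transpose (Q : D.Diag Sq.{w}) : D.transpose (D.transpose Q) = Q := by
  rw [transpose, transpose, ← restr_comp_obj, swapSq_comp_swapSq, restr_id_obj]

lemma isCocartesian_transpose [D.IsDerivator] {Q : D.Diag Sq.{w}} (h : D.IsCocartesian Q) :
    D.IsCocartesian (D.transpose Q) := by
  rw [isCocartesian_iff] at h ⊢
  intro Z
  rw [← transpose_transpose Z]
  exact (Bij.transport inclUL_comp_swapSq).1 (h _)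

lemma IsLoopSquare.transpose [D.IsStable] {Q : D.Diag Sq.{w}} (h : D.IsLoopSquare Q) :
    D.IsLoopSquare (D.transpose Q) where
  isZero₀₁ := (isZero_ev_restr_iff swapSq _ Q).2 h.isZero₁₀
  isZero₁₀ := (isZero_ev_restr_iff swapSq _ Q).2 h.isZero₀₁
  isCocartesian := isCocartesian_transpose h.isCocartesian
  isCartesian := (IsStable.isCartesian_iff _).2 (isCocartesian_transpose h.isCocartesian)

lemma isLoopSquare_of_isCocartesian [D.IsStable] {Q : D.Diag Sq.{w}}
    (h01 : IsZero ((D.ev (sq 0 1)).obj Q)) (h10 : IsZero ((D.ev (sq 1 0)).obj Q))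
    (h : D.IsCocartesian Q) : D.IsLoopSquare Q :=
  ⟨h01, h10, h, (IsStable.isCartesian_iff _).2 h⟩

/-- Every object is the last vertex of a bicartesian square with two zero corners. -/
lemma exists_isLoopSquare [D.IsStable] (W : D.Diag OneCat.{w}) :
    ∃ Q : D.Diag Sq.{w}, D.IsLoopSquare Q ∧ Nonempty ((D.ev (sq 1 1)).obj Q ≅ W) := by
  have := IsStable.hasZeroObject (D := D)
  -- `B` is the extension of `W` by zero to `⌟`. Its right Kan extension `Q` is cartesian by
  -- construction and cocartesian by stability.
  let B := (D.lan cornerLR).obj W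
  let Q := (D.ran inclLR).obj B
  let e : (D.restr inclLR).obj Q ≅ B := asIso ((D.ranAdj inclLR).counit.app B)
  let e' : W ≅ (D.restr cornerLR).obj B := asIso ((D.lanAdj cornerLR).unit.app W)
  have h01 : IsZero ((D.ev (⟨sq 0 1, by simp [sq]⟩ : LR.{w})).obj B) := by
    have : IsEmpty (Comma cornerLR (pt (⟨sq 0 1, by simp [sq]⟩ : LR.{w}))) :=
      ⟨fun x => absurd (show (1 : Fin 2) ≤ 0 from (leOfHom x.hom).1) (by decide)⟩
    exact isZero_of_isColimCone_of_isEmpty _ (isColimCone_lan cornerLR _ W)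
  have h10 : IsZero ((D.ev (⟨sq 1 0, by simp [sq]⟩ : LR.{w})).obj B) := by
    have : IsEmpty (Comma cornerLR (pt (⟨sq 1 0, by simp [sq]⟩ : LR.{w}))) :=
      ⟨fun x => absurd (show (1 : Fin 2) ≤ 0 from (leOfHom x.hom).2) (by decide)⟩
    exact isZero_of_isColimCone_of_isEmpty _ (isColimCone_lan cornerLR _ W)
  refine ⟨Q, ⟨?_, ?_, ?_, ?_⟩, ⟨?_⟩⟩
  · exact (isZero_ev_restr_iff inclLR _ Q).1 (h01.of_iso ((D.ev _).mapIso e))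
  · exact (isZero_ev_restr_iff inclLR _ Q).1 (h10.of_iso ((D.ev _).mapIso e))
  · exact (IsStable.isCartesian_iff _).1 ⟨B, ⟨Iso.refl _⟩⟩
  · exact ⟨B, ⟨Iso.refl _⟩⟩
  · exact eqToIso (D.restr_obj_eq' (p := cornerLR) (f := inclLR)
      (q := pt (sq 1 1)) rfl Q).symm ≪≫ (D.restr cornerLR).mapIso e ≪≫ e'.symm

end Transpose

/-! ### Pulling back morphisms of coherent diagrams -/

section Pull

variable {D : Prederivator.{w, v, u}}
variable {A B J J' J'' : Type w} [SmallCategory A] [SmallCategory B] [SmallCategory J]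
  [SmallCategory J'] [SmallCategory J'']

/-- The restriction along `u : J' ⥤ J` of a morphism `ε^* X ⟶ π^* Y` in `D(J)`. -/
def pull (u : J' ⥤ J) {ε : J ⥤ A} {π : J ⥤ B} {ε' : J' ⥤ A} {π' : J' ⥤ B} (hε : u ⋙ ε = ε')
    (hπ : u ⋙ π = π') {X : D.Diag A} {Y : D.Diag B} (φ : (D.restr ε).obj X ⟶ (D.restr π).obj Y) :
    (D.restr ε').obj X ⟶ (D.restr π').obj Y :=
  eqToHom (D.restr_obj_eq' hε X).symm ≫ (D.restr u).map φ ≫ eqToHom (D.restr_obj_eq' hπ Y)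

lemma pull_comp {C : Type w} [SmallCategory C] (u : J' ⥤ J) {ε : J ⥤ A} {π : J ⥤ B} {ρ : J ⥤ C}
    {ε' : J' ⥤ A} {π' : J' ⥤ B} {ρ' : J' ⥤ C} (hε : u ⋙ ε = ε') (hπ : u ⋙ π = π')
    (hρ : u ⋙ ρ = ρ') {X : D.Diag A} {Y : D.Diag B} {Z : D.Diag C}
    (φ : (D.restr ε).obj X ⟶ (D.restr π).obj Y) (ψ : (D.restr π).obj Y ⟶ (D.restr ρ).obj Z) :
    pull u hε hρ (φ ≫ ψ) = pull u hε hπ φ ≫ pull u hπ hρ ψ := by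
  simp [pull]

lemma pull_restr_map (u : J' ⥤ J) {ε : J ⥤ A} {ε' : J' ⥤ A} (hε : u ⋙ ε = ε') {X Y : D.Diag A}
    (φ : X ⟶ Y) : pull u hε hε ((D.restr ε).map φ) = (D.restr ε').map φ := by
  subst hε
  simp [pull, restr_comp_map]

lemma pull_pull (u : J' ⥤ J) (u' : J'' ⥤ J') {ε : J ⥤ A} {π : J ⥤ B} {ε' : J' ⥤ A} {π' : J' ⥤ B}
    {ε'' : J'' ⥤ A} {π'' : J'' ⥤ B} (hε : u ⋙ ε = ε') (hπ : u ⋙ π = π') (hε' : u' ⋙ ε' = ε'')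
    (hπ' : u' ⋙ π' = π'') {v : J'' ⥤ J} (hv : u' ⋙ u = v) {X : D.Diag A} {Y : D.Diag B}
    (φ : (D.restr ε).obj X ⟶ (D.restr π).obj Y) :
    pull u' hε' hπ' (pull u hε hπ φ) =
      pull v (by rw [← hv, Functor.assoc, hε, hε']) (by rw [← hv, Functor.assoc, hπ, hπ']) φ := by
  subst hv hε hπ hε' hπ'
  simp [pull, restr_comp_map, eqToHom_map]

lemma pull_id {ε : J ⥤ A} {π : J ⥤ B} {u : J ⥤ J} (hu : u = 𝟭 J) (hε : u ⋙ ε = ε)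
    (hπ : u ⋙ π = π) {X : D.Diag A} {Y : D.Diag B}
    (φ : (D.restr ε).obj X ⟶ (D.restr π).obj Y) : pull u hε hπ φ = φ := by
  subst hu
  simp [pull, restr_id_map]

lemma pull_bijective {u : J' ⥤ J} {ε : J ⥤ A} {π : J ⥤ B} {ε' : J' ⥤ A} {π' : J' ⥤ B}
    {X : D.Diag A} {Y : D.Diag B} (h : D.Bij u ((D.restr ε).obj X) ((D.restr π).obj Y))
    (hε : u ⋙ ε = ε') (hπ : u ⋙ π = π') :
    Function.Bijective (pull (D := D) u hε hπ (X := X) (Y := Y)) :=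
  (bijective_eqToHom_conj _ _).comp h

end Pull

/-! ### Coproducts of two objects -/

section Coproduct

variable {D : Prederivator.{w, v, u}}

/-- The inclusion of the two maximal elements of `⌜`. -/
def cornersUL : (Σ _ : ULift.{w} Bool, OneCat.{w}) ⥤ UL.{w} :=
  Sigma.desc fun i => pt (if i.down then ⟨sq 0 1, by simp [sq]⟩ else ⟨sq 1 0, by simp [sq]⟩)

instance : cornersUL.{w}.Faithful where
  map_injective {x y} a b _ := by
    change Sigma.SigmaHom x y at a b
    cases a with
    | mk a => cases b with
      | mk b => rw [Subsingleton.elim a b]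

instance : cornersUL.{w}.Full where
  map_surjective {x y} m := by
    obtain ⟨⟨i⟩, x⟩ := x
    obtain ⟨⟨j⟩, y⟩ := y
    have h : cornersUL.obj ⟨⟨i⟩, x⟩ ≤ cornersUL.obj ⟨⟨j⟩, y⟩ := leOfHom m
    cases i <;> cases j
    · exact ⟨Sigma.SigmaHom.mk (eqToHom (Subsingleton.elim _ _)), Subsingleton.elim _ _⟩
    · exact absurd (show (1 : Fin 2) ≤ 0 from h.1) (by decide)
    · exact absurd (show (1 : Fin 2) ≤ 0 from h.2) (by decide)
    · exact ⟨Sigma.SigmaHom.mk (eqToHom (Subsingleton.elim _ _)), Subsingleton.elim _ _⟩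

variable [D.IsDerivator]

/-- A span with vanishing apex is left Kan extended from its two feet: the slice over the apex is
empty. With (Der1), the colimit of such a span becomes a coproduct. -/
lemma bij_cornersUL {V : D.Diag UL.{w}} (hV : IsZero ((D.ev ⟨sq 0 0, by simp [sq]⟩).obj V))
    (Z : D.Diag UL.{w}) : D.Bij cornersUL V Z := by
  refine bij_of_isColimCone _ _ ?_ Z
  intro c
  induction c using ul_cases
  · have : IsEmpty (Comma cornersUL (pt (⟨sq 0 0, by simp [sq]⟩ : UL.{w}))) := ⟨fun x => by
      obtain ⟨⟨⟨i⟩, x⟩, y, m⟩ := x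
      have h : cornersUL.obj ⟨⟨i⟩, x⟩ ≤ ⟨sq 0 0, by simp [sq]⟩ := leOfHom m
      cases i
      · exact absurd (show (1 : Fin 2) ≤ 0 from h.1) (by decide)
      · exact absurd (show (1 : Fin 2) ≤ 0 from h.2) (by decide)⟩
    exact isColimCone_of_isEmpty _ hV _
  · exact isColimCone_colimCone_obj cornersUL ⟨⟨true⟩, ⟨⟨⟩⟩⟩ V
  · exact isColimCone_colimCone_obj cornersUL ⟨⟨false⟩, ⟨⟨⟩⟩⟩ V

lemma bijective_ev_pair {V : D.Diag UL.{w}} (hV : IsZero ((D.ev ⟨sq 0 0, by simp [sq]⟩).obj V))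
    (Z : D.Diag UL.{w}) : Function.Bijective (fun φ : V ⟶ Z =>
      ((D.ev ⟨sq 0 1, by simp [sq]⟩).map φ, (D.ev ⟨sq 1 0, by simp [sq]⟩).map φ)) := by
  have h1 := (bijective_sigma (fun _ : ULift.{w} Bool => OneCat.{w}) _ _).comp
    (bij_cornersUL hV Z)
  have e : ∀ (b : Bool), Sigma.incl ⟨b⟩ ⋙ cornersUL.{w} =
      pt (if b then ⟨sq 0 1, by simp [sq]⟩ else ⟨sq 1 0, by simp [sq]⟩) := fun b =>
    functor_ext_of_isThin fun _ => rfl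
  have e' : ∀ (b : Bool) (φ : V ⟶ Z), (D.restr (Sigma.incl ⟨b⟩)).map ((D.restr cornersUL).map φ) =
      eqToHom (D.restr_obj_eq' (e b) V) ≫ (D.restr _).map φ ≫
        eqToHom (D.restr_obj_eq' (e b) Z).symm := fun b φ => by
    rw [restr_map_map, D.restr_congr_map (e b)]
    simp
  constructor
  · intro φ ψ h
    refine h1.1 (funext ?_)
    rintro ⟨b⟩
    refine (e' b φ).trans (Eq.trans ?_ (e' b ψ).symm)
    cases b
    · exact congrArg (fun t => _ ≫ t ≫ _) (congrArg Prod.snd h)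
    · exact congrArg (fun t => _ ≫ t ≫ _) (congrArg Prod.fst h)
  · rintro ⟨f, g⟩
    obtain ⟨φ, hφ⟩ := h1.2 (fun i => match i with
      | ⟨true⟩ => eqToHom (D.restr_obj_eq' (e true) V) ≫ f ≫ eqToHom (D.restr_obj_eq' (e true) Z).symm
      | ⟨false⟩ => eqToHom (D.restr_obj_eq' (e false) V) ≫ g ≫
          eqToHom (D.restr_obj_eq' (e false) Z).symm)
    refine ⟨φ, Prod.ext ?_ ?_⟩
    · have := (e' true φ).symm.trans (congrFun hφ ⟨true⟩)
      exact (bijective_eqToHom_conj _ _).1 this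
    · have := (e' false φ).symm.trans (congrFun hφ ⟨false⟩)
      exact (bijective_eqToHom_conj _ _).1 this

end Coproduct

/-! ### The Segal condition -/

/-- The poset with a least element `base` and three maximal elements. -/
inductive Fan : Type w
  | base | one | two | three

/-- The elements of `Fan` as subsets of a set with three elements. -/
def Fan.toFinset : Fan.{w} → Finset (Fin 3)
  | base => ∅
  | one => {0}
  | two => {1}
  | three => {2}

instance : Preorder Fan.{w} := Preorder.lift Fan.toFinset

instance : DecidableLE Fan.{w} := fun a b => inferInstanceAs (Decidable (a.toFinset ≤ b.toFinset))

/-- The poset obtained from `Fan` by adjoining upper bounds `left` of `one` and `two`, and `right`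
of `two` and `three`. -/
inductive Join : Type w
  | base | one | two | three | left | right

/-- The elements of `Join` as subsets of a set with three elements. -/
def Join.toFinset : Join.{w} → Finset (Fin 3)
  | base => ∅
  | one => {0}
  | two => {1}
  | three => {2}
  | left => {0, 1}
  | right => {1, 2}

instance : Preorder Join.{w} := Preorder.lift Join.toFinset

instance : DecidableLE Join.{w} := fun a b => inferInstanceAs (Decidable (a.toFinset ≤ b.toFinset))

/-- The functor `Fan ⥤ P` given by three elements above a fourth one. -/
def fanTo {P : Type w} [Preorder P] (a b c d : P) (hb : a ≤ b) (hc : a ≤ c) (hd : a ≤ d) :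
    Fan.{w} ⥤ P :=
  Monotone.functor (f := fun x => match x with
    | .base => a | .one => b | .two => c | .three => d) (by
      intro x y
      cases x <;> cases y <;> intro h <;>
        first | exact le_rfl | assumption | exact absurd h (by decide))

/-- The functor `Join ⥤ □` which identifies both squares of `Join` with `□`. -/
def joinToSq : Join.{w} ⥤ Sq.{w} :=
  Monotone.functor (f := fun x => match x with
    | .base => sq 0 0 | .one => sq 0 1 | .two => sq 1 0 | .three => sq 0 1 | .left => sq 1 1
    | .right => sq 1 1) (by
      intro x y
      cases x <;> cases y <;> intro h <;>
        first
        | exact absurd h (by decide)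
        | (change (_ : Fin 2 × Fin 2) ≤ _; decide))

abbrev fanToJoin : Fan.{w} ⥤ Join.{w} :=
  fanTo .base .one .two .three (by decide) (by decide) (by decide)

abbrev squareJoinLeft : Sq.{w} ⥤ Join.{w} :=
  squareSq .base .one .two .left (by decide) (by decide) (by decide) (by decide)

abbrev squareJoinRight : Sq.{w} ⥤ Join.{w} :=
  squareSq .base .three .two .right (by decide) (by decide) (by decide) (by decide)

abbrev spanJoin : UL.{w} ⥤ Join.{w} := spanUL .two .left .right (by decide) (by decide)

abbrev span₁₂ : UL.{w} ⥤ Fan.{w} := spanUL .base .one .two (by decide) (by decide)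
abbrev span₃₂ : UL.{w} ⥤ Fan.{w} := spanUL .base .three .two (by decide) (by decide)
abbrev span₂₃ : UL.{w} ⥤ Fan.{w} := spanUL .base .two .three (by decide) (by decide)
abbrev span₁₃ : UL.{w} ⥤ Fan.{w} := spanUL .base .one .three (by decide) (by decide)

/-- The functor `Fan ⥤ ⌜` with `one, three ↦ (0,1)` and `two ↦ (1,0)`. -/
abbrev foldFan : Fan.{w} ⥤ UL.{w} :=
  fanTo ⟨sq 0 0, by simp [sq]⟩ ⟨sq 0 1, by simp [sq]⟩ ⟨sq 1 0, by simp [sq]⟩ ⟨sq 0 1, by simp [sq]⟩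
    (by simp [sq]) (by simp [sq]) (by simp [sq])

instance : fanToJoin.{w}.Faithful := ⟨fun _ => Subsingleton.elim _ _⟩
instance : fanToJoin.{w}.Full := ⟨fun {x y} m => ⟨homOfLE (by
  have h : fanToJoin.obj x ≤ fanToJoin.obj y := leOfHom m
  clear m
  cases x <;> cases y <;> revert h <;> decide), Subsingleton.elim _ _⟩⟩

lemma full_of_not_le {s : UL.{w} ⥤ Fan.{w}}
    (h1 : ¬ s.obj ⟨sq 0 1, by simp [sq]⟩ ≤ s.obj ⟨sq 0 0, by simp [sq]⟩)
    (h2 : ¬ s.obj ⟨sq 1 0, by simp [sq]⟩ ≤ s.obj ⟨sq 0 0, by simp [sq]⟩)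
    (h3 : ¬ s.obj ⟨sq 0 1, by simp [sq]⟩ ≤ s.obj ⟨sq 1 0, by simp [sq]⟩)
    (h4 : ¬ s.obj ⟨sq 1 0, by simp [sq]⟩ ≤ s.obj ⟨sq 0 1, by simp [sq]⟩) : s.Full :=
  ⟨fun {x y} m => ⟨homOfLE (by
    have h : s.obj x ≤ s.obj y := leOfHom m
    clear m
    induction x using ul_cases <;> induction y using ul_cases <;>
      first
      | exact le_rfl
      | exact absurd h (by assumption)
      | (simp [sq])), Subsingleton.elim _ _⟩⟩

instance : span₁₂.{w}.Faithful := ⟨fun _ => Subsingleton.elim _ _⟩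
instance : span₃₂.{w}.Faithful := ⟨fun _ => Subsingleton.elim _ _⟩
instance : span₁₂.{w}.Full :=
  full_of_not_le (show ¬ Fan.one ≤ Fan.base by decide) (show ¬ Fan.two ≤ Fan.base by decide)
    (show ¬ Fan.one ≤ Fan.two by decide) (show ¬ Fan.two ≤ Fan.one by decide)
instance : span₃₂.{w}.Full :=
  full_of_not_le (show ¬ Fan.three ≤ Fan.base by decide) (show ¬ Fan.two ≤ Fan.base by decide)
    (show ¬ Fan.three ≤ Fan.two by decide) (show ¬ Fan.two ≤ Fan.three by decide)

section Segal

variable {D : Prederivator.{w, v, u}}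

lemma squareJoinLeft_comp : squareJoinLeft.{w} ⋙ joinToSq = 𝟭 _ :=
  functor_ext_of_isThin fun x => by induction x using sq_cases <;> rfl

lemma squareJoinRight_comp : squareJoinRight.{w} ⋙ joinToSq = 𝟭 _ :=
  functor_ext_of_isThin fun x => by induction x using sq_cases <;> rfl

/-- The reflection onto `left ← two → right` rounds `base`, `one` and `three` up to `two`, `left`
and `right`. -/
lemma bij_spanJoin (X : D.Diag Join.{w}) (Y : D.Diag OneCat.{w}) :
    D.Bij spanJoin X ((D.restr (toPt _)).obj Y) := by
  refine bij_of_galoisConnection (fun p => match p with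
    | .base => ⟨sq 0 0, by simp [sq]⟩ | .two => ⟨sq 0 0, by simp [sq]⟩
    | .one => ⟨sq 0 1, by simp [sq]⟩ | .left => ⟨sq 0 1, by simp [sq]⟩
    | .three => ⟨sq 1 0, by simp [sq]⟩ | .right => ⟨sq 1 0, by simp [sq]⟩) _ ?_ ?_ X Y
  · intro a b
    cases a <;> induction b using ul_cases <;>
      (change (_ : Fin 2 × Fin 2) ≤ _ ↔ (_ : Join) ≤ _; decide)
  · intro b
    induction b using ul_cases <;> rfl

lemma isTerminal_sq₁₁ : Nonempty (IsTerminal (sq.{w} 1 1)) :=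
  ⟨IsTerminal.ofUniqueHom (fun x => homOfLE ⟨Fin.le_last x.down.1, Fin.le_last x.down.2⟩)
    (fun _ _ => Subsingleton.elim _ _)⟩

lemma bij_pt_sq₁₁ (X : D.Diag Sq.{w}) (Y : D.Diag OneCat.{w}) :
    D.Bij (pt (sq 1 1)) X ((D.restr (toPt _)).obj Y) :=
  bij_of_adjunction (terminalAdj (toPt _) isTerminal_sq₁₁.some) X Y

lemma isZero_spanJoin {Q : D.Diag Sq.{w}} (h10 : IsZero ((D.ev (sq 1 0)).obj Q)) :
    IsZero ((D.ev (⟨sq 0 0, by simp [sq]⟩ : UL.{w})).obj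
      ((D.restr (spanJoin ⋙ joinToSq)).obj Q)) :=
  (isZero_ev_restr_iff (spanJoin ⋙ joinToSq) _ Q).2 h10

variable [D.IsDerivator]

/-- Below `left` and below `right` the fan is a span, and the diagram over it, completed by the new
vertex, is `Q` itself. So both new vertices are pushouts. -/
lemma bij_fanToJoin {Q : D.Diag Sq.{w}} (hQ : D.IsCocartesian Q) (Z : D.Diag Join.{w}) :
    D.Bij fanToJoin ((D.restr joinToSq).obj Q) Z := by
  refine bij_of_isColimCone _ _ ?_ Z
  rw [isCocartesian_iff_const] at hQ
  intro c
  cases c with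
  | base => exact isColimCone_colimCone_obj fanToJoin Fan.base _
  | one => exact isColimCone_colimCone_obj fanToJoin Fan.one _
  | two => exact isColimCone_colimCone_obj fanToJoin Fan.two _
  | three => exact isColimCone_colimCone_obj fanToJoin Fan.three _
  | left =>
    refine isColimCone_of_square fanToJoin squareJoinLeft span₁₂ (fun x => by
        induction x using ul_cases <;> rfl) (fun a m => ?_) _ ?_
    · have h : fanToJoin.obj a ≤ Join.left := leOfHom m
      clear m
      cases a
      · exact ⟨⟨sq 0 0, by simp [sq]⟩, rfl⟩
      · exact ⟨⟨sq 0 1, by simp [sq]⟩, rfl⟩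
      · exact ⟨⟨sq 1 0, by simp [sq]⟩, rfl⟩
      · exact absurd h (show ¬ Join.three ≤ Join.left by decide)
    · intro Y
      rw [← restr_comp_obj, squareJoinLeft_comp, restr_id_obj]
      exact hQ Y
  | right =>
    refine isColimCone_of_square fanToJoin squareJoinRight span₃₂ (fun x => by
        induction x using ul_cases <;> rfl) (fun a m => ?_) _ ?_
    · have h : fanToJoin.obj a ≤ Join.right := leOfHom m
      clear m
      cases a
      · exact ⟨⟨sq 0 0, by simp [sq]⟩, rfl⟩
      · exact absurd h (show ¬ Join.one ≤ Join.right by decide)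
      · exact ⟨⟨sq 1 0, by simp [sq]⟩, rfl⟩
      · exact ⟨⟨sq 0 1, by simp [sq]⟩, rfl⟩
    · intro Y
      rw [← restr_comp_obj, squareJoinRight_comp, restr_id_obj]
      exact hQ Y

/-- By finality only the span `left ← two → right` matters. Its apex has the value `Q₁₀ = 0`, so its
colimit is the coproduct of two copies of `Q₁₁`. -/
lemma bijective_pull_join {Q : D.Diag Sq.{w}} (h10 : IsZero ((D.ev (sq 1 0)).obj Q))
    (Y : D.Diag OneCat.{w}) : Function.Bijective
      (fun φ : (D.restr joinToSq).obj Q ⟶ (D.restr (toPt Join.{w})).obj Y =>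
        (pull squareJoinLeft (ε' := 𝟭 _) (π' := toPt _) squareJoinLeft_comp rfl φ,
          pull squareJoinRight (ε' := 𝟭 _) (π' := toPt _) squareJoinRight_comp rfl φ)) := by
  let p : ((D.restr (𝟭 Sq.{w})).obj Q ⟶ (D.restr (toPt Sq.{w})).obj Y) →
    ((D.restr (pt (sq 1 1))).obj Q ⟶ (D.restr (toPt OneCat.{w})).obj Y) :=
      pull (pt (sq 1 1)) (Functor.comp_id _) rfl
  have hp : Function.Bijective p := pull_bijective (bij_pt_sq₁₁ _ _) _ _
  -- A map from `Q` to a constant diagram may be replaced by its value at the terminal vertex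
  -- `(1,1)`, which is the value of the map of joins at `left` or at `right`.
  rw [← Function.Bijective.of_comp_iff' (hp.prodMap hp)]
  let s : ((D.restr joinToSq).obj Q ⟶ (D.restr (toPt Join.{w})).obj Y) →
    ((D.restr (spanJoin ⋙ joinToSq)).obj Q ⟶ (D.restr (toPt UL.{w})).obj Y) :=
      pull spanJoin rfl rfl
  have hs : Function.Bijective s := pull_bijective (bij_spanJoin _ _) _ _
  have e1 : pt (⟨sq 0 1, by simp [sq]⟩ : UL.{w}) ⋙ spanJoin ⋙ joinToSq = pt (sq 1 1) :=
    functor_ext_of_isThin fun _ => rfl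
  have e2 : pt (⟨sq 1 0, by simp [sq]⟩ : UL.{w}) ⋙ spanJoin ⋙ joinToSq = pt (sq 1 1) :=
    functor_ext_of_isThin fun _ => rfl
  have hc := (Function.Bijective.prodMap (bijective_eqToHom_conj (D.restr_obj_eq' e1 Q).symm
    (restr_toPt (pt _) Y)) (bijective_eqToHom_conj (D.restr_obj_eq' e2 Q).symm
    (restr_toPt (pt _) Y))).comp (bijective_ev_pair (isZero_spanJoin h10)
      ((D.restr (toPt UL.{w})).obj Y))
  refine (congrArg Function.Bijective (funext fun φ => ?_)).mp (hc.comp hs)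
  refine Prod.ext ?_ ?_
  · change pull (pt (⟨sq 0 1, by simp [sq]⟩ : UL.{w})) e1 rfl (pull spanJoin rfl rfl φ) =
      pull (pt (sq 1 1)) (Functor.comp_id _) rfl (pull squareJoinLeft squareJoinLeft_comp rfl φ)
    rw [pull_pull (v := pt Join.left) (hv := functor_ext_of_isThin fun _ => rfl),
      pull_pull (v := pt Join.left) (hv := functor_ext_of_isThin fun _ => rfl)]
  · change pull (pt (⟨sq 1 0, by simp [sq]⟩ : UL.{w})) e2 rfl (pull spanJoin rfl rfl φ) =
      pull (pt (sq 1 1)) (Functor.comp_id _) rfl (pull squareJoinRight squareJoinRight_comp rfl φ)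
    rw [pull_pull (v := pt Join.right) (hv := functor_ext_of_isThin fun _ => rfl),
      pull_pull (v := pt Join.right) (hv := functor_ext_of_isThin fun _ => rfl)]

lemma span₁₂_comp_foldFan : span₁₂.{w} ⋙ foldFan = 𝟭 _ :=
  functor_ext_of_isThin fun x => by induction x using ul_cases <;> rfl

lemma span₃₂_comp_foldFan : span₃₂.{w} ⋙ foldFan = 𝟭 _ :=
  functor_ext_of_isThin fun x => by induction x using ul_cases <;> rfl

lemma span₁₂_comp_foldFan_comp_inclUL : span₁₂.{w} ⋙ foldFan ⋙ inclUL = inclUL :=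
  functor_ext_of_isThin fun x => by induction x using ul_cases <;> rfl

lemma span₃₂_comp_foldFan_comp_inclUL : span₃₂.{w} ⋙ foldFan ⋙ inclUL = inclUL :=
  functor_ext_of_isThin fun x => by induction x using ul_cases <;> rfl

/-- The Segal condition for diagrams obtained from the span `Q|_⌜`. -/
lemma bijective_pull_fan {Q : D.Diag Sq.{w}} (hQ : D.IsCocartesian Q)
    (h10 : IsZero ((D.ev (sq 1 0)).obj Q)) (Y : D.Diag OneCat.{w}) : Function.Bijective
      (fun φ : (D.restr (foldFan ⋙ inclUL)).obj Q ⟶ (D.restr (toPt Fan.{w})).obj Y =>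
        (pull span₁₂ (ε' := inclUL) (π' := toPt UL.{w})
            span₁₂_comp_foldFan_comp_inclUL rfl φ,
          pull span₃₂ (ε' := inclUL) (π' := toPt UL.{w})
            span₃₂_comp_foldFan_comp_inclUL rfl φ)) := by
  let i : ((D.restr (𝟭 Sq.{w})).obj Q ⟶ (D.restr (toPt Sq.{w})).obj Y) →
    ((D.restr inclUL).obj Q ⟶ (D.restr (toPt UL.{w})).obj Y) :=
      pull inclUL (Functor.comp_id _) rfl
  have hi : Function.Bijective i := pull_bijective (by
    rw [restr_id_obj]; exact (isCocartesian_iff_const Q).1 hQ Y) _ _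
  have e : fanToJoin ⋙ joinToSq = foldFan.{w} ⋙ inclUL :=
    functor_ext_of_isThin fun x => by cases x <;> rfl
  let k : ((D.restr joinToSq).obj Q ⟶ (D.restr (toPt Join.{w})).obj Y) →
    ((D.restr (foldFan ⋙ inclUL)).obj Q ⟶ (D.restr (toPt Fan.{w})).obj Y) :=
      pull fanToJoin e rfl
  have hk : Function.Bijective k := pull_bijective (bij_fanToJoin hQ _) _ _
  rw [← Function.Bijective.of_comp_iff _ hk]
  refine (congrArg Function.Bijective (funext fun φ => ?_)).mp
    ((hi.prodMap hi).comp (bijective_pull_join h10 Y))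
  refine Prod.ext ?_ ?_
  · change pull inclUL (Functor.comp_id _) rfl (pull squareJoinLeft squareJoinLeft_comp rfl φ) =
      pull span₁₂ span₁₂_comp_foldFan_comp_inclUL rfl (pull fanToJoin e rfl φ)
    rw [pull_pull (v := span₁₂ ⋙ fanToJoin) (hv := functor_ext_of_isThin fun x => by
        induction x using ul_cases <;> rfl), pull_pull (v := span₁₂ ⋙ fanToJoin) (hv := rfl)]
  · change pull inclUL (Functor.comp_id _) rfl (pull squareJoinRight squareJoinRight_comp rfl φ) =
      pull span₃₂ span₃₂_comp_foldFan_comp_inclUL rfl (pull fanToJoin e rfl φ)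
    rw [pull_pull (v := span₃₂ ⋙ fanToJoin) (hv := functor_ext_of_isThin fun x => by
        induction x using ul_cases <;> rfl), pull_pull (v := span₃₂ ⋙ fanToJoin) (hv := rfl)]

end Segal

/-! ### Null morphisms -/

section Null

/-- `f` factors through a zero object. -/
def IsNull {E : Type*} [Category* E] {a b : E} (f : a ⟶ b) : Prop :=
  ∃ (z : E) (i : a ⟶ z) (p : z ⟶ b), IsZero z ∧ f = i ≫ p

variable {E : Type*} [Category* E] {a b c : E}

/-- Null morphisms between given objects are unique, so they can be used in every `D(J)` without
choosing zero morphisms there. -/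
lemma IsNull.eq {f g : a ⟶ b} (hf : IsNull f) (hg : IsNull g) : f = g := by
  obtain ⟨z, i, p, hz, rfl⟩ := hf
  obtain ⟨z', i', p', hz', rfl⟩ := hg
  rw [hz.eq_of_src p (hz.to_ z' ≫ p'), ← Category.assoc, hz'.eq_of_tgt (i ≫ hz.to_ z') i']

lemma IsNull.comp {f : a ⟶ b} (hf : IsNull f) (g : b ⟶ c) : IsNull (f ≫ g) := by
  obtain ⟨z, i, p, hz, rfl⟩ := hf
  exact ⟨z, i, p ≫ g, hz, by simp⟩

lemma IsNull.comp' {g : b ⟶ c} (hg : IsNull g) (f : a ⟶ b) : IsNull (f ≫ g) := by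
  obtain ⟨z, i, p, hz, rfl⟩ := hg
  exact ⟨z, f ≫ i, p, hz, by simp⟩

end Null

/-! ### Addition -/

section Addition

variable {D : Prederivator.{w, v, u}}

/-- The functor `⌜ ⥤ □` with `(0,0) ↦ (0,0)` which maps the other objects to `(0,1)`. -/
abbrev edgeUL : UL.{w} ⥤ Sq.{w} :=
  spanUL (sq 0 0) (sq 0 1) (sq 0 1) (by simp [sq]) (by simp [sq])

abbrev foldUL₀₁ : UL.{w} ⥤ UL.{w} :=
  spanUL ⟨sq 0 0, by simp [sq]⟩ ⟨sq 0 1, by simp [sq]⟩ ⟨sq 0 1, by simp [sq]⟩ (by simp [sq])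
    (by simp [sq])

abbrev foldUL₁₀ : UL.{w} ⥤ UL.{w} :=
  spanUL ⟨sq 0 0, by simp [sq]⟩ ⟨sq 1 0, by simp [sq]⟩ ⟨sq 1 0, by simp [sq]⟩ (by simp [sq])
    (by simp [sq])

/-- These strict equalities are the reason for working with `edgeUL`, which uses the zero object
`Q₀₁` twice: endofunctors of `⌜` act on `SpanHom` by plain restriction. For `inclUL` the two zero
objects would be permuted. -/
lemma swapUL_comp_edgeUL : swapUL.{w} ⋙ edgeUL = edgeUL :=
  functor_ext_of_isThin fun x => by induction x using ul_cases <;> rfl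

lemma foldUL₀₁_comp_edgeUL : foldUL₀₁.{w} ⋙ edgeUL = edgeUL :=
  functor_ext_of_isThin fun x => by induction x using ul_cases <;> rfl

lemma foldUL₁₀_comp_edgeUL : foldUL₁₀.{w} ⋙ edgeUL = edgeUL :=
  functor_ext_of_isThin fun x => by induction x using ul_cases <;> rfl

/-- The functor `Fan ⥤ □` with `base ↦ (0,0)` which maps the other objects to `(0,1)`. -/
abbrev edgeFan : Fan.{w} ⥤ Sq.{w} :=
  fanTo (sq 0 0) (sq 0 1) (sq 0 1) (sq 0 1) (by simp [sq]) (by simp [sq]) (by simp [sq])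

lemma foldFan_comp_edgeUL : foldFan.{w} ⋙ edgeUL = edgeFan :=
  functor_ext_of_isThin fun x => by cases x <;> rfl

lemma span₁₂_comp_edgeFan : span₁₂.{w} ⋙ edgeFan = edgeUL :=
  functor_ext_of_isThin fun x => by induction x using ul_cases <;> rfl

lemma span₃₂_comp_edgeFan : span₃₂.{w} ⋙ edgeFan = edgeUL :=
  functor_ext_of_isThin fun x => by induction x using ul_cases <;> rfl

lemma span₂₃_comp_edgeFan : span₂₃.{w} ⋙ edgeFan = edgeUL :=
  functor_ext_of_isThin fun x => by induction x using ul_cases <;> rfl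

lemma span₁₃_comp_edgeFan : span₁₃.{w} ⋙ edgeFan = edgeUL :=
  functor_ext_of_isThin fun x => by induction x using ul_cases <;> rfl

/-- The morphisms from the extension by zero of `Q_{00}` to a constant diagram. -/
abbrev SpanHom (Q : D.Diag Sq.{w}) (Y : D.Diag OneCat.{w}) : Type v :=
  (D.restr edgeUL).obj Q ⟶ (D.restr (toPt UL.{w})).obj Y

/-- The version of `SpanHom` for `Fan`. -/
abbrev FanHom (Q : D.Diag Sq.{w}) (Y : D.Diag OneCat.{w}) : Type v :=
  (D.restr edgeFan).obj Q ⟶ (D.restr (toPt Fan.{w})).obj Y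

/-- Restriction along an endofunctor of `⌜`. -/
abbrev SpanHom.pull {Q : D.Diag Sq.{w}} {Y : D.Diag OneCat.{w}} (s : UL.{w} ⥤ UL.{w})
    (hs : s ⋙ edgeUL = edgeUL) (φ : SpanHom Q Y) : SpanHom Q Y :=
  Prederivator.pull s hs rfl φ

/-- The faces of an element of `FanHom`. -/
abbrev FanHom.face {Q : D.Diag Sq.{w}} {Y : D.Diag OneCat.{w}} (s : UL.{w} ⥤ Fan.{w})
    (hs : s ⋙ edgeFan = edgeUL) (φ : FanHom Q Y) : SpanHom Q Y :=
  Prederivator.pull s hs rfl φ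

/-- The degeneracies to `FanHom`. -/
abbrev SpanHom.degen {Q : D.Diag Sq.{w}} {Y : D.Diag OneCat.{w}} (s : Fan.{w} ⥤ UL.{w})
    (hs : s ⋙ edgeUL = edgeFan) (φ : SpanHom Q Y) : FanHom Q Y :=
  Prederivator.pull s hs rfl φ

lemma toPt_oneCat_eq : toPt OneCat.{w} = 𝟭 _ := functor_oneCat_eq _ _

lemma restr_toPt_oneCat (Y : D.Diag OneCat.{w}) : (D.restr (toPt OneCat.{w})).obj Y = Y := by
  rw [toPt_oneCat_eq, restr_id_obj]

lemma restr_toPt_oneCat_map {Y Y' : D.Diag OneCat.{w}} (y : Y ⟶ Y') :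
    eqToHom (restr_toPt_oneCat Y).symm ≫ (D.restr (toPt OneCat.{w})).map y =
      y ≫ eqToHom (restr_toPt_oneCat Y').symm := by
  rw [D.restr_congr_map toPt_oneCat_eq, restr_id_map]
  simp

/-- The value at `(1,1)` of a morphism from `Q` to a constant diagram. -/
abbrev topValue (Q : D.Diag Sq.{w}) (Y : D.Diag OneCat.{w}) (ε : Sq.{w} ⥤ Sq.{w})
    (hε : pt (sq 1 1) ⋙ ε = pt (sq 1 1))
    (φ : (D.restr ε).obj Q ⟶ (D.restr (toPt Sq.{w})).obj Y) : (D.ev (sq 1 1)).obj Q ⟶ Y :=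
  pull (pt (sq 1 1)) hε (π' := toPt OneCat.{w}) rfl φ ≫ eqToHom (restr_toPt_oneCat Y)

lemma topValue_bijective (Q : D.Diag Sq.{w}) (Y : D.Diag OneCat.{w}) (ε : Sq.{w} ⥤ Sq.{w})
    (hε : pt (sq 1 1) ⋙ ε = pt (sq 1 1)) : Function.Bijective (topValue Q Y ε hε) :=
  (bijective_comp_of_isIso' _ _).comp (pull_bijective (bij_pt_sq₁₁ _ _) hε rfl)

/-- The morphism from `Q` to a constant diagram given by a morphism `Q_{11} ⟶ Y`. -/
noncomputable def coneTop {Q : D.Diag Sq.{w}} {Y : D.Diag OneCat.{w}}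
    (f : (D.ev (sq 1 1)).obj Q ⟶ Y) : (D.restr (𝟭 _)).obj Q ⟶ (D.restr (toPt Sq.{w})).obj Y :=
  ((topValue_bijective Q Y (𝟭 _) (Functor.comp_id _)).2 f).choose

lemma topValue_coneTop {Q : D.Diag Sq.{w}} {Y : D.Diag OneCat.{w}}
    (f : (D.ev (sq 1 1)).obj Q ⟶ Y) : topValue Q Y (𝟭 _) (Functor.comp_id _) (coneTop f) = f :=
  ((topValue_bijective Q Y (𝟭 _) (Functor.comp_id _)).2 f).choose_spec

lemma coneTop_bijective (Q : D.Diag Sq.{w}) (Y : D.Diag OneCat.{w}) :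
    Function.Bijective (coneTop (Q := Q) (Y := Y)) := by
  refine ⟨fun f g h => ?_, fun φ => ⟨topValue Q Y (𝟭 _) (Functor.comp_id _) φ, ?_⟩⟩
  · rw [← topValue_coneTop f, h, topValue_coneTop]
  · exact (topValue_bijective Q Y (𝟭 _) (Functor.comp_id _)).1 (topValue_coneTop _)

lemma topValue_comp {Q : D.Diag Sq.{w}} {Y Y' : D.Diag OneCat.{w}} {ε : Sq.{w} ⥤ Sq.{w}}
    (hε : pt (sq 1 1) ⋙ ε = pt (sq 1 1))
    (φ : (D.restr ε).obj Q ⟶ (D.restr (toPt Sq.{w})).obj Y) (y : Y ⟶ Y') :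
    topValue Q Y' ε hε (φ ≫ (D.restr (toPt _)).map y) = topValue Q Y ε hε φ ≫ y := by
  have := restr_toPt_oneCat_map y
  rw [eqToHom_comp_iff] at this
  rw [topValue, pull_comp (π' := toPt OneCat.{w}) (ρ' := toPt OneCat.{w}) (hπ := rfl),
    pull_restr_map, Category.assoc, this]
  simp

lemma comp_topValue {Q Q' : D.Diag Sq.{w}} {Y : D.Diag OneCat.{w}} {ε δ : Sq.{w} ⥤ Sq.{w}}
    (hε : pt (sq 1 1) ⋙ ε = pt (sq 1 1)) (hδ : pt (sq 1 1) ⋙ δ = pt (sq 1 1))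
    (q : (D.restr δ).obj Q ⟶ (D.restr ε).obj Q')
    (φ : (D.restr ε).obj Q' ⟶ (D.restr (toPt Sq.{w})).obj Y) :
    topValue Q Y δ hδ (q ≫ φ) = pull (pt (sq 1 1)) hδ hε q ≫ topValue Q' Y ε hε φ := by
  rw [topValue, pull_comp (hπ := hε), Category.assoc]

lemma coneTop_comp {Q : D.Diag Sq.{w}} {Y Y' : D.Diag OneCat.{w}}
    (f : (D.ev (sq 1 1)).obj Q ⟶ Y) (y : Y ⟶ Y') :
    coneTop (f ≫ y) = coneTop f ≫ (D.restr (toPt _)).map y := by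
  apply (topValue_bijective Q Y' (𝟭 _) (Functor.comp_id _)).1
  rw [topValue_coneTop, topValue_comp, topValue_coneTop]

lemma coneTop_naturality {Q Q' : D.Diag Sq.{w}} {Y : D.Diag OneCat.{w}} (q : Q ⟶ Q')
    (f : (D.ev (sq 1 1)).obj Q' ⟶ Y) :
    coneTop ((D.ev (sq 1 1)).map q ≫ f) = (D.restr (𝟭 _)).map q ≫ coneTop f := by
  apply (topValue_bijective Q Y (𝟭 _) (Functor.comp_id _)).1
  rw [topValue_coneTop, comp_topValue (hε := Functor.comp_id _), topValue_coneTop, pull_restr_map]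

lemma coneTop_swap {Q : D.Diag Sq.{w}} {Y : D.Diag OneCat.{w}}
    (t : (D.restr (𝟭 _)).obj Q ⟶ (D.restr swapSq).obj Q) (f : (D.ev (sq 1 1)).obj Q ⟶ Y) :
    coneTop (pull (pt (sq 1 1)) (Functor.comp_id _) (pt_comp _ _) t ≫ f) =
      t ≫ pull swapSq (Functor.comp_id _) rfl (coneTop f) := by
  apply (topValue_bijective Q Y (𝟭 _) (Functor.comp_id _)).1
  rw [topValue_coneTop, comp_topValue (hε := pt_comp _ _)]
  congr 1
  exact (topValue_coneTop f).symm.trans (congrArg (fun t => t ≫ eqToHom (restr_toPt_oneCat Y))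
    (pull_pull swapSq (pt (sq 1 1)) (Functor.comp_id _) rfl (pt_comp _ _) rfl
      (v := pt (sq 1 1)) (pt_comp _ _) (coneTop f)).symm)

end Addition

/-! ### Addition of morphisms out of the last vertex of a bicartesian square -/

section SpanOf

variable {D : Prederivator.{w, v, u}}

lemma cornerUL_comp_edgeUL : cornerUL.{w} ⋙ edgeUL = pt (sq 0 0) :=
  functor_ext_of_isThin fun _ => rfl

lemma cornerUL_comp_inclUL : cornerUL.{w} ⋙ inclUL = pt (sq 0 0) := rfl

lemma cornerUL_comp_swapUL : cornerUL.{w} ⋙ swapUL = cornerUL :=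
  functor_ext_of_isThin fun _ => rfl

lemma pull_one {A J J' : Type w} [SmallCategory A] [SmallCategory J] [SmallCategory J'] {u : J' ⥤ J}
    {ε : J ⥤ A} {ε' : J' ⥤ A} (hε : u ⋙ ε = ε') (X : D.Diag A) :
    pull u hε hε (𝟙 ((D.restr ε).obj X)) = 𝟙 _ := by
  simp [pull]

variable [D.IsDerivator] {Q Q' : D.Diag Sq.{w}} {Y Y' : D.Diag OneCat.{w}}

/-- Morphisms into a diagram of shape `⌜` which vanishes outside of `(0,0)` are determined by
their value at `(0,0)`. -/
lemma pull_cornerUL_bijective {A B : Type w} [SmallCategory A] [SmallCategory B] {ε : UL.{w} ⥤ A}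
    {π : UL.{w} ⥤ B} {ε' : OneCat.{w} ⥤ A} {π' : OneCat.{w} ⥤ B} (hε : cornerUL ⋙ ε = ε')
    (hπ : cornerUL ⋙ π = π') (X : D.Diag A) (Z : D.Diag B)
    (h01 : IsZero ((D.ev (π.obj ⟨sq 0 1, by simp [sq]⟩)).obj Z))
    (h10 : IsZero ((D.ev (π.obj ⟨sq 1 0, by simp [sq]⟩)).obj Z)) :
    Function.Bijective (pull (D := D) cornerUL hε hπ (X := X) (Y := Z)) :=
  pull_bijective (bij_cornerUL _ ((isZero_ev_restr_iff π _ Z).2 h01)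
    ((isZero_ev_restr_iff π _ Z).2 h10) _) hε hπ

/-- The canonical isomorphism between the restrictions of `Q` along `edgeUL` and `inclUL`, which is
the identity at `(0,0)`. -/
noncomputable def edgeToSpan (h : D.IsLoopSquare Q) :
    (D.restr edgeUL).obj Q ⟶ (D.restr inclUL).obj Q :=
  ((pull_cornerUL_bijective cornerUL_comp_edgeUL cornerUL_comp_inclUL Q Q h.isZero₀₁
    h.isZero₁₀).2 (𝟙 _)).choose

lemma pull_edgeToSpan (h : D.IsLoopSquare Q) :
    pull cornerUL cornerUL_comp_edgeUL cornerUL_comp_inclUL (edgeToSpan h) = 𝟙 _ :=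
  ((pull_cornerUL_bijective cornerUL_comp_edgeUL cornerUL_comp_inclUL Q Q h.isZero₀₁
    h.isZero₁₀).2 (𝟙 _)).choose_spec

instance isIso_edgeToSpan (h : D.IsLoopSquare Q) : IsIso (edgeToSpan h) := by
  have h1 := pull_cornerUL_bijective cornerUL_comp_inclUL cornerUL_comp_edgeUL Q Q h.isZero₀₁
    h.isZero₀₁
  obtain ⟨k, hk⟩ := h1.2 (𝟙 _)
  refine ⟨k, ?_, ?_⟩
  · apply (pull_cornerUL_bijective cornerUL_comp_edgeUL cornerUL_comp_edgeUL Q Q h.isZero₀₁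
      h.isZero₀₁).1
    rw [pull_comp (hπ := cornerUL_comp_inclUL), pull_edgeToSpan, hk, pull_one, Category.comp_id]
  · apply (pull_cornerUL_bijective cornerUL_comp_inclUL cornerUL_comp_inclUL Q Q h.isZero₀₁
      h.isZero₁₀).1
    rw [pull_comp (hπ := cornerUL_comp_edgeUL), pull_edgeToSpan, hk, pull_one, Category.comp_id]

lemma edgeToSpan_naturality (h : D.IsLoopSquare Q) (h' : D.IsLoopSquare Q') (q : Q ⟶ Q') :
    edgeToSpan h ≫ (D.restr inclUL).map q = (D.restr edgeUL).map q ≫ edgeToSpan h' := by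
  apply (pull_cornerUL_bijective cornerUL_comp_edgeUL cornerUL_comp_inclUL Q Q' h'.isZero₀₁
    h'.isZero₁₀).1
  rw [pull_comp (hπ := cornerUL_comp_inclUL), pull_comp (hπ := cornerUL_comp_edgeUL),
    pull_edgeToSpan, pull_edgeToSpan, pull_restr_map, pull_restr_map]
  simp

/-- The bijection between `Q_{11} ⟶ Y` and the morphisms of `⌜`-shaped diagrams from
`0 ⟵ Q_{00} ⟶ 0` to the constant diagram `Y`. -/
noncomputable def spanOf (h : D.IsLoopSquare Q) (f : (D.ev (sq 1 1)).obj Q ⟶ Y) : SpanHom Q Y :=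
  edgeToSpan h ≫ pull inclUL (Functor.comp_id _) rfl (coneTop f)

/-- Maps out of `Q₁₁` are maps from `Q` to a constant diagram because `(1,1)` is terminal, and these
are determined on `⌜` because `Q` is cocartesian. -/
lemma spanOf_bijective (h : D.IsLoopSquare Q) (Y : D.Diag OneCat.{w}) :
    Function.Bijective (spanOf (Y := Y) h) := by
  have hi : Function.Bijective (pull (D := D) inclUL (ε := 𝟭 _) (π := toPt Sq.{w}) (ε' := inclUL)
      (π' := toPt UL.{w}) (Functor.comp_id _) rfl (X := Q) (Y := Y)) := by
    refine pull_bijective ?_ _ _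
    rw [restr_id_obj]
    exact (isCocartesian_iff_const Q).1 h.isCocartesian Y
  exact (bijective_comp_of_isIso (edgeToSpan h) _).comp (hi.comp (coneTop_bijective Q Y))

lemma spanOf_comp (h : D.IsLoopSquare Q) (f : (D.ev (sq 1 1)).obj Q ⟶ Y) (y : Y ⟶ Y') :
    spanOf h (f ≫ y) = spanOf h f ≫ (D.restr (toPt _)).map y := by
  rw [spanOf, spanOf, coneTop_comp, pull_comp (π' := toPt UL.{w}) (ρ' := toPt UL.{w}) (hπ := rfl),
    pull_restr_map, Category.assoc]

lemma spanOf_naturality (h : D.IsLoopSquare Q) (h' : D.IsLoopSquare Q') (q : Q ⟶ Q')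
    (f : (D.ev (sq 1 1)).obj Q' ⟶ Y) :
    spanOf h ((D.ev (sq 1 1)).map q ≫ f) = (D.restr edgeUL).map q ≫ spanOf h' f := by
  rw [spanOf, spanOf, coneTop_naturality, pull_comp (hπ := Functor.comp_id _), pull_restr_map,
    reassoc_of% (edgeToSpan_naturality h h' q)]

lemma IsNull.spanOf (h : D.IsLoopSquare Q) {f : (D.ev (sq 1 1)).obj Q ⟶ Y} (hf : IsNull f) :
    IsNull (Prederivator.spanOf h f) := by
  obtain ⟨z, i, p, hz, rfl⟩ := hf
  exact ⟨_, _, _, isZero_restr _ hz, spanOf_comp h i p⟩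

lemma IsNull.of_spanOf (h : D.IsLoopSquare Q) {f : (D.ev (sq 1 1)).obj Q ⟶ Y}
    (hf : IsNull (Prederivator.spanOf h f)) (hD : HasZeroObject (D.Diag OneCat.{w})) :
    IsNull f := by
  obtain ⟨z, hz⟩ := hD
  have hn : IsNull (hz.from_ ((D.ev (sq 1 1)).obj Q) ≫ hz.to_ Y) := ⟨z, _, _, hz, rfl⟩
  rwa [(spanOf_bijective h Y).1 (hf.eq (hn.spanOf h))]

/-- The effect of the transposition of `Q` on the maps `Q_{11} ⟶ Y`. -/
lemma spanOf_swap (h : D.IsLoopSquare Q) (t : (D.restr (𝟭 _)).obj Q ⟶ (D.restr swapSq).obj Q)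
    (ht : pull (pt (sq 0 0)) (Functor.comp_id _) (π' := pt (sq 0 0)) (pt_comp _ _) t = 𝟙 _)
    (f : (D.ev (sq 1 1)).obj Q ⟶ Y) :
    spanOf h (pull (pt (sq 1 1)) (Functor.comp_id _) (pt_comp _ _) t ≫ f) =
      SpanHom.pull swapUL swapUL_comp_edgeUL (spanOf h f) := by
  -- Both sides map to a diagram vanishing outside `(0,0)`, and both are the identity at `(0,0)`.
  have key : edgeToSpan h ≫ pull inclUL (Functor.comp_id _) inclUL_comp_swapSq t =
      pull swapUL swapUL_comp_edgeUL rfl (edgeToSpan h) := by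
    apply (pull_cornerUL_bijective cornerUL_comp_edgeUL (π := swapUL ⋙ inclUL)
      (π' := pt (sq 0 0)) (functor_ext_of_isThin fun _ => rfl) Q Q h.isZero₁₀ h.isZero₀₁).1
    rw [pull_comp (hπ := cornerUL_comp_inclUL), pull_edgeToSpan, Category.id_comp,
      pull_pull (v := pt (sq 0 0)) (hv := cornerUL_comp_inclUL),
      pull_pull (v := cornerUL) (hv := cornerUL_comp_swapUL)]
    exact ht.trans (pull_edgeToSpan h).symm
  rw [spanOf, coneTop_swap, pull_comp (hπ := inclUL_comp_swapSq), reassoc_of% key, spanOf,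
    SpanHom.pull, pull_comp (hπ := rfl) (ρ' := toPt UL.{w})]
  congr 1
  rw [pull_pull (v := swapUL ⋙ inclUL) (hv := inclUL_comp_swapSq),
    pull_pull (v := swapUL ⋙ inclUL) (hv := rfl)]

end SpanOf

/-! ### The addition defined by the faces of a fan -/

section FanAddition

variable {D : Prederivator.{w, v, u}}

abbrev degenRight : Fan.{w} ⥤ UL.{w} :=
  fanTo ⟨sq 0 0, by simp [sq]⟩ ⟨sq 0 1, by simp [sq]⟩ ⟨sq 1 0, by simp [sq]⟩ ⟨sq 1 0, by simp [sq]⟩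
    (by simp [sq]) (by simp [sq]) (by simp [sq])

abbrev degenLeft : Fan.{w} ⥤ UL.{w} :=
  fanTo ⟨sq 0 0, by simp [sq]⟩ ⟨sq 0 1, by simp [sq]⟩ ⟨sq 0 1, by simp [sq]⟩ ⟨sq 1 0, by simp [sq]⟩
    (by simp [sq]) (by simp [sq]) (by simp [sq])

lemma degenRight_comp_edgeUL : degenRight.{w} ⋙ edgeUL = edgeFan :=
  functor_ext_of_isThin fun x => by cases x <;> rfl

lemma degenLeft_comp_edgeUL : degenLeft.{w} ⋙ edgeUL = edgeFan :=
  functor_ext_of_isThin fun x => by cases x <;> rfl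

section

variable {J : Type w} [SmallCategory J]

/-- Restricting a morphism to a constant diagram along a functor which can be contracted to an
object where the source vanishes gives a null morphism. -/
lemma isNull_restr_map [D.IsDerivator] {s : J ⥤ J} {c : J} (γ : s ⟶ toPt J ⋙ pt c) {X : D.Diag J}
    {Y : D.Diag OneCat.{w}} (hX : IsZero ((D.ev c).obj X))
    (φ : X ⟶ (D.restr (toPt J)).obj Y) : IsNull ((D.restr s).map φ) := by
  -- A constant diagram does not see the contraction `γ`, so by naturality the restricted morphism
  -- factors through the constant diagram at `X_c`, which is zero.
  have hγ : IsIso ((D.restrMap γ).app ((D.restr (toPt J)).obj Y)) := by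
    have h1 := D.restrMap_whiskerRight_app γ (toPt J) Y
    have : IsIso (Functor.whiskerRight γ (toPt J)) := by
      rw [NatTrans.isIso_iff_isIso_app]
      intro j
      exact ⟨Discrete.eqToHom rfl, Subsingleton.elim _ _, Subsingleton.elim _ _⟩
    have h2 : IsIso ((D.restrMap (Functor.whiskerRight γ (toPt J))).app Y) := by
      have := D.isIso_restrMap (Functor.whiskerRight γ (toPt J))
      infer_instance
    rw [h1] at h2
    simpa using h2
  have hz : IsZero ((D.restr (toPt J ⋙ pt c)).obj X) := by
    rw [restr_comp_obj]
    exact isZero_restr _ hX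
  have h := (D.restrMap γ).naturality φ
  rw [← IsIso.eq_comp_inv] at h
  rw [h]
  exact ⟨_, (D.restrMap γ).app X, _, hz, Category.assoc _ _ _⟩

lemma isNull_pull [D.IsDerivator] {s : UL.{w} ⥤ UL.{w}} (hs : s ⋙ edgeUL = edgeUL) {c : UL.{w}}
    (γ : s ⟶ toPt _ ⋙ pt c) {Q : D.Diag Sq.{w}} (hQ : IsZero ((D.ev (edgeUL.obj c)).obj Q))
    {Y : D.Diag OneCat.{w}} (φ : SpanHom Q Y) : IsNull (SpanHom.pull s hs φ) :=
  ((isNull_restr_map γ ((isZero_ev_restr_iff edgeUL c Q).2 hQ) φ).comp _).comp' _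

end

/-- After folding, the span has two equal legs and contracts to their common end, where the source
vanishes: a constant path is zero. -/
lemma isNull_pull_foldUL₀₁ [D.IsDerivator] {Q : D.Diag Sq.{w}} (hQ : IsZero ((D.ev (sq 0 1)).obj Q))
    {Y : D.Diag OneCat.{w}} (φ : SpanHom Q Y) :
    IsNull (SpanHom.pull foldUL₀₁ foldUL₀₁_comp_edgeUL φ) :=
  isNull_pull _ (c := ⟨sq 0 1, by simp [sq]⟩)
    { app := fun x => homOfLE (by
        induction x using ul_cases <;> (change (_ : Fin 2 × Fin 2) ≤ _; decide))
      naturality := fun _ _ _ => Subsingleton.elim _ _ } hQ φ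

lemma isNull_pull_foldUL₁₀ [D.IsDerivator] {Q : D.Diag Sq.{w}} (hQ : IsZero ((D.ev (sq 0 1)).obj Q))
    {Y : D.Diag OneCat.{w}} (φ : SpanHom Q Y) :
    IsNull (SpanHom.pull foldUL₁₀ foldUL₁₀_comp_edgeUL φ) :=
  isNull_pull _ (c := ⟨sq 1 0, by simp [sq]⟩)
    { app := fun x => homOfLE (by
        induction x using ul_cases <;> (change (_ : Fin 2 × Fin 2) ≤ _; decide))
      naturality := fun _ _ _ => Subsingleton.elim _ _ } hQ φ

variable {Q Q' : D.Diag Sq.{w}} {Y Y' : D.Diag OneCat.{w}}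

lemma bijective_pull_swapUL (Q : D.Diag Sq.{w}) (Y : D.Diag OneCat.{w}) :
    Function.Bijective (SpanHom.pull (Q := Q) (Y := Y) swapUL swapUL_comp_edgeUL) :=
  pull_bijective (bij_of_full_faithful _ _ _) _ _

lemma FanHom.face_comp {s : UL.{w} ⥤ Fan.{w}} (hs : s ⋙ edgeFan = edgeUL) (k : FanHom Q Y)
    (y : Y ⟶ Y') : FanHom.face s hs (k ≫ (D.restr (toPt _)).map y) =
      FanHom.face s hs k ≫ (D.restr (toPt _)).map y := by
  rw [FanHom.face, pull_comp (hπ := rfl) (π' := toPt UL.{w}) (ρ' := toPt UL.{w}), pull_restr_map]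

lemma FanHom.face_precomp {s : UL.{w} ⥤ Fan.{w}} (hs : s ⋙ edgeFan = edgeUL) (q : Q ⟶ Q')
    (k : FanHom Q' Y) : FanHom.face s hs ((D.restr edgeFan).map q ≫ k) =
      (D.restr edgeUL).map q ≫ FanHom.face s hs k := by
  rw [FanHom.face, pull_comp (hπ := hs), pull_restr_map]

lemma FanHom.face_degen {s : UL.{w} ⥤ Fan.{w}} (hs : s ⋙ edgeFan = edgeUL) {d : Fan.{w} ⥤ UL.{w}}
    (hd : d ⋙ edgeUL = edgeFan) {r : UL.{w} ⥤ UL.{w}} (hr : s ⋙ d = r) (φ : SpanHom Q Y) :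
    FanHom.face s hs (SpanHom.degen d hd φ) =
      SpanHom.pull r (by rw [← hr, Functor.assoc, hd, hs]) φ := by
  rw [FanHom.face, SpanHom.degen, pull_pull (v := r) (hv := hr)]

variable [D.IsDerivator]

lemma bijective_faces (h : D.IsLoopSquare Q) (Y : D.Diag OneCat.{w}) :
    Function.Bijective (fun k : FanHom Q Y =>
      (FanHom.face span₁₂ span₁₂_comp_edgeFan k, FanHom.face span₃₂ span₃₂_comp_edgeFan k)) := by
  -- `foldFan` retracts both spans `12` and `32`, so each of these faces of `κ` is `edgeToSpan h`,
  -- and `κ` transports the Segal condition.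
  let κ : (D.restr edgeFan).obj Q ⟶ (D.restr (foldFan ⋙ inclUL)).obj Q :=
    pull foldFan foldFan_comp_edgeUL rfl (edgeToSpan h)
  have : IsIso κ := by
    dsimp only [κ, pull]
    infer_instance
  have e := bijective_comp_of_isIso (edgeToSpan h) ((D.restr (toPt _)).obj Y)
  rw [← Function.Bijective.of_comp_iff _ (bijective_comp_of_isIso κ _)]
  refine (congrArg Function.Bijective (funext fun m => ?_)).mp
    ((e.prodMap e).comp (bijective_pull_fan h.isCocartesian h.isZero₁₀ Y))
  refine Prod.ext ?_ ?_
  · change _ = pull span₁₂ span₁₂_comp_edgeFan rfl (κ ≫ m)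
    rw [pull_comp (hπ := span₁₂_comp_foldFan_comp_inclUL) (ρ' := toPt UL.{w})]
    dsimp only [κ]
    rw [pull_pull (v := 𝟭 _) (hv := span₁₂_comp_foldFan), pull_id rfl]
    rfl
  · change _ = pull span₃₂ span₃₂_comp_edgeFan rfl (κ ≫ m)
    rw [pull_comp (hπ := span₃₂_comp_foldFan_comp_inclUL) (ρ' := toPt UL.{w})]
    dsimp only [κ]
    rw [pull_pull (v := 𝟭 _) (hv := span₃₂_comp_foldFan), pull_id rfl]
    rfl

lemma swapUL_comp_span₃₂ : swapUL.{w} ⋙ span₃₂ = span₂₃ :=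
  functor_ext_of_isThin fun x => by induction x using ul_cases <;> rfl

/-- The gluing takes place along the vertex `two`; reorienting the second face from `32` to `23`
makes the two paths composable. -/
lemma bijective_faces' (h : D.IsLoopSquare Q) (Y : D.Diag OneCat.{w}) :
    Function.Bijective (fun k : FanHom Q Y =>
      (FanHom.face span₁₂ span₁₂_comp_edgeFan k, FanHom.face span₂₃ span₂₃_comp_edgeFan k)) := by
  refine (congrArg Function.Bijective (funext fun k => ?_)).mp
    ((Function.bijective_id.prodMap (bijective_pull_swapUL Q Y)).comp (bijective_faces h Y))
  refine Prod.ext rfl ?_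
  change pull swapUL swapUL_comp_edgeUL rfl (pull span₃₂ span₃₂_comp_edgeFan rfl k) = _
  rw [pull_pull (v := span₂₃) (hv := swapUL_comp_span₃₂)]

/-- The addition of morphisms of spans. -/
noncomputable def SpanHom.add (h : D.IsLoopSquare Q) (φ ψ : SpanHom Q Y) : SpanHom Q Y :=
  FanHom.face span₁₃ span₁₃_comp_edgeFan ((bijective_faces' h Y).2 (φ, ψ)).choose

/-- The sum is a concatenation of paths: the face `13` of any fan with the prescribed faces `12` and
`23`. Every identity below is proved by exhibiting a fan. -/
lemma SpanHom.add_eq (h : D.IsLoopSquare Q) {φ ψ : SpanHom Q Y} (k : FanHom Q Y)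
    (h12 : FanHom.face span₁₂ span₁₂_comp_edgeFan k = φ)
    (h23 : FanHom.face span₂₃ span₂₃_comp_edgeFan k = ψ) :
    SpanHom.add h φ ψ = FanHom.face span₁₃ span₁₃_comp_edgeFan k := by
  have := ((bijective_faces' h Y).2 (φ, ψ)).choose_spec
  rw [SpanHom.add, (bijective_faces' h Y).1 (this.trans (Prod.ext h12 h23).symm)]

lemma SpanHom.exists_fan (h : D.IsLoopSquare Q) (φ ψ : SpanHom Q Y) : ∃ k : FanHom Q Y,
    FanHom.face span₁₂ span₁₂_comp_edgeFan k = φ ∧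
      FanHom.face span₂₃ span₂₃_comp_edgeFan k = ψ := by
  obtain ⟨k, hk⟩ := (bijective_faces' h Y).2 (φ, ψ)
  exact ⟨k, congrArg Prod.fst hk, congrArg Prod.snd hk⟩

lemma SpanHom.add_comp (h : D.IsLoopSquare Q) (φ ψ : SpanHom Q Y) (y : Y ⟶ Y') :
    SpanHom.add h (φ ≫ (D.restr (toPt _)).map y) (ψ ≫ (D.restr (toPt _)).map y) =
      SpanHom.add h φ ψ ≫ (D.restr (toPt _)).map y := by
  obtain ⟨k, rfl, rfl⟩ := SpanHom.exists_fan h φ ψ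
  rw [SpanHom.add_eq h k rfl rfl, SpanHom.add_eq h (k ≫ (D.restr (toPt _)).map y)
    (FanHom.face_comp _ _ _) (FanHom.face_comp _ _ _), FanHom.face_comp]

lemma SpanHom.comp_add (h : D.IsLoopSquare Q) (h' : D.IsLoopSquare Q') (q : Q ⟶ Q')
    (φ ψ : SpanHom Q' Y) :
    SpanHom.add h ((D.restr edgeUL).map q ≫ φ) ((D.restr edgeUL).map q ≫ ψ) =
      (D.restr edgeUL).map q ≫ SpanHom.add h' φ ψ := by
  obtain ⟨k, rfl, rfl⟩ := SpanHom.exists_fan h' φ ψ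
  rw [SpanHom.add_eq h' k rfl rfl, SpanHom.add_eq h ((D.restr edgeFan).map q ≫ k)
    (FanHom.face_precomp _ _ _) (FanHom.face_precomp _ _ _), FanHom.face_precomp]

/-- The degenerate fan with `two = three` has `φ` as its faces `12` and `13`, while its face `23` is
folded and hence null. -/
lemma SpanHom.add_null (h : D.IsLoopSquare Q) (φ : SpanHom Q Y) {ψ : SpanHom Q Y}
    (hψ : IsNull ψ) : SpanHom.add h φ ψ = φ := by
  have e1 : span₁₂.{w} ⋙ degenRight = 𝟭 _ :=
    functor_ext_of_isThin fun x => by induction x using ul_cases <;> rfl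
  have e2 : span₂₃.{w} ⋙ degenRight = foldUL₁₀ :=
    functor_ext_of_isThin fun x => by induction x using ul_cases <;> rfl
  have e3 : span₁₃.{w} ⋙ degenRight = 𝟭 _ :=
    functor_ext_of_isThin fun x => by induction x using ul_cases <;> rfl
  rw [SpanHom.add_eq h (SpanHom.degen degenRight degenRight_comp_edgeUL φ)
    ((FanHom.face_degen _ _ e1 _).trans (pull_id rfl _ _ _))
    ((FanHom.face_degen _ _ e2 _).trans ((isNull_pull_foldUL₁₀ h.isZero₀₁ φ).eq hψ)),
    FanHom.face_degen _ _ e3]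
  exact pull_id rfl _ _ _

lemma SpanHom.null_add (h : D.IsLoopSquare Q) (φ : SpanHom Q Y) {ψ : SpanHom Q Y}
    (hψ : IsNull ψ) : SpanHom.add h ψ φ = φ := by
  have e1 : span₁₂.{w} ⋙ degenLeft = foldUL₀₁ :=
    functor_ext_of_isThin fun x => by induction x using ul_cases <;> rfl
  have e2 : span₂₃.{w} ⋙ degenLeft = 𝟭 _ :=
    functor_ext_of_isThin fun x => by induction x using ul_cases <;> rfl
  have e3 : span₁₃.{w} ⋙ degenLeft = 𝟭 _ :=
    functor_ext_of_isThin fun x => by induction x using ul_cases <;> rfl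
  rw [SpanHom.add_eq h (SpanHom.degen degenLeft degenLeft_comp_edgeUL φ)
    ((FanHom.face_degen _ _ e1 _).trans ((isNull_pull_foldUL₀₁ h.isZero₀₁ φ).eq hψ))
    ((FanHom.face_degen _ _ e2 _).trans (pull_id rfl _ _ _)), FanHom.face_degen _ _ e3]
  exact pull_id rfl _ _ _

/-- The degenerate fan with `one = three` runs along `φ` and back again; its face `13` is folded. -/
lemma SpanHom.isNull_add_pull_swapUL (h : D.IsLoopSquare Q) (φ : SpanHom Q Y) :
    IsNull (SpanHom.add h φ (SpanHom.pull swapUL swapUL_comp_edgeUL φ)) := by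
  have e1 : span₁₂.{w} ⋙ foldFan = 𝟭 _ :=
    functor_ext_of_isThin fun x => by induction x using ul_cases <;> rfl
  have e2 : span₂₃.{w} ⋙ foldFan = swapUL :=
    functor_ext_of_isThin fun x => by induction x using ul_cases <;> rfl
  have e3 : span₁₃.{w} ⋙ foldFan = foldUL₀₁ :=
    functor_ext_of_isThin fun x => by induction x using ul_cases <;> rfl
  rw [SpanHom.add_eq h (SpanHom.degen foldFan foldFan_comp_edgeUL φ)
    ((FanHom.face_degen _ _ e1 _).trans (pull_id rfl _ _ _)) (FanHom.face_degen _ _ e2 _),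
    FanHom.face_degen _ _ e3]
  exact isNull_pull_foldUL₀₁ h.isZero₀₁ φ

/-- The addition of morphisms out of `Q_{11}`. -/
noncomputable def addTop (h : D.IsLoopSquare Q) (f g : (D.ev (sq 1 1)).obj Q ⟶ Y) :
    (D.ev (sq 1 1)).obj Q ⟶ Y :=
  ((spanOf_bijective h Y).2 (SpanHom.add h (spanOf h f) (spanOf h g))).choose

lemma spanOf_addTop (h : D.IsLoopSquare Q) (f g : (D.ev (sq 1 1)).obj Q ⟶ Y) :
    spanOf h (addTop h f g) = SpanHom.add h (spanOf h f) (spanOf h g) :=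
  ((spanOf_bijective h Y).2 (SpanHom.add h (spanOf h f) (spanOf h g))).choose_spec

lemma addTop_comp (h : D.IsLoopSquare Q) (f g : (D.ev (sq 1 1)).obj Q ⟶ Y) (y : Y ⟶ Y') :
    addTop h (f ≫ y) (g ≫ y) = addTop h f g ≫ y := by
  apply (spanOf_bijective h Y').1
  rw [spanOf_addTop, spanOf_comp, spanOf_comp, spanOf_comp, spanOf_addTop, SpanHom.add_comp]

lemma comp_addTop (h : D.IsLoopSquare Q) (h' : D.IsLoopSquare Q') (q : Q ⟶ Q')
    (f g : (D.ev (sq 1 1)).obj Q' ⟶ Y) :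
    addTop h ((D.ev (sq 1 1)).map q ≫ f) ((D.ev (sq 1 1)).map q ≫ g) =
      (D.ev (sq 1 1)).map q ≫ addTop h' f g := by
  apply (spanOf_bijective h Y).1
  rw [spanOf_addTop, spanOf_naturality h h', spanOf_naturality h h', spanOf_naturality h h',
    spanOf_addTop, SpanHom.comp_add h h']

lemma addTop_null (h : D.IsLoopSquare Q) (f : (D.ev (sq 1 1)).obj Q ⟶ Y)
    {g : (D.ev (sq 1 1)).obj Q ⟶ Y} (hg : IsNull g) : addTop h f g = f := by
  apply (spanOf_bijective h Y).1
  rw [spanOf_addTop, SpanHom.add_null h _ (hg.spanOf h)]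

lemma null_addTop (h : D.IsLoopSquare Q) (f : (D.ev (sq 1 1)).obj Q ⟶ Y)
    {g : (D.ev (sq 1 1)).obj Q ⟶ Y} (hg : IsNull g) : addTop h g f = f := by
  apply (spanOf_bijective h Y).1
  rw [spanOf_addTop, SpanHom.null_add h _ (hg.spanOf h)]

lemma isNull_addTop (h : D.IsLoopSquare Q) (hD : HasZeroObject (D.Diag OneCat.{w}))
    (t : (D.restr (𝟭 _)).obj Q ⟶ (D.restr swapSq).obj Q)
    (ht : pull (pt (sq 0 0)) (Functor.comp_id _) (π' := pt (sq 0 0)) (pt_comp _ _) t = 𝟙 _)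
    (f : (D.ev (sq 1 1)).obj Q ⟶ Y) : IsNull
      (addTop h f (pull (pt (sq 1 1)) (Functor.comp_id _) (pt_comp _ _) t ≫ f)) := by
  refine IsNull.of_spanOf h ?_ hD
  rw [spanOf_addTop, spanOf_swap h t ht]
  exact SpanHom.isNull_add_pull_swapUL h _

end FanAddition

/-- `Q` and its transpose have the same corner `(0,0)`, so the identity there extends to a map of
squares. -/
lemma exists_swap {D : Prederivator.{w, v, u}} [D.IsStable] {Q : D.Diag Sq.{w}} (h : D.IsLoopSquare Q) :
    ∃ t : (D.restr (𝟭 _)).obj Q ⟶ (D.restr swapSq).obj Q,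
      pull (pt (sq 0 0)) (Functor.comp_id _) (π' := pt (sq 0 0)) (pt_comp _ _) t = 𝟙 _ := by
  refine (pull_bijective ?_ _ _).2 _
  have h' : D.IsSuspSquare ((D.restr (𝟭 _)).obj Q) := by
    rw [restr_id_obj]; exact h.isSuspSquare
  exact h'.bij_ev h.transpose.isSuspSquare

/-! ### Preadditivity -/

section Abstract

variable {E : Type*} [Category* E]

/-- `i, j : W ⟶ P` exhibit `P` as the coproduct of two copies of `W`. -/
def IsCopower {W P : E} (i j : W ⟶ P) : Prop :=
  ∀ Y : E, Function.Bijective (fun φ : P ⟶ Y => (i ≫ φ, j ≫ φ))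

lemma IsCopower.exists_desc {W P Y : E} {i j : W ⟶ P} (h : IsCopower i j) (f g : W ⟶ Y) :
    ∃ φ : P ⟶ Y, i ≫ φ = f ∧ j ≫ φ = g := by
  obtain ⟨φ, hφ⟩ := (h Y).2 (f, g)
  exact ⟨φ, congrArg Prod.fst hφ, congrArg Prod.snd hφ⟩

lemma IsCopower.hom_ext {W P Y : E} {i j : W ⟶ P} (h : IsCopower i j) {φ ψ : P ⟶ Y}
    (h1 : i ≫ φ = i ≫ ψ) (h2 : j ≫ φ = j ≫ ψ) : φ = ψ :=
  (h Y).1 (Prod.ext h1 h2)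

lemma isNull_zero [HasZeroObject E] [HasZeroMorphisms E] (X Y : E) : IsNull (0 : X ⟶ Y) := by
  obtain ⟨z, hz⟩ := HasZeroObject.zero (C := E)
  exact ⟨z, hz.from_ X, hz.to_ Y, hz, by simp [hz.eq_of_src (hz.to_ Y) 0]⟩

lemma IsNull.eq_zero [HasZeroMorphisms E] {X Y : E} {f : X ⟶ Y} (hf : IsNull f) : f = 0 := by
  obtain ⟨z, i, p, hz, rfl⟩ := hf
  simp [hz.eq_of_src p 0]

/-- An operation on the morphisms of a category which is natural and has null morphisms as units
and null sums, comes from a preadditive structure (Eckmann--Hilton). -/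
lemma nonempty_preadditive [HasZeroObject E]
    (m : ∀ {X Y : E}, (X ⟶ Y) → (X ⟶ Y) → (X ⟶ Y))
    (m_comp : ∀ {X Y Z : E} (f g : X ⟶ Y) (y : Y ⟶ Z), m (f ≫ y) (g ≫ y) = m f g ≫ y)
    (comp_m : ∀ {X Y Z : E} (x : X ⟶ Y) (f g : Y ⟶ Z), m (x ≫ f) (x ≫ g) = x ≫ m f g)
    (m_null : ∀ {X Y : E} (f : X ⟶ Y) {g : X ⟶ Y}, IsNull g → m f g = f)
    (null_m : ∀ {X Y : E} (f : X ⟶ Y) {g : X ⟶ Y}, IsNull g → m g f = f)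
    (neg : ∀ {X Y : E} (f : X ⟶ Y), ∃ g, IsNull (m f g))
    (copower : ∀ W : E, ∃ (P : E) (i j : W ⟶ P), IsCopower i j) : Nonempty (Preadditive E) := by
  let : HasZeroMorphisms E := HasZeroObject.zeroMorphismsOfZeroObject
  have mz : ∀ {X Y : E} (f : X ⟶ Y), m f 0 = f := fun f => m_null f (isNull_zero _ _)
  have zm : ∀ {X Y : E} (f : X ⟶ Y), m 0 f = f := fun f => null_m f (isNull_zero _ _)
  -- With `(a,b)` and `(c,d)` factored as `(i,j)` followed by `p` and by `q`, naturality on both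
  -- sides makes each member equal to `m i j ≫ m p q`.
  have interchange : ∀ {X Y : E} (a b c d : X ⟶ Y), m (m a b) (m c d) = m (m a c) (m b d) := by
    intro X Y a b c d
    obtain ⟨P, i, j, h⟩ := copower X
    obtain ⟨p, rfl, rfl⟩ := h.exists_desc a b
    obtain ⟨q, rfl, rfl⟩ := h.exists_desc c d
    rw [m_comp, m_comp, comp_m, comp_m, comp_m, m_comp]
  have comm : ∀ {X Y : E} (a b : X ⟶ Y), m a b = m b a := fun a b => by
    have := interchange 0 a b 0
    rwa [zm, mz, zm, mz] at this
  have assoc : ∀ {X Y : E} (a b c : X ⟶ Y), m (m a b) c = m a (m b c) := fun a b c => by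
    have := interchange a b 0 c
    rwa [zm, mz] at this
  choose n hn using @neg
  exact ⟨{
    homGroup := fun X Y =>
      letI : Add (X ⟶ Y) := ⟨m⟩
      letI : Neg (X ⟶ Y) := ⟨n⟩
      { add_assoc := assoc
        zero_add := zm
        add_zero := mz
        nsmul := nsmulRec
        zsmul := zsmulRec
        neg_add_cancel := fun f => (comm _ _).trans (hn f).eq_zero
        add_comm := comm }
    add_comp := fun _ _ _ f f' g => (m_comp f f' g).symm
    comp_add := fun _ _ _ f g g' => (comp_m f g g').symm }⟩

/-- It is enough to compute `m i j` for the two coprojections, and `𝟙 P = p ≫ i + q ≫ j` reduces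
this to the unit laws. Only naturality in the target is used, so the source `W` can stay fixed, and
the conclusion holds for every preadditive structure. -/
lemma eq_add_of_unital [HasZeroObject E] [Preadditive E] {W : E}
    (m : ∀ {Y : E}, (W ⟶ Y) → (W ⟶ Y) → (W ⟶ Y))
    (m_comp : ∀ {Y Z : E} (f g : W ⟶ Y) (y : Y ⟶ Z), m (f ≫ y) (g ≫ y) = m f g ≫ y)
    (m_null : ∀ {Y : E} (f : W ⟶ Y) {g : W ⟶ Y}, IsNull g → m f g = f)
    (null_m : ∀ {Y : E} (f : W ⟶ Y) {g : W ⟶ Y}, IsNull g → m g f = f)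
    (copower : ∃ (P : E) (i j : W ⟶ P), IsCopower i j) {Y : E} (f g : W ⟶ Y) :
    m f g = f + g := by
  obtain ⟨P, i, j, h⟩ := copower
  obtain ⟨p, hp1, hp2⟩ := h.exists_desc (𝟙 W) 0
  obtain ⟨q, hq1, hq2⟩ := h.exists_desc 0 (𝟙 W)
  have e : p ≫ i + q ≫ j = 𝟙 P := by
    apply h.hom_ext
    · simp [reassoc_of% hp1, reassoc_of% hq1]
    · simp [reassoc_of% hp2, reassoc_of% hq2]
  have hm : m i j = i + j := by
    rw [← Category.comp_id (m i j), ← e, Preadditive.comp_add, ← Category.assoc, ← Category.assoc,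
      ← m_comp i j p, ← m_comp i j q, hp1, hp2, hq1, hq2, m_null _ (isNull_zero _ _),
      null_m _ (isNull_zero _ _), Category.id_comp, Category.id_comp]
  obtain ⟨φ, rfl, rfl⟩ := h.exists_desc f g
  rw [m_comp, hm, Preadditive.add_comp]

end Abstract

/-- `W ⊔ W` is the left Kan extension to the point of the constant diagram on `𝟙 ⊔ 𝟙`; (Der1)
identifies the maps from that diagram to a constant one with pairs. -/
lemma exists_copower {D : Prederivator.{w, v, u}} [D.IsDerivator] (W : D.Diag OneCat.{w}) :
    ∃ (P : D.Diag OneCat.{w}) (i j : W ⟶ P), IsCopower i j := by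
  let S := Σ _ : ULift.{w} Bool, OneCat.{w}
  let V := (D.restr (toPt S)).obj W
  let P := (D.lan (toPt S)).obj V
  let c : ∀ (b : ULift.{w} Bool) {Y : D.Diag OneCat.{w}}, (V ⟶ (D.restr (toPt S)).obj Y) →
      (W ⟶ Y) := fun b Y φ => eqToHom (restr_toPt_oneCat W).symm ≫
        pull (Sigma.incl (C := fun _ => OneCat.{w}) b) (ε' := toPt OneCat.{w})
          (π' := toPt OneCat.{w}) rfl rfl φ ≫ eqToHom (restr_toPt_oneCat Y)
  have hc : ∀ (b : ULift.{w} Bool) {Y Y' : D.Diag OneCat.{w}}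
      (φ : V ⟶ (D.restr (toPt S)).obj Y) (y : Y ⟶ Y'),
      c b (φ ≫ (D.restr (toPt S)).map y) = c b φ ≫ y := by
    intro b Y Y' φ y
    have := restr_toPt_oneCat_map y
    rw [eqToHom_comp_iff] at this
    dsimp only [c]
    rw [pull_comp (π' := toPt OneCat.{w}) (ρ' := toPt OneCat.{w}) (hπ := rfl), pull_restr_map, this]
    simp
  have hb : ∀ Y : D.Diag OneCat.{w}, Function.Bijective
      (fun φ : V ⟶ (D.restr (toPt S)).obj Y => (c ⟨true⟩ φ, c ⟨false⟩ φ)) := by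
    intro Y
    have h1 := bijective_sigma (fun _ : ULift.{w} Bool => OneCat.{w}) V ((D.restr (toPt S)).obj Y)
    have h2 : ∀ b : ULift.{w} Bool, Function.Bijective
        (fun ψ : (D.restr (Sigma.incl (C := fun _ => OneCat.{w}) b)).obj V ⟶
          (D.restr (Sigma.incl (C := fun _ => OneCat.{w}) b)).obj ((D.restr (toPt S)).obj Y) =>
        (eqToHom (restr_toPt_oneCat W).symm ≫ (eqToHom (D.restr_obj_eq' rfl W).symm ≫ ψ ≫
          eqToHom (D.restr_obj_eq' rfl Y)) ≫ eqToHom (restr_toPt_oneCat Y) : W ⟶ Y)) := fun b =>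
      (bijective_eqToHom_conj _ _).comp (bijective_eqToHom_conj _ _)
    constructor
    · intro φ ψ h
      refine h1.1 (funext ?_)
      rintro ⟨b⟩
      cases b
      · exact (h2 _).1 (congrArg Prod.snd h)
      · exact (h2 _).1 (congrArg Prod.fst h)
    · rintro ⟨f, g⟩
      choose s hs using fun b => (h2 b).2
      obtain ⟨φ, hφ⟩ := h1.2 (fun b => match b with
        | ⟨true⟩ => s ⟨true⟩ f
        | ⟨false⟩ => s ⟨false⟩ g)
      refine ⟨φ, Prod.ext ?_ ?_⟩
      · refine Eq.trans ?_ (hs ⟨true⟩ f)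
        exact congrArg (fun ψ => _ ≫ (_ ≫ ψ ≫ _) ≫ _) (congrFun hφ ⟨true⟩)
      · refine Eq.trans ?_ (hs ⟨false⟩ g)
        exact congrArg (fun ψ => _ ≫ (_ ≫ ψ ≫ _) ≫ _) (congrFun hφ ⟨false⟩)
  refine ⟨P, c ⟨true⟩ ((D.lanAdj (toPt S)).unit.app V), c ⟨false⟩ ((D.lanAdj (toPt S)).unit.app V),
    fun Y => ?_⟩
  refine (congrArg Function.Bijective (funext fun φ => ?_)).mp
    ((hb Y).comp ((D.lanAdj (toPt S)).homEquiv V Y).bijective)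
  simp only [Function.comp, Adjunction.homEquiv_unit]
  exact Prod.ext (hc _ _ _) (hc _ _ _)

section Stable

variable {D : Prederivator.{w, v, u}} [D.IsStable]

lemma nonempty_preadditive_diag : Nonempty (Preadditive (D.Diag OneCat.{w})) := by
  have := IsStable.hasZeroObject (D := D)
  choose Q hQ e using exists_isLoopSquare (D := D)
  let e := fun W => (e W).some
  refine nonempty_preadditive (fun {X Y} f g => (e X).inv ≫ addTop (hQ X) ((e X).hom ≫ f)
    ((e X).hom ≫ g)) ?_ ?_ ?_ ?_ ?_ exists_copower
  · intro X Y Z f g y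
    rw [← Category.assoc, ← Category.assoc, addTop_comp, Category.assoc]
  · intro X Y Z x f g
    -- Any `x : X ⟶ Y` lifts to a map of the chosen squares, so naturality for maps of squares gives
    -- naturality in all of `D(𝟙)`.
    obtain ⟨q, hq⟩ := ((hQ X).bij_ev₁₁ (hQ Y)).2 ((e X).hom ≫ x ≫ (e Y).inv)
    have h : (e X).hom ≫ x = (D.ev (sq 1 1)).map q ≫ (e Y).hom := by simp [hq]
    rw [← Category.assoc, ← Category.assoc, h, Category.assoc, Category.assoc,
      comp_addTop (hQ X) (hQ Y), ← Category.assoc, ← Category.assoc x, ← (e X).inv_hom_id_assoc x, h]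
    simp
  · intro X Y f g hg
    rw [addTop_null _ _ (hg.comp' _)]
    simp
  · intro X Y f g hg
    rw [null_addTop _ _ (hg.comp' _)]
    simp
  · intro X Y f
    obtain ⟨t, ht⟩ := exists_swap (hQ X)
    refine ⟨(e X).inv ≫ pull (pt (sq 1 1)) (Functor.comp_id _) (pt_comp _ _) t ≫ (e X).hom ≫ f, ?_⟩
    rw [Iso.hom_inv_id_assoc]
    exact (isNull_addTop (hQ X) this t ht _).comp' _

/-- The path sum of `𝟙` and its image under the transposition is null, and that sum is the given
addition. -/
lemma pull_swap_eq_neg [Preadditive (D.Diag OneCat.{w})] {Q : D.Diag Sq.{w}}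
    (h : D.IsLoopSquare Q) (t : (D.restr (𝟭 _)).obj Q ⟶ (D.restr swapSq).obj Q)
    (ht : pull (pt (sq 0 0)) (Functor.comp_id _) (π' := pt (sq 0 0)) (pt_comp _ _) t = 𝟙 _) :
    pull (pt (sq 1 1)) (Functor.comp_id _) (π' := pt (sq 1 1)) (pt_comp _ _) t = -𝟙 _ := by
  have := IsStable.hasZeroObject (D := D)
  have h1 : addTop h (𝟙 _) (pull (pt (sq 1 1)) (Functor.comp_id _) (π' := pt (sq 1 1))
      (pt_comp _ _) t ≫ 𝟙 _) = 0 := (isNull_addTop h this t ht (𝟙 _)).eq_zero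
  rw [eq_add_of_unital (addTop h) (addTop_comp h) (addTop_null h) (null_addTop h)
    (exists_copower _), Category.comp_id] at h1
  exact (neg_eq_of_add_eq_zero_right h1).symm

end Stable

/-! ### Squares in the opposite derivator -/

section Opposite

variable {D : Prederivator.{w, v, u}}

/-- Dualizing exchanges the source and the target, hence left and right Kan extension properties. -/
lemma opposite_bij_iff {A B : Type w} [SmallCategory A] [SmallCategory B] (f : A ⥤ B)
    (X Z : D.Diag Bᵒᵖ) :
    D.opposite.Bij f (op X) (op Z) ↔ D.Bij f.op Z X := by
  have h1 : Function.Bijective (fun φ : (op X : (D.Diag Bᵒᵖ)ᵒᵖ) ⟶ op Z => Quiver.Hom.unop φ) :=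
    ⟨Quiver.Hom.unop_inj, fun φ => ⟨φ.op, rfl⟩⟩
  have h2 : Function.Bijective (fun φ : (D.restr f.op).obj Z ⟶ (D.restr f.op).obj X =>
      Quiver.Hom.op φ) := ⟨Quiver.Hom.op_inj, fun φ => ⟨φ.unop, rfl⟩⟩
  exact (Function.Bijective.of_comp_iff' h2
    ((fun φ : Z ⟶ X => (D.restr f.op).map φ) ∘ (fun φ => Quiver.Hom.unop φ))).trans
      (Function.Bijective.of_comp_iff _ h1)

/-- The inverse of `flipSq`. -/
def flipSqInv : Sq.{w} ⥤ Sq.{w}ᵒᵖ where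
  obj p := op (sq p.down.2.rev p.down.1.rev)
  map {p q} m := (homOfLE (x := sq q.down.2.rev q.down.1.rev) (y := sq p.down.2.rev p.down.1.rev)
    (Prod.mk_le_mk.2 ⟨Fin.rev_le_rev.mpr (leOfHom m).2, Fin.rev_le_rev.mpr (leOfHom m).1⟩)).op

lemma flipSq_comp_flipSqInv : flipSq.{w} ⋙ flipSqInv = 𝟭 _ :=
  functor_ext_of_isThin fun x => by
    obtain ⟨x⟩ := x
    induction x using sq_cases <;> rfl

lemma flipSqInv_comp_flipSq : flipSqInv.{w} ⋙ flipSq = 𝟭 _ :=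
  functor_ext_of_isThin fun x => by induction x using sq_cases <;> rfl

instance : (D.restr flipSq).IsEquivalence :=
  D.isEquivalence_restr_of_inverse flipSq_comp_flipSqInv flipSqInv_comp_flipSq

lemma exists_flipSq (Z : D.Diag Sq.{w}ᵒᵖ) : ∃ Z', (D.restr flipSq).obj Z' = Z :=
  ⟨(D.restr flipSqInv).obj Z, by rw [← restr_comp_obj, flipSq_comp_flipSqInv, restr_id_obj]⟩

/-- The isomorphism `⌜ᵒᵖ ⥤ ⌟` induced by `flipSq`. -/
def flipUL : UL.{w}ᵒᵖ ⥤ LR.{w} where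
  obj p := ⟨flipSq.obj (op p.unop.1), by
    obtain ⟨p⟩ := p
    induction p using ul_cases <;> (intro h; exact absurd (congrArg ULift.down h) (by decide))⟩
  map m := homOfLE (leOfHom (flipSq.map (inclUL.map m.unop).op))

/-- The inverse of `flipUL`. -/
def flipULInv : LR.{w} ⥤ UL.{w}ᵒᵖ where
  obj p := op ⟨(flipSqInv.obj p.1).unop, by
    obtain ⟨p, hp⟩ := p
    revert hp
    induction p using sq_cases <;>
      first
      | exact fun hp => absurd rfl hp
      | exact fun _ h => absurd (congrArg ULift.down h) (show ¬ ((0, 1) : Fin 2 × Fin 2) = _ by decide)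
      | exact fun _ h => absurd (congrArg ULift.down h) (show ¬ ((1, 0) : Fin 2 × Fin 2) = _ by decide)
      | exact fun _ h =>
          absurd (congrArg ULift.down h) (show ¬ ((0, 0) : Fin 2 × Fin 2) = _ by decide)⟩
  map m := (homOfLE (leOfHom (flipSqInv.map (inclLR.map m)).unop)).op

lemma flipUL_comp_flipULInv : flipUL.{w} ⋙ flipULInv = 𝟭 _ :=
  functor_ext_of_isThin fun x => by
    obtain ⟨x⟩ := x
    induction x using ul_cases <;> rfl

lemma flipULInv_comp_flipUL : flipULInv.{w} ⋙ flipUL = 𝟭 _ :=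
  functor_ext_of_isThin fun ⟨x, hx⟩ => by
    revert hx
    induction x using sq_cases <;> exact fun _ => rfl

instance : (D.restr flipUL).IsEquivalence :=
  D.isEquivalence_restr_of_inverse flipUL_comp_flipULInv flipULInv_comp_flipUL

lemma exists_flipUL (V : D.Diag UL.{w}ᵒᵖ) : ∃ V', (D.restr flipUL).obj V' = V :=
  ⟨(D.restr flipULInv).obj V, by rw [← restr_comp_obj, flipUL_comp_flipULInv, restr_id_obj]⟩

lemma inclUL_op_comp_flipSq : inclUL.{w}.op ⋙ flipSq = flipUL ⋙ inclLR := rfl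

/-- The isomorphism `𝟙ᵒᵖ ⥤ 𝟙`. -/
abbrev flipOne : OneCat.{w}ᵒᵖ ⥤ OneCat.{w} := (Functor.const _).obj ⟨⟨⟩⟩

lemma flipOne_comp : flipOne.{w} ⋙ (Functor.const _).obj (op ⟨⟨⟩⟩) = 𝟭 _ :=
  functor_ext_of_isThin fun _ => rfl

lemma comp_flipOne : (Functor.const _).obj (op ⟨⟨⟩⟩) ⋙ flipOne.{w} = 𝟭 _ :=
  functor_ext_of_isThin fun _ => rfl

instance : (D.restr flipOne).IsEquivalence :=
  D.isEquivalence_restr_of_inverse flipOne_comp comp_flipOne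

instance : D.toOpposite.IsEquivalence :=
  inferInstanceAs (D.restr flipOne).op.IsEquivalence

lemma cornerUL_op_comp_flipUL : cornerUL.{w}.op ⋙ flipUL = flipOne ⋙ cornerLR :=
  functor_ext_of_isThin fun _ => rfl

lemma opposite_bij_flip_iff (Q Z : D.Diag Sq.{w}) :
    D.opposite.Bij inclUL (D.flip Q) (D.flip Z) ↔ D.Bij inclLR Z Q :=
  (opposite_bij_iff _ _ _).trans (Bij.transport inclUL_op_comp_flipSq).symm

lemma IsLoopSquare.isSuspSquare_flip [D.IsDerivator] {Q : D.Diag Sq.{w}} (h : D.IsLoopSquare Q) :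
    D.opposite.IsSuspSquare (D.flip Q) where
  bij_incl Z := by
    obtain ⟨Z⟩ := Z
    obtain ⟨Z, rfl⟩ := exists_flipSq Z
    exact (opposite_bij_flip_iff Q Z).2 (h.bij_inclLR Z)
  bij_corner V := by
    obtain ⟨V⟩ := V
    refine (opposite_bij_iff cornerUL V ((D.restr inclUL.op).obj ((D.restr flipSq).obj Q))).2 ?_
    rw [← restr_comp_obj, inclUL_op_comp_flipSq, restr_comp_obj]
    obtain ⟨V, rfl⟩ := exists_flipUL V
    exact (Bij.transport cornerUL_op_comp_flipUL).1 (h.bij_cornerLR V)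

lemma opposite_isCocartesian_iff [D.IsDerivator] (Q : D.Diag Sq.{w}) :
    D.opposite.IsCocartesian (D.flip Q) ↔ D.IsCartesian Q := by
  rw [isCartesian_iff]
  constructor
  · intro h Z
    -- Here the chosen Kan extensions have to be compared: the essential image is moved to `D`,
    -- where the derivator axioms make the right Kan extension fully faithful.
    have e : D.opposite.lan inclUL ≅ (D.ran inclUL.op).op :=
      (D.opposite.lanAdj inclUL).leftAdjointUniq (D.ranAdj inclUL.op).op
    have h' : (D.ran inclUL.op).op.essImage (D.flip Q) := by
      obtain ⟨W, ⟨i⟩⟩ := h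
      exact ⟨W, ⟨(e.app W).symm ≪≫ i⟩⟩
    obtain ⟨W, ⟨i⟩⟩ := h'
    exact (opposite_bij_flip_iff Q Z).1 ((opposite_bij_iff _ _ _).2
      (bij_of_mem_essImage_ran ⟨W.unop, ⟨i.unop.symm⟩⟩ _))
  · intro h
    refine isCocartesian_of_bij fun Z => ?_
    obtain ⟨Z⟩ := Z
    obtain ⟨Z, rfl⟩ := exists_flipSq Z
    exact (opposite_bij_flip_iff Q Z).2 (h Z)

end Opposite

/-! ### Triangles with a chosen bicartesian square -/

section

variable {D : Prederivator.{w, v, u}}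

lemma mapIso_surjective {E E' : Type*} [Category* E] [Category* E'] (F : E ⥤ E') [F.Full]
    [F.Faithful] {X Y : E} : Function.Surjective (F.mapIso (X := X) (Y := Y)) :=
  fun e => ⟨F.preimageIso e, by ext; simp⟩

lemma exists_iso_of_bij {A B : Type w} [SmallCategory A] [SmallCategory B] {f : A ⥤ B}
    {X Z : D.Diag B} (hXX : D.Bij f X X) (hXZ : D.Bij f X Z) (hZX : D.Bij f Z X)
    (hZZ : D.Bij f Z Z) (a : (D.restr f).obj X ≅ (D.restr f).obj Z) :
    ∃ u : X ≅ Z, (D.restr f).map u.hom = a.hom := by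
  obtain ⟨k, hk⟩ := hXZ.2 a.hom
  obtain ⟨l, hl⟩ := hZX.2 a.inv
  dsimp only at hk hl
  exact ⟨⟨k, l, hXX.1 (by simp [hk, hl]), hZZ.1 (by simp [hk, hl])⟩, hk⟩

variable (D) in
/-- The morphism of squares in the opposite derivator given by a morphism of squares. -/
def flipMap {Q Q' : D.Diag Sq.{w}} (q : Q ⟶ Q') : D.flip Q' ⟶ D.flip Q :=
  ((D.restr flipSq).map q).op

lemma flipMap_ev {Q Q' : D.Diag Sq.{w}} (q : Q ⟶ Q') (i j : Fin 2) :
    (D.opposite.ev (sq i j)).map (D.flipMap q) = eqToHom (D.flip_ev Q' i j) ≫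
      D.toOpposite.map ((D.ev (sq j.rev i.rev)).map q).op ≫ eqToHom (D.flip_ev Q i j).symm := by
  have h : (D.restr (pt (sq i j)).op).map ((D.restr flipSq).map q) =
      eqToHom (D.restr_obj_eq (p := (pt (sq i j)).op) (f := flipSq) (q := flipOne)
          (g := pt (sq j.rev i.rev)) rfl Q) ≫
        (D.restr flipOne).map ((D.ev (sq j.rev i.rev)).map q) ≫
          eqToHom (D.restr_obj_eq (p := (pt (sq i j)).op) (f := flipSq) (q := flipOne)
            (g := pt (sq j.rev i.rev)) rfl Q').symm := by
    rw [restr_map_map, restr_map_map]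
    simp
    rfl
  have := congrArg Quiver.Hom.op h
  rw [op_comp, op_comp, eqToHom_op, eqToHom_op, Category.assoc] at this
  exact this

variable [D.IsDerivator]

/-- The canonical morphism `Q_{11} ⟶ Σ Q_{00}`. -/
noncomputable def IsLoopSquare.comparison {Q : D.Diag Sq.{w}} (h : D.IsLoopSquare Q) :
    (D.ev (sq 1 1)).obj Q ⟶ D.susp.obj ((D.ev (sq 0 0)).obj Q) :=
  h.isSuspSquare.exists_comparison.choose

lemma IsLoopSquare.isSuspComparison {Q : D.Diag Sq.{w}} (h : D.IsLoopSquare Q) :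
    D.IsSuspComparison Q h.comparison :=
  h.isSuspSquare.exists_comparison.choose_spec

instance {Q : D.Diag Sq.{w}} (h : D.IsLoopSquare Q) : IsIso h.comparison :=
  h.isSuspSquare.isIso_comparison h.isSuspComparison

/-- The canonical morphism in the opposite derivator from the desuspension of `Q_{11}` to
`Q_{00}`. -/
noncomputable def IsLoopSquare.flipComparison {Q : D.Diag Sq.{w}} (h : D.IsLoopSquare Q) :
    (D.opposite.ev (sq 1 1)).obj (D.flip Q) ⟶
      D.opposite.susp.obj ((D.opposite.ev (sq 0 0)).obj (D.flip Q)) :=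
  h.isSuspSquare_flip.exists_comparison.choose

lemma IsLoopSquare.isSuspComparison_flip {Q : D.Diag Sq.{w}} (h : D.IsLoopSquare Q) :
    D.opposite.IsSuspComparison (D.flip Q) h.flipComparison :=
  h.isSuspSquare_flip.exists_comparison.choose_spec

instance {Q : D.Diag Sq.{w}} (h : D.IsLoopSquare Q) : IsIso h.flipComparison :=
  h.isSuspSquare_flip.isIso_comparison h.isSuspComparison_flip

/-- `flipComparison`, in terms of objects of `D(𝟙)`. -/
noncomputable def IsLoopSquare.opComparison {Q : D.Diag Sq.{w}} (h : D.IsLoopSquare Q) :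
    D.toOpposite.obj (op ((D.ev (sq 0 0)).obj Q)) ⟶
      D.opposite.susp.obj (D.toOpposite.obj (op ((D.ev (sq 1 1)).obj Q))) :=
  eqToHom (D.flip_ev Q 1 1).symm ≫ h.flipComparison ≫
    D.opposite.susp.map (eqToHom (D.flip_ev Q 0 0))

instance {Q : D.Diag Sq.{w}} (h : D.IsLoopSquare Q) : IsIso h.opComparison := by
  unfold IsLoopSquare.opComparison
  infer_instance

lemma IsLoopSquare.opComparison_naturality {Q Q' : D.Diag Sq.{w}} (h : D.IsLoopSquare Q)
    (h' : D.IsLoopSquare Q') (q : Q ⟶ Q') :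
    D.toOpposite.map ((D.ev (sq 0 0)).map q).op ≫ h.opComparison =
      h'.opComparison ≫ D.opposite.susp.map (D.toOpposite.map ((D.ev (sq 1 1)).map q).op) := by
  have := h'.isSuspSquare_flip.comparison_naturality (D.flipMap q) h'.isSuspComparison_flip
    h.isSuspComparison_flip
  rw [flipMap_ev, flipMap_ev, Functor.map_comp, Functor.map_comp, Category.assoc, Category.assoc,
    eqToHom_comp_iff] at this
  have e := congrArg (fun t => t ≫ D.opposite.susp.map (eqToHom (D.flip_ev Q 0 0))) this
  simp only [Category.assoc, ← Functor.map_comp, eqToHom_trans, eqToHom_refl,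
    Category.comp_id] at e
  rw [IsLoopSquare.opComparison, IsLoopSquare.opComparison]
  refine e.trans ?_
  simp only [Functor.map_comp, Category.assoc]
  rfl

variable (D) in
/-- Diagrams `Q_{00} ⟶ y ⟶ z ⟶ Q_{11}`, where `Q` is a bicartesian square with two zero corners. -/
structure LoopTriangle where
  Q : D.Diag Sq.{w}
  isLoopSquare : D.IsLoopSquare Q
  {y z : D.Diag OneCat.{w}}
  f : (D.ev (sq 0 0)).obj Q ⟶ y
  g : y ⟶ z
  h : z ⟶ (D.ev (sq 1 1)).obj Q

namespace LoopTriangle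

/-- The triangle of `D(𝟙)`. -/
noncomputable def toTriangle (S : D.LoopTriangle) : D.Triangle where
  f := S.f
  g := S.g
  h := S.h ≫ S.isLoopSquare.comparison

/-- The triangle of `Dᵒᵖ(𝟙)`. -/
noncomputable def toOppositeTriangle (S : D.LoopTriangle) : D.opposite.Triangle where
  f := D.toOpposite.map S.h.op
  g := D.toOpposite.map S.g.op
  h := D.toOpposite.map S.f.op ≫ S.isLoopSquare.opComparison

/-- Isomorphic diagrams. -/
def Iso (S T : D.LoopTriangle) : Prop :=
  ∃ (u : S.Q ≅ T.Q) (b : S.y ≅ T.y) (c : S.z ≅ T.z),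
    S.f ≫ b.hom = (D.ev (sq 0 0)).map u.hom ≫ T.f ∧ S.g ≫ c.hom = b.hom ≫ T.g ∧
      S.h ≫ (D.ev (sq 1 1)).map u.hom = c.hom ≫ T.h

lemma comparison_naturality {S T : D.LoopTriangle} (u : S.Q ⟶ T.Q) :
    (D.ev (sq 1 1)).map u ≫ T.isLoopSquare.comparison =
      S.isLoopSquare.comparison ≫ D.susp.map ((D.ev (sq 0 0)).map u) :=
  S.isLoopSquare.isSuspSquare.comparison_naturality u S.isLoopSquare.isSuspComparison
    T.isLoopSquare.isSuspComparison

/-- An isomorphism of the corners `(0,0)` lifts to the squares, and naturality of the comparison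
identifies its value at `(1,1)` with `Σ` of the given map. For the opposite triangles the same is
done from the corner `(1,1)`. -/
lemma toTriangle_iso_iff (S T : D.LoopTriangle) : S.toTriangle.Iso T.toTriangle ↔ S.Iso T := by
  constructor
  · rintro ⟨a, b, c, hf, hg, hh⟩
    have hS := S.isLoopSquare.isSuspSquare
    have hT := T.isLoopSquare.isSuspSquare
    obtain ⟨u, hu⟩ := exists_iso_of_bij (hS.bij_ev hS) (hS.bij_ev hT) (hT.bij_ev hS)
      (hT.bij_ev hT) a
    refine ⟨u, b, c, hf.trans (congrArg (fun t => t ≫ T.f) hu.symm), hg, ?_⟩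
    rw [← cancel_mono T.isLoopSquare.comparison, Category.assoc, comparison_naturality]
    refine Eq.trans ?_ (hh.trans (Category.assoc _ _ _).symm)
    refine (Category.assoc _ _ _).symm.trans ?_
    exact congrArg (fun t => (S.h ≫ S.isLoopSquare.comparison) ≫ D.susp.map t) hu
  · rintro ⟨u, b, c, hf, hg, hh⟩
    refine ⟨(D.ev (sq 0 0)).mapIso u, b, c, hf, hg, ?_⟩
    change (S.h ≫ _) ≫ D.susp.map ((D.ev (sq 0 0)).map u.hom) = c.hom ≫ T.h ≫ _
    rw [Category.assoc, ← comparison_naturality, reassoc_of% hh]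

lemma Iso.symm {S T : D.LoopTriangle} (h : S.Iso T) : T.Iso S := by
  obtain ⟨u, b, c, hf, hg, hh⟩ := h
  refine ⟨u.symm, b.symm, c.symm, ?_, ?_, ?_⟩
  · have := ((D.ev (sq 0 0)).mapIso u).eq_inv_comp.2 hf.symm
    exact (Iso.comp_inv_eq b).2 (this.trans (Category.assoc _ _ _).symm)
  · exact (Iso.comp_inv_eq c).2 (((Iso.eq_inv_comp b).2 hg.symm).trans (Category.assoc _ _ _).symm)
  · exact (Iso.comp_inv_eq ((D.ev (sq 1 1)).mapIso u)).2
      (((Iso.eq_inv_comp c).2 hh.symm).trans (Category.assoc _ _ _).symm)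

lemma toOppositeTriangle_iso_iff (S T : D.LoopTriangle) :
    S.toOppositeTriangle.Iso T.toOppositeTriangle ↔ T.Iso S := by
  constructor
  · rintro ⟨a, b, c, hf, hg, hh⟩
    obtain ⟨a, rfl⟩ := mapIso_surjective D.toOpposite a
    obtain ⟨b, rfl⟩ := mapIso_surjective D.toOpposite b
    obtain ⟨c, rfl⟩ := mapIso_surjective D.toOpposite c
    have hS := S.isLoopSquare
    have hT := T.isLoopSquare
    obtain ⟨u, hu⟩ := exists_iso_of_bij (hT.bij_ev₁₁ hT) (hT.bij_ev₁₁ hS) (hS.bij_ev₁₁ hT)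
      (hS.bij_ev₁₁ hS) a.unop
    dsimp only [toOppositeTriangle, Functor.mapIso_hom] at hf hg hh
    rw [← Functor.map_comp, ← Functor.map_comp] at hf hg
    replace hf := congrArg Quiver.Hom.unop (D.toOpposite.map_injective hf)
    replace hg := congrArg Quiver.Hom.unop (D.toOpposite.map_injective hg)
    refine ⟨u, c.unop, b.unop, ?_, hg.symm, ?_⟩
    · have e : a.hom = ((D.ev (sq 1 1)).map u.hom).op := congrArg Quiver.Hom.op hu.symm
      rw [e, Category.assoc, ← hT.opComparison_naturality hS, ← Category.assoc, ← Category.assoc,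
        cancel_mono, ← Functor.map_comp, ← Functor.map_comp] at hh
      exact (congrArg Quiver.Hom.unop (D.toOpposite.map_injective hh)).symm
    · exact (congrArg (fun t => T.h ≫ t) hu).trans hf.symm
  · rintro ⟨u, b, c, hf, hg, hh⟩
    refine ⟨D.toOpposite.mapIso ((D.ev (sq 1 1)).mapIso u).op, D.toOpposite.mapIso c.op,
      D.toOpposite.mapIso b.op, ?_, ?_, ?_⟩
    · dsimp only [toOppositeTriangle, Functor.mapIso_hom]
      rw [← Functor.map_comp, ← Functor.map_comp]
      exact congrArg (fun t => D.toOpposite.map (Quiver.Hom.op t)) hh.symm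
    · dsimp only [toOppositeTriangle, Functor.mapIso_hom]
      rw [← Functor.map_comp, ← Functor.map_comp]
      exact congrArg (fun t => D.toOpposite.map (Quiver.Hom.op t)) hg.symm
    · change (_ ≫ _) ≫ D.opposite.susp.map (D.toOpposite.map ((D.ev (sq 1 1)).map u.hom).op) =
        D.toOpposite.map b.hom.op ≫ D.toOpposite.map T.f.op ≫ T.isLoopSquare.opComparison
      rw [Category.assoc, ← T.isLoopSquare.opComparison_naturality S.isLoopSquare,
        ← Category.assoc, ← Category.assoc, ← Functor.map_comp, ← Functor.map_comp]
      exact congrArg (fun t => D.toOpposite.map (Quiver.Hom.op t) ≫ _) hf.symm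

lemma toTriangle_iso_iff_toOppositeTriangle_iso (S T : D.LoopTriangle) :
    S.toTriangle.Iso T.toTriangle ↔ S.toOppositeTriangle.Iso T.toOppositeTriangle := by
  rw [toTriangle_iso_iff, toOppositeTriangle_iso_iff]
  exact ⟨Iso.symm, Iso.symm⟩

end LoopTriangle

/-- The comparison morphisms are unique, so they need not be part of the data. -/
lemma Triangle.correspondsTo_iff (T : D.Triangle) (T' : D.opposite.Triangle) :
    T.CorrespondsTo T' ↔ ∃ S : D.LoopTriangle, T.Iso S.toTriangle ∧ T'.Iso S.toOppositeTriangle := by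
  constructor
  · rintro ⟨Q, φ, ψ, y, z, f, g, h, h01, h10, hc, hc', hφ, hψ, hT, hT'⟩
    have hQ : D.IsLoopSquare Q := ⟨h01, h10, hc, hc'⟩
    obtain rfl := hQ.isSuspSquare.comparison_unique hφ hQ.isSuspComparison
    obtain rfl := hQ.isSuspSquare_flip.comparison_unique hψ hQ.isSuspComparison_flip
    exact ⟨⟨Q, hQ, f, g, h⟩, hT, hT'⟩
  · rintro ⟨⟨Q, hQ, f, g, h⟩, hT, hT'⟩
    exact ⟨Q, _, _, _, _, f, g, h, hQ.isZero₀₁, hQ.isZero₁₀, hQ.isCocartesian, hQ.isCartesian,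
      hQ.isSuspComparison, hQ.isSuspComparison_flip, hT, hT'⟩

end

/-! ### Isomorphism of triangles is an equivalence relation -/

section

variable {D : Prederivator.{w, v, u}} [D.HasKan]

lemma Triangle.Iso.refl (T : D.Triangle) : T.Iso T :=
  ⟨CategoryTheory.Iso.refl _, CategoryTheory.Iso.refl _, CategoryTheory.Iso.refl _, by simp, by simp,
    by simp⟩

lemma Triangle.Iso.symm {S T : D.Triangle} (h : S.Iso T) : T.Iso S := by
  obtain ⟨a, b, c, hf, hg, hh⟩ := h
  refine ⟨a.symm, b.symm, c.symm, ?_, ?_, ?_⟩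
  · exact (CategoryTheory.Iso.comp_inv_eq b).2
      (((CategoryTheory.Iso.eq_inv_comp a).2 hf.symm).trans (Category.assoc _ _ _).symm)
  · exact (CategoryTheory.Iso.comp_inv_eq c).2
      (((CategoryTheory.Iso.eq_inv_comp b).2 hg.symm).trans (Category.assoc _ _ _).symm)
  · exact (CategoryTheory.Iso.comp_inv_eq (D.susp.mapIso a)).2
      (((CategoryTheory.Iso.eq_inv_comp c).2 hh.symm).trans (Category.assoc _ _ _).symm)

lemma Triangle.Iso.trans {R S T : D.Triangle} (h : R.Iso S) (h' : S.Iso T) : R.Iso T := by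
  obtain ⟨a, b, c, hf, hg, hh⟩ := h
  obtain ⟨a', b', c', hf', hg', hh'⟩ := h'
  exact ⟨a ≪≫ a', b ≪≫ b', c ≪≫ c', by simp [reassoc_of% hf, hf'], by simp [reassoc_of% hg, hg'],
    by simp [reassoc_of% hh, hh']⟩

end

/-! ### Cofiber sequences in the opposite derivator -/

section Reversal

/-- The isomorphism `(𝟚 × 𝟛)ᵒᵖ ⥤ 𝟚 × 𝟛`. -/
def revRect : Rect.{w}ᵒᵖ ⥤ Rect.{w} where
  obj p := rect p.unop.down.1.rev p.unop.down.2.rev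
  map m := homOfLE
    ⟨Fin.rev_le_rev.mpr (leOfHom m.unop).1, Fin.rev_le_rev.mpr (leOfHom m.unop).2⟩

/-- The inverse of `revRect`. -/
def revRectInv : Rect.{w} ⥤ Rect.{w}ᵒᵖ where
  obj p := op (rect p.down.1.rev p.down.2.rev)
  map {p q} m := (homOfLE (x := rect q.down.1.rev q.down.2.rev)
    (y := rect p.down.1.rev p.down.2.rev)
    (Prod.mk_le_mk.2 ⟨Fin.rev_le_rev.mpr (leOfHom m).1, Fin.rev_le_rev.mpr (leOfHom m).2⟩)).op

lemma revRect_comp_revRectInv : revRect.{w} ⋙ revRectInv = 𝟭 _ :=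
  functor_ext_of_isThin fun x => by
    obtain ⟨x⟩ := x
    induction x using rect_cases <;> rfl

variable (D : Prederivator.{w, v, u})

/-- A coherent diagram of shape `𝟚 × 𝟛` in `D`, viewed in `Dᵒᵖ` through `revRect`. -/
def rev (Y : D.Diag Rect.{w}) : D.opposite.Diag Rect.{w} := op ((D.restr revRect).obj Y)

lemma exists_rev (X : D.opposite.Diag Rect.{w}) : ∃ Y, D.rev Y = X := by
  have (X : D.Diag Rect.{w}ᵒᵖ) : (D.restr revRect).obj ((D.restr revRectInv).obj X) = X := by
    rw [← restr_comp_obj, revRect_comp_revRectInv, restr_id_obj]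
  exact ⟨(D.restr revRectInv).obj X.unop, congrArg op (this _)⟩

lemma rev_ev (Y : D.Diag Rect.{w}) (i : Fin 2) (j : Fin 3) :
    (D.opposite.ev (rect i j)).obj (D.rev Y) =
      D.toOpposite.obj (op ((D.ev (rect i.rev j.rev)).obj Y)) :=
  congrArg op (D.restr_obj_eq (p := (pt (rect i j)).op) (f := revRect) (q := flipOne)
    (g := pt (rect i.rev j.rev)) rfl Y)

lemma evMap_rev (Y : D.Diag Rect.{w}) {i i' : Fin 2} {j j' : Fin 3} (m : rect i j ⟶ rect i' j')
    (m' : rect i'.rev j'.rev ⟶ rect i.rev j.rev) :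
    D.opposite.evMap (D.rev Y) m = eqToHom (D.rev_ev Y i j) ≫
      D.toOpposite.map (D.evMap Y m').op ≫ eqToHom (D.rev_ev Y i' j').symm := by
  have h : ∀ α : (pt (rect i' j')).op ⟶ (pt (rect i j)).op,
      (D.restrMap α).app ((D.restr revRect).obj Y) =
      eqToHom (D.restr_obj_eq (p := (pt (rect i' j')).op) (f := revRect) (q := flipOne)
          (g := pt (rect i'.rev j'.rev)) rfl Y) ≫
        (D.restr flipOne).map (D.evMap Y m') ≫
          eqToHom (D.restr_obj_eq (p := (pt (rect i j)).op) (f := revRect) (q := flipOne)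
            (g := pt (rect i.rev j.rev)) rfl Y).symm := by
    intro α
    rw [restrMap_app_restr, evMap, restr_map_restrMap, D.restrMap_app_congr_of_isThin
      (Functor.whiskerRight α revRect) (Functor.whiskerLeft flipOne
        (Discrete.natTrans (fun _ => m') : pt (rect i'.rev j'.rev) ⟶ pt (rect i.rev j.rev))) rfl rfl]
    simp
  have := congrArg Quiver.Hom.op (h (NatTrans.op (Discrete.natTrans (fun _ => m))))
  rw [op_comp, op_comp, eqToHom_op, eqToHom_op, Category.assoc] at this
  exact this

lemma isZero_of_isZero_obj {E E' : Type*} [Category* E] [Category* E'] (F : E ⥤ E') [F.Full]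
    [F.Faithful] {X : E} (h : IsZero (F.obj X)) : IsZero X where
  unique_to _ := ⟨⟨⟨F.preimage (h.to_ _)⟩, fun _ => F.map_injective (h.eq_of_src _ _)⟩⟩
  unique_from _ := ⟨⟨⟨F.preimage (h.from_ _)⟩, fun _ => F.map_injective (h.eq_of_tgt _ _)⟩⟩

lemma isZero_rev_iff [D.IsDerivator] (Y : D.Diag Rect.{w}) (i : Fin 2) (j : Fin 3) :
    IsZero ((D.opposite.ev (rect i j)).obj (D.rev Y)) ↔
      IsZero ((D.ev (rect i.rev j.rev)).obj Y) := by
  rw [rev_ev]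
  exact ⟨fun h => (isZero_of_isZero_obj D.toOpposite h).unop,
    fun h => (isZero_restr flipOne h).op⟩

/-- This is the origin of the sign: the reversal `(i,j) ↦ (1-i,1-j)` and `flipSq` differ by the
transposition of `□`. -/
lemma restr_iota_rev (Y : D.Diag Rect.{w}) {j k : Fin 3} (h : j ≤ k) (h' : k.rev ≤ j.rev) :
    (D.opposite.restr (iota j k h)).obj (D.rev Y) =
      D.flip (D.transpose ((D.restr (iota k.rev j.rev h')).obj Y)) := by
  have : (D.restr (iota j k h).op).obj ((D.restr revRect).obj Y) =
      (D.restr flipSq).obj ((D.restr swapSq).obj ((D.restr (iota k.rev j.rev h')).obj Y)) := by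
    rw [← restr_comp_obj, ← restr_comp_obj, ← restr_comp_obj]
    refine D.restr_congr_obj (functor_ext_of_isThin fun x => ?_) Y
    obtain ⟨x⟩ := x
    induction x using sq_cases <;> rfl
  exact congrArg op this

lemma opposite_outer_rev (Y : D.Diag Rect.{w}) :
    D.opposite.outer (D.rev Y) = D.flip (D.transpose (D.outer Y)) :=
  D.restr_iota_rev Y _ _

variable {D} in
-- The reversal exchanges the two squares and the two zero entries. Cocartesian squares become
-- cartesian, which is harmless by stability, as is the transposition.
lemma isCofiberSequence_rev_iff [D.IsStable] (Y : D.Diag Rect.{w}) :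
    D.opposite.IsCofiberSequence (D.rev Y) ↔ D.IsCofiberSequence Y := by
  have hc : ∀ Q : D.Diag Sq.{w}, D.opposite.IsCocartesian (D.flip (D.transpose Q)) ↔
      D.IsCocartesian Q := fun Q => by
    rw [opposite_isCocartesian_iff, IsStable.isCartesian_iff]
    refine ⟨fun h => ?_, isCocartesian_transpose⟩
    rw [← transpose_transpose Q]
    exact isCocartesian_transpose h
  have h1 := D.restr_iota_rev Y (j := 0) (k := 1) (by decide) (by decide)
  have h2 := D.restr_iota_rev Y (j := 1) (k := 2) (by decide) (by decide)
  constructor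
  · intro ⟨a, b, c, d⟩
    rw [h1] at a
    rw [h2] at b
    exact ⟨(hc _).1 b, (hc _).1 a, (D.isZero_rev_iff Y 1 0).1 d, (D.isZero_rev_iff Y 0 2).1 c⟩
  · intro ⟨a, b, c, d⟩
    refine ⟨?_, ?_, (D.isZero_rev_iff Y 0 2).2 d, (D.isZero_rev_iff Y 1 0).2 c⟩
    · rw [h1]
      exact (hc _).2 b
    · rw [h2]
      exact (hc _).2 a

end Reversal

/-! ### Signs -/

section Units

variable {E : Type*} [Category* E] [Preadditive E]

lemma smul_smul_of_units (ε : ℤˣ) {X Y : E} (f : X ⟶ Y) : (ε : ℤ) • (ε : ℤ) • f = f := by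
  simp [smul_smul]

/-- The multiplication by a sign. -/
def signIso (ε : ℤˣ) (X : E) : X ≅ X where
  hom := (ε : ℤ) • 𝟙 X
  inv := (ε : ℤ) • 𝟙 X
  hom_inv_id := by simp [smul_smul]
  inv_hom_id := by simp [smul_smul]

lemma smul_comp_signIso (ε ε' : ℤˣ) {X Y : E} (f : X ⟶ Y) :
    ((ε : ℤ) • f) ≫ (signIso ε' Y).hom = ((ε * ε' : ℤˣ) : ℤ) • f := by
  simp [signIso, smul_smul, mul_comm]

lemma signIso_comp_smul (ε ε' : ℤˣ) {X Y : E} (f : X ⟶ Y) :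
    (signIso ε X).hom ≫ ((ε' : ℤ) • f) = ((ε * ε' : ℤˣ) : ℤ) • f := by
  simp [signIso, smul_smul, mul_comm]

end Units

section Signs

variable {D : Prederivator.{w, v, u}} [D.HasKan] [Preadditive (D.Diag OneCat.{w})]

lemma Triangle.Iso.signs {S T : D.Triangle} (h : S.Iso T) (ε₁ ε₂ ε₃ : ℤˣ) :
    (S.signs ε₁ ε₂ ε₃).Iso (T.signs ε₁ ε₂ ε₃) := by
  obtain ⟨a, b, c, hf, hg, hh⟩ := h
  refine ⟨a, b, c, ?_, ?_, ?_⟩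
  · simp [Triangle.signs, hf]
  · simp [Triangle.signs, hg]
  · simp [Triangle.signs, hh]

/-- Rescaling `y` by `ε₁` and `z` by `ε₁ε₂` moves all signs to the last map. As `x` is left alone,
additivity of `Σ` plays no role. -/
lemma Triangle.signs_iso (T : D.Triangle) (ε₁ ε₂ ε₃ : ℤˣ) :
    (T.signs ε₁ ε₂ ε₃).Iso (T.signs 1 1 (ε₁ * ε₂ * ε₃)) := by
  refine ⟨CategoryTheory.Iso.refl _, signIso ε₁ _, signIso (ε₁ * ε₂) _, ?_, ?_, ?_⟩
  · exact (smul_comp_signIso ε₁ ε₁ T.f).trans (by rw [Int.units_mul_self]; exact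
      (Category.id_comp _).symm)
  · refine (smul_comp_signIso ε₂ (ε₁ * ε₂) T.g).trans (Eq.trans ?_ (signIso_comp_smul ε₁ 1 T.g).symm)
    rw [mul_left_comm, Int.units_mul_self]
  · refine Eq.trans ?_ (signIso_comp_smul (ε₁ * ε₂) (ε₁ * ε₂ * ε₃) T.h).symm
    rw [← mul_assoc, Int.units_mul_self, one_mul]
    exact (congrArg (fun t => _ ≫ t) (D.susp.map_id T.x)).trans (Category.comp_id _)

lemma Triangle.signs_signs (T : D.Triangle) : (T.signs 1 1 (-1)).signs 1 1 (-1) = T := by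
  have (ε : ℤˣ) {a b : D.Diag OneCat.{w}} (f : a ⟶ b) : (ε : ℤ) • (ε : ℤ) • f = f :=
    smul_smul_of_units ε f
  obtain ⟨f, g, h⟩ := T
  change Triangle.mk _ _ _ = _
  congr 1
  · exact this 1 f
  · exact this 1 g
  · exact this (-1) h

end Signs

/-! ### The sign of a transposition -/

section Comparison

lemma IsSuspSquare.comparison_congr {D : Prederivator.{w, v, u}} [D.HasKan] {Q Q' : D.Diag Sq.{w}}
    (h : D.IsSuspSquare Q) (e : Q' = Q)
    {φ : (D.ev (sq 1 1)).obj Q ⟶ D.susp.obj ((D.ev (sq 0 0)).obj Q)}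
    {φ' : (D.ev (sq 1 1)).obj Q' ⟶ D.susp.obj ((D.ev (sq 0 0)).obj Q')}
    (hφ : D.IsSuspComparison Q φ) (hφ' : D.IsSuspComparison Q' φ') :
    φ' = eqToHom (congrArg (D.ev (sq 1 1)).obj e) ≫ φ ≫
      D.susp.map (eqToHom (congrArg (D.ev (sq 0 0)).obj e).symm) := by
  subst e
  simpa using h.comparison_unique hφ' hφ

variable {D : Prederivator.{w, v, u}}

lemma ev₀₀_transpose (Q : D.Diag Sq.{w}) :
    (D.ev (sq 0 0)).obj (D.transpose Q) = (D.ev (sq 0 0)).obj Q :=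
  D.restr_obj_eq' (p := pt (sq 0 0)) (f := swapSq) (q := pt (sq 0 0)) rfl Q

lemma ev₁₁_transpose (Q : D.Diag Sq.{w}) :
    (D.ev (sq 1 1)).obj (D.transpose Q) = (D.ev (sq 1 1)).obj Q :=
  D.restr_obj_eq' (p := pt (sq 1 1)) (f := swapSq) (q := pt (sq 1 1)) rfl Q

/-- The transposition of a bicartesian square changes the sign of the canonical isomorphism. -/
lemma IsLoopSquare.comparison_transpose [D.IsStable] [Preadditive (D.Diag OneCat.{w})]
    {Q : D.Diag Sq.{w}} (h : D.IsLoopSquare Q) :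
    h.transpose.comparison = -(eqToHom (ev₁₁_transpose Q) ≫ h.comparison ≫
      D.susp.map (eqToHom (ev₀₀_transpose Q).symm)) := by
  -- Naturality of the comparison along `t : Q ⟶ Qᵀ` yields the formula: `t` is the identity at
  -- `(0,0)` and `-1` at `(1,1)`.
  obtain ⟨t, ht⟩ := exists_swap h
  have ht' := pull_swap_eq_neg h t ht
  have h0 : (D.ev (sq 0 0)).map (eqToHom (D.restr_id_obj Q).symm ≫ t) =
      eqToHom (ev₀₀_transpose Q).symm := by
    have := congrArg (fun s => s ≫ eqToHom (ev₀₀_transpose Q).symm) ht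
    simp only [pull, Category.assoc, eqToHom_trans, eqToHom_refl, Category.comp_id,
      Category.id_comp] at this
    rw [Functor.map_comp, eqToHom_map]
    exact this
  have h1 : (D.ev (sq 1 1)).map (eqToHom (D.restr_id_obj Q).symm ≫ t) =
      -eqToHom (ev₁₁_transpose Q).symm := by
    have := congrArg (fun s => s ≫ eqToHom (ev₁₁_transpose Q).symm) ht'
    simp only [pull, Category.assoc, eqToHom_trans, eqToHom_refl, Category.comp_id,
      Preadditive.neg_comp, Category.id_comp] at this
    rw [Functor.map_comp, eqToHom_map]
    exact this
  have := h.isSuspSquare.comparison_naturality (eqToHom (D.restr_id_obj Q).symm ≫ t)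
    h.isSuspComparison h.transpose.isSuspComparison
  rw [h0, h1] at this
  rw [← this]
  simp

end Comparison

/-! ### Distinguished triangles of both derivators in terms of the same cofiber sequences -/

section CofiberSequence

variable {D : Prederivator.{w, v, u}} [D.IsStable]

lemma IsCofiberSequence.isLoopSquare_outer {Y : D.Diag Rect.{w}} (h : D.IsCofiberSequence Y) :
    D.IsLoopSquare (D.outer Y) :=
  isLoopSquare_of_isCocartesian ((isZero_ev_restr_iff (iota 0 2 (by decide)) (sq 0 1) Y).2 h.isZero₀₂)
    ((isZero_ev_restr_iff (iota 0 2 (by decide)) (sq 1 0) Y).2 h.isZero₁₀)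
    (isCocartesian_outer h.left h.right)

/-- The diagram `x ⟶ y ⟶ z ⟶ w` given by a cofiber sequence, with the transposed outer
rectangle. -/
noncomputable def IsCofiberSequence.loopTriangle {Y : D.Diag Rect.{w}}
    (h : D.IsCofiberSequence Y) : D.LoopTriangle where
  Q := D.transpose (D.outer Y)
  isLoopSquare := h.isLoopSquare_outer.transpose
  f := eqToHom ((ev₀₀_transpose _).trans (D.outer_ev₀₀ Y)) ≫
    D.evMap Y (homOfLE (by simp [rect] : rect 0 0 ≤ rect 0 1))
  g := D.evMap Y (homOfLE (by simp [rect] : rect 0 1 ≤ rect 1 1))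
  h := D.evMap Y (homOfLE (by simp [rect] : rect 1 1 ≤ rect 1 2)) ≫
    eqToHom ((ev₁₁_transpose _).trans (D.outer_ev₁₁ Y)).symm

/-- The outer rectangle enters only through the last map, which its transposition negates. -/
lemma IsCofiberSequence.signs_triangleOf_iso [Preadditive (D.Diag OneCat.{w})] {Y : D.Diag Rect.{w}}
    (h : D.IsCofiberSequence Y) :
    ((D.triangleOf Y h.isLoopSquare_outer.comparison).signs 1 1 (-1)).Iso
      h.loopTriangle.toTriangle := by
  refine ⟨eqToIso ((ev₀₀_transpose _).trans (D.outer_ev₀₀ Y)).symm, CategoryTheory.Iso.refl _,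
    CategoryTheory.Iso.refl _, ?_, ?_, ?_⟩
  · simp [Triangle.signs, triangleOf, loopTriangle, LoopTriangle.toTriangle]
  · simp [Triangle.signs, triangleOf, loopTriangle, LoopTriangle.toTriangle]
  · simp [Triangle.signs, triangleOf, loopTriangle, LoopTriangle.toTriangle,
      h.isLoopSquare_outer.comparison_transpose, eqToHom_map]

/-- No sign occurs here: the outer rectangle of the reversed sequence is the flip of the transposed
rectangle used in `loopTriangle`. -/
lemma IsCofiberSequence.triangleOf_rev_iso {Y : D.Diag Rect.{w}} (h : D.IsCofiberSequence Y)
    {ψ : (D.opposite.ev (sq 1 1)).obj (D.opposite.outer (D.rev Y)) ⟶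
      D.opposite.susp.obj ((D.opposite.ev (sq 0 0)).obj (D.opposite.outer (D.rev Y)))}
    (hψ : D.opposite.IsSuspComparison (D.opposite.outer (D.rev Y)) ψ) :
    (D.opposite.triangleOf (D.rev Y) ψ).Iso h.loopTriangle.toOppositeTriangle := by
  have hL := h.isLoopSquare_outer.transpose
  obtain rfl := hL.isSuspSquare_flip.comparison_congr (D.opposite_outer_rev Y)
    hL.isSuspComparison_flip hψ
  have e1 := (ev₁₁_transpose _).trans (D.outer_ev₁₁ Y)
  have e := (D.rev_ev Y 0 0).trans (congrArg (fun t => D.toOpposite.obj (op t)) e1.symm)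
  refine ⟨eqToIso e, eqToIso (D.rev_ev Y 0 1), eqToIso (D.rev_ev Y 1 1), ?_, ?_, ?_⟩
  · dsimp only [triangleOf, loopTriangle, LoopTriangle.toOppositeTriangle, eqToIso.hom]
    rw [D.evMap_rev Y (i := 0) (j := 0) (i' := 0) (j' := 1) _
      (homOfLE (by simp [rect] : rect.{w} 1 1 ≤ rect 1 2))]
    simp [eqToHom_map]
  · dsimp only [triangleOf, loopTriangle, LoopTriangle.toOppositeTriangle, eqToIso.hom]
    rw [D.evMap_rev Y (i := 0) (j := 1) (i' := 1) (j' := 1) _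
      (homOfLE (by simp [rect] : rect.{w} 0 1 ≤ rect 1 1))]
    simp
  · dsimp only [triangleOf, loopTriangle, LoopTriangle.toOppositeTriangle, eqToIso.hom]
    rw [D.evMap_rev Y (i := 1) (j := 1) (i' := 1) (j' := 2) _
      (homOfLE (by simp [rect] : rect.{w} 0 0 ≤ rect 0 1))]
    simp [eqToHom_map, IsLoopSquare.opComparison]

/-- The signs amount to one `-1` on the last map, which cancels the sign coming from the
transposition. -/
lemma Triangle.isDistinguished_signs_iff [Preadditive (D.Diag OneCat.{w})] {ε₁ ε₂ ε₃ : ℤˣ}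
    (hε : ε₁ * ε₂ * ε₃ = -1) (T : D.Triangle) : (T.signs ε₁ ε₂ ε₃).IsDistinguished ↔
      ∃ (Y : D.Diag Rect.{w}) (h : D.IsCofiberSequence Y), T.Iso h.loopTriangle.toTriangle := by
  have hT := T.signs_iso ε₁ ε₂ ε₃
  rw [hε] at hT
  constructor
  · rintro ⟨Y, φ, h, hφ, hY⟩
    obtain rfl := h.isLoopSquare_outer.isSuspSquare.comparison_unique hφ
      h.isLoopSquare_outer.isSuspComparison
    refine ⟨Y, h, Iso.trans ?_ h.signs_triangleOf_iso⟩
    have := (hT.symm.trans hY).signs 1 1 (-1)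
    rwa [signs_signs] at this
  · rintro ⟨Y, h, hY⟩
    refine ⟨Y, _, h, h.isLoopSquare_outer.isSuspComparison, hT.trans ?_⟩
    have := (hY.trans h.signs_triangleOf_iso.symm).signs 1 1 (-1)
    rwa [signs_signs] at this

lemma Triangle.opposite_isDistinguished_iff (T' : D.opposite.Triangle) : T'.IsDistinguished ↔
    ∃ (Y : D.Diag Rect.{w}) (h : D.IsCofiberSequence Y),
      T'.Iso h.loopTriangle.toOppositeTriangle := by
  constructor
  · rintro ⟨X, ψ, h, hψ, hX⟩
    obtain ⟨Y, rfl⟩ := D.exists_rev X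
    rw [isCofiberSequence_rev_iff] at h
    exact ⟨Y, h, hX.trans (h.triangleOf_rev_iso hψ)⟩
  · rintro ⟨Y, h, hY⟩
    have hs : D.opposite.IsSuspSquare (D.opposite.outer (D.rev Y)) := by
      rw [opposite_outer_rev]
      exact h.isLoopSquare_outer.transpose.isSuspSquare_flip
    obtain ⟨ψ, hψ⟩ := hs.exists_comparison
    exact ⟨D.rev Y, ψ, (isCofiberSequence_rev_iff Y).2 h, hψ,
      hY.trans (h.triangleOf_rev_iso hψ).symm⟩

end CofiberSequence

end Prederivator

end Derivators

theorem mainTheorem10 (D : Derivators.Prederivator.{w, v, u}) [D.IsStable] :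
    Nonempty (Preadditive (D.Diag Derivators.OneCat.{w})) ∧
    ∀ [Preadditive (D.Diag Derivators.OneCat.{w})] (ε₁ ε₂ ε₃ : ℤˣ), ε₁ * ε₂ * ε₃ = -1 →
      (∀ T : D.Triangle, (T.signs ε₁ ε₂ ε₃).IsDistinguished ↔
        ∃ T' : D.opposite.Triangle, T.CorrespondsTo T' ∧ T'.IsDistinguished) ∧
      (∀ T' : D.opposite.Triangle, T'.IsDistinguished ↔
        ∃ T : D.Triangle, T.CorrespondsTo T' ∧ (T.signs ε₁ ε₂ ε₃).IsDistinguished) := by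
  refine ⟨Derivators.Prederivator.nonempty_preadditive_diag, fun {_} ε₁ ε₂ ε₃ hε =>
    ⟨fun T => ?_, fun T' => ?_⟩⟩
  · rw [Derivators.Prederivator.Triangle.isDistinguished_signs_iff hε]
    constructor
    · rintro ⟨Y, h, hY⟩
      exact ⟨_, (Derivators.Prederivator.Triangle.correspondsTo_iff _ _).2 ⟨h.loopTriangle, hY, .refl _⟩,
        (Derivators.Prederivator.Triangle.opposite_isDistinguished_iff _).2 ⟨Y, h, .refl _⟩⟩
    -- `S` and the diagram of `Y` have isomorphic opposite triangles, hence isomorphic triangles in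
    -- `D(𝟙)`. The second statement uses the reverse implication.
    · rintro ⟨T', hT, hT'⟩
      obtain ⟨S, hS, hS'⟩ := (Derivators.Prederivator.Triangle.correspondsTo_iff _ _).1 hT
      obtain ⟨Y, h, hY⟩ :=
        (Derivators.Prederivator.Triangle.opposite_isDistinguished_iff _).1 hT'
      exact ⟨Y, h, hS.trans ((S.toTriangle_iso_iff_toOppositeTriangle_iso _).2
        (hS'.symm.trans hY))⟩
  · rw [Derivators.Prederivator.Triangle.opposite_isDistinguished_iff]
    constructor
    · rintro ⟨Y, h, hY⟩
      exact ⟨_, (Derivators.Prederivator.Triangle.correspondsTo_iff _ _).2 ⟨h.loopTriangle, .refl _, hY⟩,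
        (Derivators.Prederivator.Triangle.isDistinguished_signs_iff hε _).2 ⟨Y, h, .refl _⟩⟩
    · rintro ⟨T, hT, hT'⟩
      obtain ⟨S, hS, hS'⟩ := (Derivators.Prederivator.Triangle.correspondsTo_iff _ _).1 hT
      obtain ⟨Y, h, hY⟩ :=
        (Derivators.Prederivator.Triangle.isDistinguished_signs_iff hε _).1 hT'
      exact ⟨Y, h, hS'.trans ((S.toTriangle_iso_iff_toOppositeTriangle_iso _).1
        (hS.symm.trans hY))⟩
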